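/- Let $\phi_0=1$, $\phi_{2m-1}(x)=\sqrt2\sin(2\pi m x)$, $\phi_{2m}(x)=\sqrt2\cos(2\pi m x)$ ($m\ge 1$) be the Fourier basis of $L^2[0,1]$. For a sequence $\theta=(\theta_j)_{j\ge1}$ let $P_\theta$ be the probability measure on $[0,1]$ with Lebesgue density $\exp\big(\sum_{j\ge1}\theta_j\phi_j(x)-c(\theta)\big)$, $c(\theta)=\log\int_0^1\exp\big(\sum_{j\ge1}\theta_j\phi_j(x)\big)dx$, and let $H^2(P,Q)=\frac12\int(\sqrt{dP}-\sqrt{dQ})^2$. For $\alpha>1/2$, $B>0$ let $\Theta_\alpha(B)=\{\theta:\sum_{j\ge1}j^{2\alpha}\theta_j^2\le B^2\}$ and, for $n\ge2$, $k_0=k_0(n)=\lceil (n/\log n)^{1/(2\alpha+1)}\rceil$. Let $\pi$ be a probability distribution on $\{0,1,2,\dots\}$ and $f_1,f_2,\dots$ probability densities on $\mathbb R$, none of them depending on $n$. The prior $\Pi$ on $\theta$ is: sample $k\sim\pi$; given $k$, sample independently $\theta_j\sim f_j$ for $1\le j\le k$ and set $\theta_j=0$ for $j>k$. Suppose that, for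 some $n_0\ge2$ and constants $C_1,C_2,C_3,C_4,c_1,\beta,c_1'>0$, $c_0,c_0'\in\mathbb R$ (with $-\log 0=+\infty$): 1. $\sum_{j\ge k}\pi(j)\le C_1\exp(-C_2k\log k)$ for all $k\ge1$; 2. $\pi(k_0)\ge C_3\exp(-C_4k_0\log k_0)$ for all $n\ge n_0$; 3. $-\log f_j(x)\ge c_0+c_1|x|^\beta$ for all $x\in\mathbb R$, $1\le j\le k_0$, $n\ge n_0$; 4. $-\log f_j(x)\le c_0'+c_1'j^{2\alpha+1}x^2$ for all $x\in\mathbb R$, $1\le j\le k_0$, $n\ge n_0$. Let $X=(X_1,\dots,X_n)$ be i.i.d. from $P_{\theta^*}$, let $\Pi(\cdot|X)$ be the posterior, $d\Pi(\theta|X)\propto\prod_{i=1}^n\frac{dP_\theta}{d\ell}(X_i)\,d\Pi(\theta)$ with $\ell$ the Lebesgue measure on $[0,1]$, let $\mathcal S_G=\{\otimes_{j\ge1}N(\mu_j,\sigma_j^2):\mu_j\in\mathbb R,\ \sigma_j^2\ge0\}$ with $N(\mu,0)=\delta_\mu$, and let $\widehat Q=\widehat Q_X$ be a minimizer of the Kullback–Leibler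 divergence $D(Q\,\|\,\Pi(\cdot|X))$ over $Q\in\mathcal S_G$. Then there is a constant $M>0$, depending only on $\alpha,B,n_0,C_1,\dots,C_4,c_0,c_1,\beta,c_0',c_1'$, such that for all $n\ge n_0$ and all $\theta^*\in\Theta_\alpha(B)$, $$\mathbb E_{X\sim P_{\theta^*}^n}\left[\int H^2(P_\theta,P_{\theta^*})\,d\widehat Q_X(\theta)\right]\le M\,n^{-\frac{2\alpha}{2\alpha+1}}(\log n)^{\frac{2\alpha}{2\alpha+1}}.$$ -/

import Mathlib

open MeasureTheory ProbabilityTheory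
open scoped ENNReal NNReal

noncomputable section

namespace VBDensity

/-! Infinite-dimensional exponential family on `[0,1]`. Parameters are sequences
`θ = (θ_1, θ_2, …)`, that is functions `ℕ+ → ℝ` with the product `σ`-algebra. -/

/-- The real Fourier basis of `L²[0,1]`: `φ_0 = 1`, `φ_{2m-1}(x) = √2 sin(2πmx)` and
`φ_{2m}(x) = √2 cos(2πmx)` for `m ≥ 1`. -/
def trigBasis (j : ℕ) (x : ℝ) : ℝ :=
  if j = 0 then 1
  else if Odd j then Real.sqrt 2 * Real.sin (2 * Real.pi * (((j + 1) / 2 : ℕ) : ℝ) * x)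
  else Real.sqrt 2 * Real.cos (2 * Real.pi * ((j / 2 : ℕ) : ℝ) * x)

/-- The series `∑_{j ≥ 1} θ_j φ_j(x)` (the coefficient of `φ_0` is `0`). -/
def logSeries (θ : ℕ+ → ℝ) (x : ℝ) : ℝ := ∑' j : ℕ+, θ j * trigBasis j x

/-- The normalization `c(θ) = log ∫₀¹ exp (∑_j θ_j φ_j(x)) dx`. -/
def logPartition (θ : ℕ+ → ℝ) : ℝ :=
  Real.log (∫ x in Set.Icc (0 : ℝ) 1, Real.exp (logSeries θ x))

/-- The Lebesgue density on `[0,1]` of `P_θ`. -/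
def expDensity (θ : ℕ+ → ℝ) (x : ℝ) : ℝ := Real.exp (logSeries θ x - logPartition θ)

/-- The probability measure `P_θ` on `[0,1]`, regarded as a measure on `ℝ` carried by `[0,1]`. -/
def expFamily (θ : ℕ+ → ℝ) : Measure ℝ :=
  (volume.restrict (Set.Icc (0 : ℝ) 1)).withDensity fun x => ENNReal.ofReal (expDensity θ x)

/-- The law `P_θ^n` of `n` independent observations from `P_θ`. -/
def sampleLaw (n : ℕ) (θ : ℕ+ → ℝ) : Measure (Fin n → ℝ) := Measure.pi fun _ => expFamily θ

/-- The likelihood `dP_θ^n/dℓ^n (X) = ∏_i (dP_θ/dℓ)(X_i)`. -/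
def likelihood {n : ℕ} (X : Fin n → ℝ) (θ : ℕ+ → ℝ) : ℝ≥0∞ :=
  ∏ i, ENNReal.ofReal (expDensity θ (X i))

/-- The Sobolev ball `Θ_α(B) = {θ : ∑_j j^{2α} θ_j² ≤ B²}`. -/
def sobolevBall (α B : ℝ) : Set (ℕ+ → ℝ) :=
  {θ | Summable (fun j : ℕ+ => ((j : ℕ) : ℝ) ^ (2 * α) * θ j ^ 2) ∧
    ∑' j : ℕ+, ((j : ℕ) : ℝ) ^ (2 * α) * θ j ^ 2 ≤ B ^ 2}

/-- The squared Hellinger distance `H²(P, Q) = ½ ∫ (√dP - √dQ)²`, computed with the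
dominating measure `P + Q` (the value does not depend on the dominating measure). -/
def hellingerSq {Ω : Type*} [MeasurableSpace Ω] (P Q : Measure Ω) : ℝ :=
  1 / 2 * ∫ x, (Real.sqrt (P.rnDeriv (P + Q) x).toReal
    - Real.sqrt (Q.rnDeriv (P + Q) x).toReal) ^ 2 ∂(P + Q)

/-- `g` is a probability density on `ℝ` with respect to Lebesgue measure. -/
structure IsProbDensity (g : ℝ → ℝ) : Prop where
  measurable : Measurable g
  nonneg : ∀ x, 0 ≤ g x
  lintegral_eq_one : ∫⁻ x, ENNReal.ofReal (g x) = 1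

/-- The law of `θ` given `k`: independent coordinates, `θ_j ∼ f_j` for `j ≤ k` and `θ_j = 0`
for `j > k`. -/
def sieveComponent (f : ℕ+ → ℝ → ℝ) (k : ℕ) : Measure (ℕ+ → ℝ) :=
  Measure.infinitePi fun j : ℕ+ =>
    if (j : ℕ) ≤ k then volume.withDensity (fun x => ENNReal.ofReal (f j x))
    else Measure.dirac 0

/-- The sieve prior: sample `k ∼ π`, then `θ` from the component with index `k`. -/
def sievePrior (π : PMF ℕ) (f : ℕ+ → ℝ → ℝ) : Measure (ℕ+ → ℝ) :=
  Measure.sum fun k : ℕ => π k • sieveComponent f k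

/-- The posterior `dΠ(θ|X) = dP_θ^n(X) dΠ(θ) / ∫ dP_θ^n(X) dΠ(θ)`. -/
def bayesPosterior {n : ℕ} (Pr : Measure (ℕ+ → ℝ)) (X : Fin n → ℝ) : Measure (ℕ+ → ℝ) :=
  (∫⁻ θ, likelihood X θ ∂Pr)⁻¹ • Pr.withDensity (likelihood X)

/-- The Gaussian mean-field family: all products `⊗_j N(μ_j, σ_j²)` with `σ_j² ≥ 0`, where
`N(μ, 0)` is the point mass at `μ`. -/
def gaussianMeanField : Set (Measure (ℕ+ → ℝ)) :=
  {Q | ∃ (μ : ℕ+ → ℝ) (v : ℕ+ → ℝ≥0), Q = Measure.infinitePi fun j => gaussianReal (μ j) (v j)}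

/-- `Q` minimizes the Kullback–Leibler divergence `D(· ‖ R)` over the class `S`. -/
def IsVariationalPosterior {Θ : Type*} [MeasurableSpace Θ] (S : Set (Measure Θ))
    (R Q : Measure Θ) : Prop :=
  Q ∈ S ∧ ∀ Q' ∈ S, InformationTheory.klDiv Q R ≤ InformationTheory.klDiv Q' R

/-- `k₀ = ⌈(n / log n)^{1/(2α+1)}⌉`. -/
def sieveDim (α : ℝ) (n : ℕ) : ℕ := ⌈((n : ℝ) / Real.log n) ^ (1 / (2 * α + 1))⌉₊

/-- `∑_{j ≥ k} π(j) ≤ C₁ exp(-C₂ k log k)` for all `k ≥ 1`. -/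
def PriorTail (π : PMF ℕ) (C₁ C₂ : ℝ) : Prop :=
  ∀ k : ℕ, 1 ≤ k →
    ∑' j : Set.Ici k, π j ≤ ENNReal.ofReal (C₁ * Real.exp (-C₂ * k * Real.log k))

/-- `π(k₀) ≥ C₃ exp(-C₄ k₀ log k₀)` for all `n ≥ n₀`. -/
def PriorMass (α : ℝ) (n₀ : ℕ) (π : PMF ℕ) (C₃ C₄ : ℝ) : Prop :=
  ∀ n : ℕ, n₀ ≤ n →
    ENNReal.ofReal (C₃ * Real.exp (-C₄ * sieveDim α n * Real.log (sieveDim α n)))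
      ≤ π (sieveDim α n)

/-- `-log f_j(x) ≥ c₀ + c₁ |x|^β` for all real `x`, `j ≤ k₀` and `n ≥ n₀`, with `-log 0 = +∞`. -/
def DensityUpper (α : ℝ) (n₀ : ℕ) (f : ℕ+ → ℝ → ℝ) (c₀ c₁ β : ℝ) : Prop :=
  ∀ n : ℕ, n₀ ≤ n → ∀ j : ℕ+, (j : ℕ) ≤ sieveDim α n → ∀ x : ℝ,
    0 < f j x → c₀ + c₁ * |x| ^ β ≤ -Real.log (f j x)

/-- `-log f_j(x) ≤ c₀' + c₁' j^{2α+1} x²` for all real `x`, `j ≤ k₀` and `n ≥ n₀`, with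
`-log 0 = +∞`. -/
def DensityLower (α : ℝ) (n₀ : ℕ) (f : ℕ+ → ℝ → ℝ) (c₀' c₁' : ℝ) : Prop :=
  ∀ n : ℕ, n₀ ≤ n → ∀ j : ℕ+, (j : ℕ) ≤ sieveDim α n → ∀ x : ℝ,
    0 < f j x ∧ -Real.log (f j x) ≤ c₀' + c₁' * ((j : ℕ) : ℝ) ^ (2 * α + 1) * x ^ 2

end VBDensity

end

open VBDensity

namespace VBDensity

/-! ### The trigonometric basis -/

/-- Lebesgue measure on the unit interval. -/
local notation "ℓ" => (volume.restrict (Set.Icc (0 : ℝ) 1) : Measure ℝ)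

/-! The risk is controlled through the variational characterization of the Kullback–Leibler
divergence, without tests. Donsker–Varadhan (`integral_le_klDiv_add_log`) applied to `t n H²` bounds
`t n ∫ H² dQ̂` by `D(Q̂ ‖ posterior) + log ∫ exp(t n H²) dposterior`. Minimality of `Q̂` replaces
the first term by the divergence of one explicit Gaussian product, `sieveGaussian`: centred at the
truncation of the true parameter to `k₀` coordinates, with variance `1/n` in each of them. The log
evidence enters that divergence with a plus sign and the posterior moment with a minus sign, so it
cancels (`lintegral_hellingerSq_variational_le`). What remains is the cost of the Gaussian and the
logarithm of the evidence weighted by `exp(t n H²)`.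

The weighted evidence, divided by the true likelihood, is controlled through its moment of order `1
- t`. The parameter space is cut into cells of mesh `1/(n j²)` in coordinate `j`, fine enough that
likelihood and weight change by bounded factors up to a doubling of `t` (`likelihood_mul_exp_le`).
The power `1 - t` is subadditive, so it passes to each cell. There the affinity bound `∫ p^(1-t) q^t
≤ exp(-2 t H²)`, tensorized over the sample, cancels the weight
(`lintegral_envelope_ratio_rpow_le`). The sum left over involves only the prior: each coordinate
costs a factor of order `(n k²)^t`. For small `t` the tail of `π` absorbs this when `k ≥ k₀`, and
smaller `k` cost at most `exp(k₀ log n)` (`tsum_prior_rpow_mul_le`).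

In expectation the Gaussian cost consists of the ratio of the Gaussian to the prior densities and of
`-log π(k₀)`, both of order `k₀ log n`, plus `n` times the expected divergence of `P_θ` from the
truth, which is of order `k₀^(-2α) + k₀/n` (`approximation_le`). The choice of `k₀` balances `n
k₀^(-2α)` against `k₀ log n`, and division by `t n` gives the rate. -/

instance isProbabilityMeasure_unitInterval : IsProbabilityMeasure ℓ :=
  ⟨by simp⟩

theorem continuous_trigBasis (j : ℕ) : Continuous (trigBasis j) := by
  unfold trigBasis
  split_ifs <;> fun_prop

theorem abs_trigBasis_le (j : ℕ) (x : ℝ) : |trigBasis j x| ≤ Real.sqrt 2 := by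
  unfold trigBasis
  split_ifs
  · simp
  · rw [abs_mul, abs_of_nonneg (Real.sqrt_nonneg 2)]
    exact mul_le_of_le_one_right (Real.sqrt_nonneg 2) (Real.abs_sin_le_one _)
  · rw [abs_mul, abs_of_nonneg (Real.sqrt_nonneg 2)]
    exact mul_le_of_le_one_right (Real.sqrt_nonneg 2) (Real.abs_cos_le_one _)

theorem sq_trigBasis_le (j : ℕ) (x : ℝ) : trigBasis j x ^ 2 ≤ 2 := by
  rw [← sq_abs, ← Real.sq_sqrt (show (0 : ℝ) ≤ 2 by norm_num)]
  exact pow_le_pow_left₀ (abs_nonneg _) (abs_trigBasis_le j x) 2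

theorem integral_cos_two_pi_int (m : ℤ) :
    ∫ x in Set.Icc (0 : ℝ) 1, Real.cos (2 * Real.pi * m * x) = if m = 0 then 1 else 0 := by
  rw [integral_Icc_eq_integral_Ioc, ← intervalIntegral.integral_of_le zero_le_one]
  split_ifs with h
  · simp [h]
  · have h' : 2 * Real.pi * (m : ℝ) ≠ 0 := by
      have : (m : ℝ) ≠ 0 := by exact_mod_cast h
      positivity
    rw [intervalIntegral.integral_comp_mul_left (fun y => Real.cos y) h', integral_cos]
    have h2 : 2 * Real.pi * (m : ℝ) * 1 = ((2 * m : ℤ) : ℝ) * Real.pi := by push_cast; ring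
    rw [h2, Real.sin_int_mul_pi]
    simp

theorem integral_sin_two_pi_int (m : ℤ) :
    ∫ x in Set.Icc (0 : ℝ) 1, Real.sin (2 * Real.pi * m * x) = 0 := by
  rw [integral_Icc_eq_integral_Ioc, ← intervalIntegral.integral_of_le zero_le_one]
  by_cases h : m = 0
  · simp [h]
  · have h' : 2 * Real.pi * (m : ℝ) ≠ 0 := by
      have : (m : ℝ) ≠ 0 := by exact_mod_cast h
      positivity
    rw [intervalIntegral.integral_comp_mul_left (fun y => Real.sin y) h', integral_sin]
    have h2 : 2 * Real.pi * (m : ℝ) * 1 = (m : ℝ) * (2 * Real.pi) := by ring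
    rw [h2, Real.cos_int_mul_two_pi]
    simp

theorem integrable_unitInterval_of_continuous {f : ℝ → ℝ} (hf : Continuous f) :
    Integrable f ℓ :=
  hf.integrableOn_Icc

/-- Product-to-sum formulas leave integer frequencies, and only a vanishing difference of cosine
type survives integration. The sine of index `2a+1` has frequency `a+1`, whence the shifts. -/
theorem integral_trigBasis_mul (i j : ℕ) (hi : i ≠ 0) (hj : j ≠ 0) :
    ∫ x in Set.Icc (0 : ℝ) 1, trigBasis i x * trigBasis j x = if i = j then 1 else 0 := by
  have hc : ∀ m : ℤ, Integrable (fun x : ℝ => Real.cos (2 * Real.pi * m * x)) ℓ := fun m =>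
    integrable_unitInterval_of_continuous (by fun_prop)
  have hs : ∀ m : ℤ, Integrable (fun x : ℝ => Real.sin (2 * Real.pi * m * x)) ℓ := fun m =>
    integrable_unitInterval_of_continuous (by fun_prop)
  have h2 : Real.sqrt 2 * Real.sqrt 2 = 2 := Real.mul_self_sqrt (by norm_num)
  rcases Nat.even_or_odd i with hi' | hi' <;> rcases Nat.even_or_odd j with hj' | hj'
  · obtain ⟨a, rfl⟩ := hi'
    obtain ⟨b, rfl⟩ := hj'
    have e : ∀ x : ℝ, trigBasis (a + a) x * trigBasis (b + b) x
        = Real.cos (2 * Real.pi * ((a - b : ℤ) : ℝ) * x)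
          + Real.cos (2 * Real.pi * ((a + b : ℤ) : ℝ) * x) := by
      intro x
      have ha : (a + a) / 2 = a := by omega
      have hb : (b + b) / 2 = b := by omega
      rw [trigBasis, trigBasis, if_neg hi, if_neg hj, if_neg (by simp), if_neg (by simp), ha, hb]
      have e1 : 2 * Real.pi * ((a - b : ℤ) : ℝ) * x
        = 2 * Real.pi * a * x - 2 * Real.pi * b * x := by push_cast; ring
      have e2 : 2 * Real.pi * ((a + b : ℤ) : ℝ) * x
        = 2 * Real.pi * a * x + 2 * Real.pi * b * x := by push_cast; ring
      rw [e1, e2, Real.cos_sub, Real.cos_add]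
      linear_combination Real.cos (2 * Real.pi * a * x) * Real.cos (2 * Real.pi * b * x) * h2
    simp_rw [e]
    rw [integral_add (hc _) (hc _), integral_cos_two_pi_int, integral_cos_two_pi_int]
    grind
  · obtain ⟨a, rfl⟩ := hi'
    obtain ⟨b, rfl⟩ := hj'
    have e : ∀ x : ℝ, trigBasis (a + a) x * trigBasis (2 * b + 1) x
        = Real.sin (2 * Real.pi * ((b + 1 - a : ℤ) : ℝ) * x)
          + Real.sin (2 * Real.pi * ((b + 1 + a : ℤ) : ℝ) * x) := by
      intro x
      have ha : (a + a) / 2 = a := by omega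
      have hb : (2 * b + 1 + 1) / 2 = b + 1 := by omega
      rw [trigBasis, trigBasis, if_neg hi, if_neg hj, if_neg (by simp), if_pos (by simp), ha, hb]
      have e1 : 2 * Real.pi * ((b + 1 - a : ℤ) : ℝ) * x
        = 2 * Real.pi * ((b + 1 : ℕ) : ℝ) * x - 2 * Real.pi * a * x := by push_cast; ring
      have e2 : 2 * Real.pi * ((b + 1 + a : ℤ) : ℝ) * x
        = 2 * Real.pi * ((b + 1 : ℕ) : ℝ) * x + 2 * Real.pi * a * x := by push_cast; ring
      rw [e1, e2, Real.sin_sub, Real.sin_add]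
      linear_combination Real.cos (2 * Real.pi * a * x)
        * Real.sin (2 * Real.pi * ((b + 1 : ℕ) : ℝ) * x) * h2
    simp_rw [e]
    rw [integral_add (hs _) (hs _), integral_sin_two_pi_int, integral_sin_two_pi_int]
    grind
  · obtain ⟨a, rfl⟩ := hi'
    obtain ⟨b, rfl⟩ := hj'
    have e : ∀ x : ℝ, trigBasis (2 * a + 1) x * trigBasis (b + b) x
        = Real.sin (2 * Real.pi * ((a + 1 - b : ℤ) : ℝ) * x)
          + Real.sin (2 * Real.pi * ((a + 1 + b : ℤ) : ℝ) * x) := by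
      intro x
      have ha : (b + b) / 2 = b := by omega
      have hb : (2 * a + 1 + 1) / 2 = a + 1 := by omega
      rw [trigBasis, trigBasis, if_neg hi, if_neg hj, if_pos (by simp), if_neg (by simp), ha, hb]
      have e1 : 2 * Real.pi * ((a + 1 - b : ℤ) : ℝ) * x
        = 2 * Real.pi * ((a + 1 : ℕ) : ℝ) * x - 2 * Real.pi * b * x := by push_cast; ring
      have e2 : 2 * Real.pi * ((a + 1 + b : ℤ) : ℝ) * x
        = 2 * Real.pi * ((a + 1 : ℕ) : ℝ) * x + 2 * Real.pi * b * x := by push_cast; ring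
      rw [e1, e2, Real.sin_sub, Real.sin_add]
      linear_combination Real.cos (2 * Real.pi * b * x)
        * Real.sin (2 * Real.pi * ((a + 1 : ℕ) : ℝ) * x) * h2
    simp_rw [e]
    rw [integral_add (hs _) (hs _), integral_sin_two_pi_int, integral_sin_two_pi_int]
    grind
  · obtain ⟨a, rfl⟩ := hi'
    obtain ⟨b, rfl⟩ := hj'
    have e : ∀ x : ℝ, trigBasis (2 * a + 1) x * trigBasis (2 * b + 1) x
        = Real.cos (2 * Real.pi * ((a - b : ℤ) : ℝ) * x)
          - Real.cos (2 * Real.pi * ((a + b + 2 : ℤ) : ℝ) * x) := by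
      intro x
      have ha : (2 * a + 1 + 1) / 2 = a + 1 := by omega
      have hb : (2 * b + 1 + 1) / 2 = b + 1 := by omega
      rw [trigBasis, trigBasis, if_neg hi, if_neg hj, if_pos (by simp), if_pos (by simp), ha, hb]
      have e1 : 2 * Real.pi * ((a - b : ℤ) : ℝ) * x
        = 2 * Real.pi * ((a + 1 : ℕ) : ℝ) * x - 2 * Real.pi * ((b + 1 : ℕ) : ℝ) * x := by
          push_cast; ring
      have e2 : 2 * Real.pi * ((a + b + 2 : ℤ) : ℝ) * x
        = 2 * Real.pi * ((a + 1 : ℕ) : ℝ) * x + 2 * Real.pi * ((b + 1 : ℕ) : ℝ) * x := by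
          push_cast; ring
      rw [e1, e2, Real.cos_sub, Real.cos_add]
      linear_combination Real.sin (2 * Real.pi * ((a + 1 : ℕ) : ℝ) * x)
        * Real.sin (2 * Real.pi * ((b + 1 : ℕ) : ℝ) * x) * h2
    simp_rw [e]
    rw [integral_sub (hc _) (hc _), integral_cos_two_pi_int, integral_cos_two_pi_int]
    grind

/-! ### The log-density series for absolutely summable coefficients -/

theorem norm_logSeries_term_le (θ : ℕ+ → ℝ) (x : ℝ) (j : ℕ+) :
    ‖θ j * trigBasis j x‖ ≤ |θ j| * Real.sqrt 2 := by
  rw [norm_mul, Real.norm_eq_abs, Real.norm_eq_abs]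
  exact mul_le_mul_of_nonneg_left (abs_trigBasis_le _ _) (abs_nonneg _)

theorem summable_logSeries {θ : ℕ+ → ℝ} (hθ : Summable θ) (x : ℝ) :
    Summable fun j : ℕ+ => θ j * trigBasis j x :=
  Summable.of_norm_bounded (hθ.abs.mul_right _) (norm_logSeries_term_le θ x)

theorem continuous_logSeries {θ : ℕ+ → ℝ} (hθ : Summable θ) : Continuous (logSeries θ) :=
  continuous_tsum (fun j => continuous_const.mul (continuous_trigBasis j)) (hθ.abs.mul_right _)
    (fun j x => norm_logSeries_term_le θ x j)

theorem abs_logSeries_le {θ : ℕ+ → ℝ} (hθ : Summable θ) (x : ℝ) :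
    |logSeries θ x| ≤ Real.sqrt 2 * ∑' j, |θ j| := by
  rw [mul_comm, ← tsum_mul_right]
  exact tsum_of_norm_bounded (hθ.abs.mul_right _).hasSum (norm_logSeries_term_le θ x)

theorem logSeries_sub {θ θ' : ℕ+ → ℝ} (hθ : Summable θ) (hθ' : Summable θ') (x : ℝ) :
    logSeries (θ - θ') x = logSeries θ x - logSeries θ' x := by
  unfold logSeries
  rw [← (summable_logSeries hθ x).tsum_sub (summable_logSeries hθ' x)]
  simp [sub_mul]

/-- Absolute summability permits termwise integration. Taking for `h` first a basis function and
then the series itself yields Parseval without any `L²` theory. -/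
theorem integral_logSeries_mul {θ : ℕ+ → ℝ} (hθ : Summable θ) {h : ℝ → ℝ} (hh : Continuous h)
    {K : ℝ} (hK : ∀ x, |h x| ≤ K) :
    ∫ x in Set.Icc (0 : ℝ) 1, logSeries θ x * h x
      = ∑' j : ℕ+, θ j * ∫ x in Set.Icc (0 : ℝ) 1, trigBasis j x * h x := by
  have hint : ∀ j : ℕ+, Integrable (fun x => θ j * trigBasis j x * h x) ℓ := fun j =>
    integrable_unitInterval_of_continuous ((continuous_const.mul (continuous_trigBasis j)).mul hh)
  have hsum : Summable fun j : ℕ+ => ∫ x in Set.Icc (0 : ℝ) 1, ‖θ j * trigBasis j x * h x‖ := by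
    refine Summable.of_nonneg_of_le (fun j => integral_nonneg fun x => norm_nonneg _) (fun j => ?_)
      ((hθ.abs.mul_right (Real.sqrt 2)).mul_right K)
    calc ∫ x in Set.Icc (0 : ℝ) 1, ‖θ j * trigBasis j x * h x‖
        ≤ ∫ x in Set.Icc (0 : ℝ) 1, |θ j| * Real.sqrt 2 * K := by
          refine integral_mono (hint j).norm (integrable_const _) fun x => ?_
          simp only [norm_mul _ (h x)]
          exact mul_le_mul (norm_logSeries_term_le θ x j) (hK x) (norm_nonneg _) (by positivity)
      _ = _ := by simp
  have := integral_tsum_of_summable_integral_norm hint hsum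
  calc _ = ∫ x in Set.Icc (0 : ℝ) 1, ∑' j : ℕ+, θ j * trigBasis j x * h x := by
        simp_rw [logSeries, tsum_mul_right]
    _ = _ := by
        rw [← this]
        simp_rw [mul_assoc, integral_const_mul]

/-- Parseval's identity for the trigonometric series. -/
theorem integral_logSeries_sq {θ : ℕ+ → ℝ} (hθ : Summable θ) :
    ∫ x in Set.Icc (0 : ℝ) 1, logSeries θ x ^ 2 = ∑' j : ℕ+, θ j ^ 2 := by
  have h1 : ∀ j : ℕ+, ∫ x in Set.Icc (0 : ℝ) 1, trigBasis j x * logSeries θ x = θ j := by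
    intro j
    simp_rw [mul_comm (trigBasis j _)]
    rw [integral_logSeries_mul hθ (continuous_trigBasis j) (abs_trigBasis_le j), tsum_eq_single j]
    · rw [integral_trigBasis_mul _ _ j.ne_zero j.ne_zero]; simp
    · intro i hi
      rw [integral_trigBasis_mul _ _ i.ne_zero j.ne_zero, if_neg (fun h => hi (PNat.eq h)), mul_zero]
  simp_rw [sq]
  rw [integral_logSeries_mul hθ (continuous_logSeries hθ) (abs_logSeries_le hθ)]
  simp_rw [h1]

/-! ### Densities of the exponential family -/

section Density

variable {θ θ' : ℕ+ → ℝ}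

theorem integral_exp_logSeries_pos (hθ : Summable θ) :
    0 < ∫ x in Set.Icc (0 : ℝ) 1, Real.exp (logSeries θ x) :=
  integral_exp_pos (integrable_unitInterval_of_continuous
    (Real.continuous_exp.comp (continuous_logSeries hθ)))

theorem exp_logPartition (hθ : Summable θ) :
    Real.exp (logPartition θ) = ∫ x in Set.Icc (0 : ℝ) 1, Real.exp (logSeries θ x) :=
  Real.exp_log (integral_exp_logSeries_pos hθ)

theorem continuous_expDensity (hθ : Summable θ) : Continuous (expDensity θ) :=
  Real.continuous_exp.comp ((continuous_logSeries hθ).sub continuous_const)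

theorem expDensity_pos (θ : ℕ+ → ℝ) (x : ℝ) : 0 < expDensity θ x := Real.exp_pos _

theorem integral_expDensity (hθ : Summable θ) : ∫ x in Set.Icc (0 : ℝ) 1, expDensity θ x = 1 := by
  simp_rw [expDensity, Real.exp_sub]
  rw [integral_div, ← exp_logPartition hθ, div_self (Real.exp_ne_zero _)]

theorem integrable_expDensity (hθ : Summable θ) : Integrable (expDensity θ) ℓ :=
  integrable_unitInterval_of_continuous (continuous_expDensity hθ)

theorem lintegral_expDensity (hθ : Summable θ) :
    ∫⁻ x in Set.Icc (0 : ℝ) 1, ENNReal.ofReal (expDensity θ x) = 1 := by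
  rw [← ofReal_integral_eq_lintegral_ofReal (integrable_expDensity hθ)
    (ae_of_all _ fun x => (expDensity_pos θ x).le), integral_expDensity hθ, ENNReal.ofReal_one]

theorem isProbabilityMeasure_expFamily (hθ : Summable θ) :
    IsProbabilityMeasure (expFamily θ) :=
  ⟨by rw [expFamily, withDensity_apply _ MeasurableSet.univ, Measure.restrict_univ,
    lintegral_expDensity hθ]⟩

/-- The log-partition function is monotone and commutes with adding constants, hence 1-Lipschitz in
the sup norm of the log-density. Both the boundedness of the densities and their comparability
within a lattice cell rest on this. -/
theorem logPartition_le_of_le (hθ : Summable θ) (hθ' : Summable θ') {d : ℝ}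
    (h : ∀ x, logSeries θ x ≤ logSeries θ' x + d) : logPartition θ ≤ logPartition θ' + d := by
  rw [← Real.exp_le_exp, Real.exp_add, exp_logPartition hθ, exp_logPartition hθ',
    ← integral_mul_const]
  refine integral_mono (integrable_unitInterval_of_continuous
    (Real.continuous_exp.comp (continuous_logSeries hθ)))
    ((integrable_unitInterval_of_continuous
    (Real.continuous_exp.comp (continuous_logSeries hθ'))).mul_const _) fun x => ?_
  simp only [← Real.exp_add]
  exact Real.exp_le_exp.2 (h x)

theorem abs_logPartition_le (hθ : Summable θ) :
    |logPartition θ| ≤ Real.sqrt 2 * ∑' j, |θ j| := by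
  have h0 : Summable (0 : ℕ+ → ℝ) := summable_zero
  have hz : ∀ x, logSeries 0 x = 0 := fun x => by simp [logSeries]
  have hc : logPartition 0 = 0 := by simp [logPartition, hz]
  have hb := abs_logSeries_le hθ
  have h1 := logPartition_le_of_le hθ h0 (d := Real.sqrt 2 * ∑' j, |θ j|)
    fun x => by rw [hz, zero_add]; exact (le_abs_self _).trans (hb x)
  have h2 := logPartition_le_of_le h0 hθ (d := Real.sqrt 2 * ∑' j, |θ j|)
    fun x => by rw [hz]; linarith [(abs_le.1 (hb x)).1]
  rw [abs_le]
  constructor <;> linarith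

theorem expDensity_le_exp (hθ : Summable θ) (x : ℝ) :
    expDensity θ x ≤ Real.exp (2 * (Real.sqrt 2 * ∑' j, |θ j|)) := by
  refine Real.exp_le_exp.2 ?_
  linarith [(abs_le.1 (abs_logSeries_le hθ x)).2, (abs_le.1 (abs_logPartition_le hθ)).1]

theorem expDensity_le_of_abs_sub_le (hθ : Summable θ) (hθ' : Summable θ') {d : ℝ}
    (h : ∀ x, |logSeries θ x - logSeries θ' x| ≤ d) (x : ℝ) :
    expDensity θ x ≤ Real.exp (2 * d) * expDensity θ' x := by
  rw [expDensity, expDensity, ← Real.exp_add]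
  refine Real.exp_le_exp.2 ?_
  have := logPartition_le_of_le hθ' hθ (d := d) fun x => by linarith [(abs_le.1 (h x)).1]
  linarith [(abs_le.1 (h x)).2]

/-! ### Hellinger distance within the exponential family -/

/-- Relative to the sum of the two measures the derivatives are `p/(p+q)` and `q/(p+q)`; the factor
`p+q` lost in the square is restored by the density of the dominating measure. -/
theorem hellingerSq_expFamily (hθ : Summable θ) (hθ' : Summable θ') :
    hellingerSq (expFamily θ) (expFamily θ')
      = 1 / 2 * ∫ x in Set.Icc (0 : ℝ) 1,
          (Real.sqrt (expDensity θ x) - Real.sqrt (expDensity θ' x)) ^ 2 := by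
  set p := expDensity θ
  set q := expDensity θ'
  have hp : ∀ x, 0 < p x := expDensity_pos θ
  have hq : ∀ x, 0 < q x := expDensity_pos θ'
  have hpc : Continuous p := continuous_expDensity hθ
  have hqc : Continuous q := continuous_expDensity hθ'
  have hsum : expFamily θ + expFamily θ' = (ℓ).withDensity fun x => ENNReal.ofReal (p x + q x) := by
    rw [expFamily, expFamily, ← withDensity_add_left hpc.measurable.ennreal_ofReal]
    congr 1
    ext x
    simp only [Pi.add_apply]
    rw [ENNReal.ofReal_add (hp x).le (hq x).le]
  have hm0 : Measurable fun x => ENNReal.ofReal (p x + q x) :=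
    (hpc.add hqc).measurable.ennreal_ofReal
  have := isProbabilityMeasure_expFamily hθ
  have := isProbabilityMeasure_expFamily hθ'
  have key : ∀ r : ℝ → ℝ, Continuous r →
      ((ℓ).withDensity fun x => ENNReal.ofReal (r x)).rnDeriv (expFamily θ + expFamily θ')
        =ᵐ[expFamily θ + expFamily θ'] fun x => ENNReal.ofReal (r x / (p x + q x)) := by
    intro r hr
    have hm : Measurable fun x => ENNReal.ofReal (r x / (p x + q x)) :=
      (hr.measurable.div (hpc.add hqc).measurable).ennreal_ofReal
    have e : ((ℓ).withDensity fun x => ENNReal.ofReal (r x))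
        = (expFamily θ + expFamily θ').withDensity
          fun x => ENNReal.ofReal (r x / (p x + q x)) := by
      rw [hsum, ← withDensity_mul _ hm0 hm]
      congr 1
      ext x
      simp only [Pi.mul_apply]
      have := add_pos (hp x) (hq x)
      rw [← ENNReal.ofReal_mul this.le, mul_div_cancel₀ _ this.ne']
    rw [e]
    exact Measure.rnDeriv_withDensity _ hm
  unfold hellingerSq
  congr 1
  have e1 : ∀ᵐ x ∂(expFamily θ + expFamily θ'),
      (Real.sqrt ((expFamily θ).rnDeriv (expFamily θ + expFamily θ') x).toReal
        - Real.sqrt ((expFamily θ').rnDeriv (expFamily θ + expFamily θ') x).toReal) ^ 2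
      = (Real.sqrt (p x / (p x + q x)) - Real.sqrt (q x / (p x + q x))) ^ 2 := by
    filter_upwards [key p hpc, key q hqc] with x h1 h2
    have := add_pos (hp x) (hq x)
    have a1 : (expFamily θ).rnDeriv (expFamily θ + expFamily θ') x
      = ENNReal.ofReal (p x / (p x + q x)) := h1
    have a2 : (expFamily θ').rnDeriv (expFamily θ + expFamily θ') x
      = ENNReal.ofReal (q x / (p x + q x)) := h2
    rw [a1, a2, ENNReal.toReal_ofReal (div_nonneg (hp x).le this.le),
      ENNReal.toReal_ofReal (div_nonneg (hq x).le this.le)]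
  rw [integral_congr_ae e1, hsum, integral_withDensity_eq_integral_toReal_smul hm0
    (ae_of_all _ fun x => ENNReal.ofReal_lt_top)]
  refine integral_congr_ae (ae_of_all _ fun x => ?_)
  have h0 := add_pos (hp x) (hq x)
  have hs : Real.sqrt (p x + q x) ^ 2 = p x + q x := Real.sq_sqrt h0.le
  have hs' : Real.sqrt (p x + q x) ≠ 0 := (Real.sqrt_pos.2 h0).ne'
  simp only [smul_eq_mul]
  rw [ENNReal.toReal_ofReal h0.le, Real.sqrt_div (hp x).le, Real.sqrt_div (hq x).le, ← sub_div,
    div_pow, hs, mul_div_cancel₀ _ h0.ne']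

theorem continuous_sqrt_expDensity (hθ : Summable θ) :
    Continuous fun x => Real.sqrt (expDensity θ x) :=
  Real.continuous_sqrt.comp (continuous_expDensity hθ)

theorem integrable_sqrt_mul_sqrt (hθ : Summable θ) (hθ' : Summable θ') :
    Integrable (fun x => Real.sqrt (expDensity θ x) * Real.sqrt (expDensity θ' x)) ℓ :=
  integrable_unitInterval_of_continuous
    ((continuous_sqrt_expDensity hθ).mul (continuous_sqrt_expDensity hθ'))

theorem hellingerSq_nonneg {Ω : Type*} [MeasurableSpace Ω] (P Q : Measure Ω) :
    0 ≤ hellingerSq P Q :=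
  mul_nonneg (by norm_num) (integral_nonneg fun x => sq_nonneg _)

theorem hellingerSq_eq_one_sub (hθ : Summable θ) (hθ' : Summable θ') :
    hellingerSq (expFamily θ) (expFamily θ')
      = 1 - ∫ x in Set.Icc (0 : ℝ) 1,
          Real.sqrt (expDensity θ x) * Real.sqrt (expDensity θ' x) := by
  rw [hellingerSq_expFamily hθ hθ']
  have e : ∀ x, (Real.sqrt (expDensity θ x) - Real.sqrt (expDensity θ' x)) ^ 2
      = expDensity θ x + expDensity θ' x
        - 2 * (Real.sqrt (expDensity θ x) * Real.sqrt (expDensity θ' x)) := by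
    intro x
    nlinarith [Real.sq_sqrt (expDensity_pos θ x).le, Real.sq_sqrt (expDensity_pos θ' x).le]
  simp_rw [e]
  have hadd : Integrable (fun x => expDensity θ x + expDensity θ' x) ℓ :=
    (integrable_expDensity hθ).add (integrable_expDensity hθ')
  rw [integral_sub hadd ((integrable_sqrt_mul_sqrt hθ hθ').const_mul 2),
    integral_add (integrable_expDensity hθ) (integrable_expDensity hθ'),
    integral_expDensity hθ, integral_expDensity hθ', integral_const_mul]
  ring

theorem hellingerSq_le_one (hθ : Summable θ) (hθ' : Summable θ') :
    hellingerSq (expFamily θ) (expFamily θ') ≤ 1 := by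
  rw [hellingerSq_eq_one_sub hθ hθ']
  have := integral_nonneg (μ := ℓ) (f := fun x =>
    Real.sqrt (expDensity θ x) * Real.sqrt (expDensity θ' x)) fun x => by positivity
  linarith

theorem hellingerSq_triangle {θ₀ : ℕ+ → ℝ} (hθ : Summable θ) (hθ' : Summable θ')
    (h₀ : Summable θ₀) :
    hellingerSq (expFamily θ) (expFamily θ₀)
      ≤ 2 * hellingerSq (expFamily θ') (expFamily θ₀)
        + 2 * hellingerSq (expFamily θ) (expFamily θ') := by
  rw [hellingerSq_expFamily hθ h₀, hellingerSq_expFamily hθ' h₀, hellingerSq_expFamily hθ hθ']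
  have hi : ∀ {a b : ℕ+ → ℝ}, Summable a → Summable b → Integrable (fun x =>
      (Real.sqrt (expDensity a x) - Real.sqrt (expDensity b x)) ^ 2) ℓ := fun ha hb =>
    integrable_unitInterval_of_continuous
      (((continuous_sqrt_expDensity ha).sub (continuous_sqrt_expDensity hb)).pow 2)
  have := integral_mono (hi hθ h₀) (((hi hθ' h₀).const_mul 2).add ((hi hθ hθ').const_mul 2))
    fun x => by
      simp only [Pi.add_apply]
      -- The difference of the two sides is exactly this square.
      nlinarith [sq_nonneg (Real.sqrt (expDensity θ x) - 2 * Real.sqrt (expDensity θ' x)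
        + Real.sqrt (expDensity θ₀ x))]
  simp only [Pi.add_apply] at this
  rw [integral_add ((hi hθ' h₀).const_mul 2) ((hi hθ hθ').const_mul 2), integral_const_mul,
    integral_const_mul] at this
  linarith

/-- The densities differ by a factor at most `e^(2d)`, the normalization contributing the second
`d`, so the affinity is at least `e^(-d)` and `H² ≤ 1 - e^(-d) ≤ d`. A bound linear in `d` suffices
because the lattice makes `d` of order `1/n`. -/
theorem hellingerSq_le_of_abs_sub_le (hθ : Summable θ) (hθ' : Summable θ') {d : ℝ}
    (h : ∀ x, |logSeries θ x - logSeries θ' x| ≤ d) :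
    hellingerSq (expFamily θ) (expFamily θ') ≤ d := by
  have hd0 : 0 ≤ d := (abs_nonneg _).trans (h 0)
  rw [hellingerSq_eq_one_sub hθ hθ']
  have h1 : ∀ x, Real.exp (-d) * expDensity θ x
      ≤ Real.sqrt (expDensity θ x) * Real.sqrt (expDensity θ' x) := by
    intro x
    have h2 := expDensity_le_of_abs_sub_le hθ hθ' h x
    have h3 : Real.exp (-d) * Real.sqrt (expDensity θ x) ≤ Real.sqrt (expDensity θ' x) := by
      refine Real.le_sqrt_of_sq_le ?_
      rw [mul_pow, Real.sq_sqrt (expDensity_pos θ x).le, ← Real.exp_nat_mul]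
      calc _ ≤ Real.exp ((2 : ℕ) * -d) * (Real.exp (2 * d) * expDensity θ' x) := by gcongr
        _ = expDensity θ' x := by
          rw [← mul_assoc, ← Real.exp_add]
          simp
    calc _ = Real.sqrt (expDensity θ x) * (Real.exp (-d) * Real.sqrt (expDensity θ x)) := by
          rw [mul_left_comm, Real.mul_self_sqrt (expDensity_pos θ x).le]
      _ ≤ _ := by gcongr
  have h4 := integral_mono ((integrable_expDensity hθ).const_mul (Real.exp (-d)))
    (integrable_sqrt_mul_sqrt hθ hθ') h1
  rw [integral_const_mul, integral_expDensity hθ, mul_one] at h4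
  linarith [Real.add_one_le_exp (-d)]

/-- The affinity `∫ p^s q^{1-s}` is bounded through the Hellinger distance when `s ≥ 1/2`. -/
theorem integral_rpow_mul_rpow_le (hθ : Summable θ) (hθ' : Summable θ') {t : ℝ} (ht0 : 0 ≤ t)
    (ht : t ≤ 1 / 2) :
    ∫⁻ x in Set.Icc (0 : ℝ) 1,
        ENNReal.ofReal (expDensity θ x ^ (1 - t) * expDensity θ' x ^ t)
      ≤ ENNReal.ofReal (Real.exp (-(2 * t * hellingerSq (expFamily θ) (expFamily θ')))) := by
  have hi := integrable_sqrt_mul_sqrt hθ hθ'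
  have h1 : ∀ x, expDensity θ x ^ (1 - t) * expDensity θ' x ^ t
      ≤ (1 - 2 * t) * expDensity θ x
        + 2 * t * (Real.sqrt (expDensity θ x) * Real.sqrt (expDensity θ' x)) := by
    intro x
    have hp := expDensity_pos θ x
    have hq := expDensity_pos θ' x
    -- Write `p^(1-t) q^t = p^(1-2t) (√p √q)^(2t)` and use weighted AM–GM; `t ≤ 1/2` makes the
    -- weight `1 - 2t` nonnegative.
    refine le_trans (le_of_eq ?_) (Real.geom_mean_le_arith_mean2_weighted (by linarith)
      (by linarith) hp.le (by positivity) (by ring))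
    rw [Real.mul_rpow (by positivity) (by positivity), ← mul_assoc, Real.sqrt_eq_rpow,
      Real.sqrt_eq_rpow, ← Real.rpow_mul hp.le, ← Real.rpow_mul hq.le, ← Real.rpow_add hp]
    congr 2 <;> ring
  calc _ ≤ ∫⁻ x in Set.Icc (0 : ℝ) 1, ENNReal.ofReal ((1 - 2 * t) * expDensity θ x
        + 2 * t * (Real.sqrt (expDensity θ x) * Real.sqrt (expDensity θ' x))) :=
        lintegral_mono fun x => ENNReal.ofReal_le_ofReal (h1 x)
    _ = ENNReal.ofReal (1 - 2 * t * hellingerSq (expFamily θ) (expFamily θ')) := by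
        have hadd : Integrable (fun x => (1 - 2 * t) * expDensity θ x
            + 2 * t * (Real.sqrt (expDensity θ x) * Real.sqrt (expDensity θ' x))) ℓ :=
          ((integrable_expDensity hθ).const_mul _).add (hi.const_mul _)
        rw [← ofReal_integral_eq_lintegral_ofReal hadd,
          integral_add ((integrable_expDensity hθ).const_mul _) (hi.const_mul _),
          integral_const_mul, integral_const_mul, integral_expDensity hθ,
          hellingerSq_eq_one_sub hθ hθ']
        · congr 1; ring
        · refine ae_of_all _ fun x => ?_
          have hp := expDensity_pos θ x
          have : 0 ≤ 1 - 2 * t := by linarith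
          simp only [Pi.zero_apply]
          positivity
    _ ≤ _ := ENNReal.ofReal_le_ofReal (by
        linarith [Real.add_one_le_exp (-(2 * t * hellingerSq (expFamily θ) (expFamily θ')))])

end Density

/-! ### Variational bounds for the Kullback–Leibler divergence -/

section KullbackLeibler

open InformationTheory

variable {Ω : Type*} [MeasurableSpace Ω]

/-- The Donsker–Varadhan inequality for bounded functions. -/
theorem integral_le_klDiv_add_log {μ ν : Measure Ω} [IsProbabilityMeasure μ]
    [IsProbabilityMeasure ν] (h : klDiv μ ν ≠ ∞) {F : Ω → ℝ} (hF : AEMeasurable F ν) {b : ℝ}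
    (hb : ∀ᵐ ω ∂ν, |F ω| ≤ b) :
    ∫ ω, F ω ∂μ ≤ (klDiv μ ν).toReal + Real.log (∫ ω, Real.exp (F ω) ∂ν) := by
  obtain ⟨hac, hint⟩ := klDiv_ne_top_iff.1 h
  have hFμ : Integrable F μ := Integrable.of_bound (hF.mono_ac hac).aestronglyMeasurable b
    (hac.ae_le hb)
  have hexp : Integrable (fun ω => Real.exp (F ω)) ν := by
    refine Integrable.of_bound (Real.measurable_exp.comp_aemeasurable hF).aestronglyMeasurable
      (Real.exp b) ?_
    filter_upwards [hb] with ω hω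
    rw [Real.norm_eq_abs, Real.abs_exp]
    exact Real.exp_le_exp.2 ((le_abs_self _).trans hω)
  have := isProbabilityMeasure_tilted hexp
  have hac' : μ ≪ ν.tilted F := hac.trans (absolutelyContinuous_tilted hexp)
  -- The inequality is the nonnegativity of the divergence from `μ` to the measure `ν` tilted by
  -- `F`, expanded.
  have h1 := integral_llr_tilted_right hac hFμ hexp hint
  have h2 := toReal_klDiv_of_measure_eq hac (by simp)
  have h3 := toReal_klDiv_of_measure_eq hac' (by simp)
  have h4 : 0 ≤ (klDiv μ (ν.tilted F)).toReal := ENNReal.toReal_nonneg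
  linarith

/-- Since `dν'/dν ≤ 1`, a density with respect to the smaller measure dominates the density with
respect to `ν`. This lets a measure living on a single mixture component be compared with the whole
mixture. -/
theorem klDiv_le_of_withDensity {μ ν ν' : Measure Ω} [IsProbabilityMeasure μ]
    [IsProbabilityMeasure ν] (hle : ν' ≤ ν) {ρ : Ω → ℝ≥0∞} (hρ : AEMeasurable ρ ν)
    (hμ : μ = ν'.withDensity ρ) {w : Ω → ℝ} (hw : Integrable w μ)
    (hρw : ∀ᵐ ω ∂μ, ρ ω ≤ ENNReal.ofReal (Real.exp (w ω))) :
    klDiv μ ν ≠ ∞ ∧ (klDiv μ ν).toReal ≤ ∫ ω, w ω ∂μ := by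
  have hac' : ν' ≪ ν := Measure.absolutelyContinuous_of_le hle
  have hfin : IsFiniteMeasure ν' := isFiniteMeasure_of_le ν hle
  have hac : μ ≪ ν := hμ ▸ (withDensity_absolutelyContinuous _ _).trans hac'
  have hμ' : μ = ν.withDensity (ν'.rnDeriv ν * ρ) := by
    rw [withDensity_mul₀ (Measure.measurable_rnDeriv _ _).aemeasurable hρ,
      Measure.withDensity_rnDeriv_eq _ _ hac', hμ]
  have hr : μ.rnDeriv ν =ᵐ[ν] ν'.rnDeriv ν * ρ := by
    conv_lhs => rw [hμ']
    exact Measure.rnDeriv_withDensity₀ ν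
      ((Measure.measurable_rnDeriv _ _).aemeasurable.mul hρ)
  have hle1 := Measure.rnDeriv_le_one_of_le hle
  have hrle : ∀ᵐ ω ∂μ, llr μ ν ω ≤ w ω := by
    filter_upwards [hac.ae_le hr, hac.ae_le hle1, hρw, Measure.rnDeriv_pos hac,
      hac.ae_le (Measure.rnDeriv_lt_top μ ν)] with ω h1 h2 h3 h4 h5
    rw [llr_def, Real.log_le_iff_le_exp (ENNReal.toReal_pos h4.ne' h5.ne),
      ← ENNReal.ofReal_le_ofReal_iff (Real.exp_pos _).le, ENNReal.ofReal_toReal h5.ne, h1]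
    calc (ν'.rnDeriv ν * ρ) ω ≤ 1 * ρ ω := by
          simp only [Pi.mul_apply]
          gcongr
          exact h2
      _ ≤ _ := by rwa [one_mul]
  -- The function `w` controls the log-likelihood ratio only from above. From below, `log r ≥ -1/r`,
  -- and `1/r` has `μ`-integral at most 1.
  have hinv : ∫⁻ ω, (μ.rnDeriv ν ω)⁻¹ ∂μ ≤ 1 := by
    calc ∫⁻ ω, (μ.rnDeriv ν ω)⁻¹ ∂μ
        = ∫⁻ ω, μ.rnDeriv ν ω * (μ.rnDeriv ν ω)⁻¹ ∂ν :=
          (lintegral_rnDeriv_mul hac (Measure.measurable_rnDeriv _ _).inv.aemeasurable).symm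
      _ ≤ ∫⁻ _, 1 ∂ν := lintegral_mono fun ω => ENNReal.mul_inv_le_one _
      _ = 1 := by simp
  have hinv' : Integrable (fun ω => (μ.rnDeriv ν ω)⁻¹.toReal) μ :=
    integrable_toReal_of_lintegral_ne_top (Measure.measurable_rnDeriv _ _).inv.aemeasurable
      (hinv.trans_lt ENNReal.one_lt_top).ne
  have hint : Integrable (llr μ ν) μ := by
    refine (hw.norm.add hinv').mono' (measurable_llr μ ν).aestronglyMeasurable ?_
    filter_upwards [hrle, Measure.rnDeriv_pos hac, hac.ae_le (Measure.rnDeriv_lt_top μ ν)]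
      with ω h1 h2 h3
    have h0 : 0 < (μ.rnDeriv ν ω).toReal := ENNReal.toReal_pos h2.ne' h3.ne
    simp only [Pi.add_apply, Real.norm_eq_abs, ENNReal.toReal_inv]
    have h4 : -((μ.rnDeriv ν ω).toReal)⁻¹ ≤ llr μ ν ω := by
      have := Real.log_le_sub_one_of_pos (inv_pos.2 h0)
      rw [Real.log_inv] at this
      rw [llr_def]
      linarith
    rw [abs_le]
    constructor
    · linarith [abs_nonneg (w ω)]
    · linarith [le_abs_self (w ω), inv_pos.2 h0]
  refine ⟨klDiv_ne_top hac hint, ?_⟩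
  rw [toReal_klDiv_of_measure_eq hac (by simp)]
  exact integral_mono_ae hint hw hrle

end KullbackLeibler

/-! ### Truncated sequences and measurability in the parameter -/

/-- The first `k` coordinates. -/
def coords (k : ℕ) : Finset ℕ+ := (Finset.range k).image Nat.succPNat

theorem mem_coords {k : ℕ} {j : ℕ+} : j ∈ coords k ↔ (j : ℕ) ≤ k := by
  simp only [coords, Finset.mem_image, Finset.mem_range]
  constructor
  · rintro ⟨i, hi, rfl⟩
    simpa using hi
  · intro h
    refine ⟨j.natPred, ?_, PNat.succPNat_natPred j⟩
    have := PNat.natPred_add_one j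
    omega

theorem card_coords (k : ℕ) : (coords k).card = k := by
  rw [coords, Finset.card_image_of_injective _ Nat.succPNat_injective, Finset.card_range]

/-- The sequence with all coordinates beyond the `k`-th set to zero. -/
def truncate (k : ℕ) (θ : ℕ+ → ℝ) : ℕ+ → ℝ := fun j => if (j : ℕ) ≤ k then θ j else 0

theorem truncate_eq_zero {k : ℕ} (θ : ℕ+ → ℝ) {j : ℕ+} (hj : j ∉ coords k) :
    truncate k θ j = 0 := if_neg (fun h => hj (mem_coords.2 h))

theorem truncate_eq_self {k : ℕ} (θ : ℕ+ → ℝ) {j : ℕ+} (hj : j ∈ coords k) :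
    truncate k θ j = θ j := if_pos (mem_coords.1 hj)

theorem summable_truncate (k : ℕ) (θ : ℕ+ → ℝ) : Summable (truncate k θ) :=
  summable_of_ne_finset_zero (s := coords k) fun _ hj => truncate_eq_zero θ hj

theorem logSeries_truncate (k : ℕ) (θ : ℕ+ → ℝ) (x : ℝ) :
    logSeries (truncate k θ) x = ∑ j ∈ coords k, θ j * trigBasis j x := by
  rw [logSeries, tsum_eq_sum (s := coords k) fun j hj => by rw [truncate_eq_zero θ hj, zero_mul]]
  exact Finset.sum_congr rfl fun j hj => by rw [truncate_eq_self θ hj]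

/-- This is the route to measurability in the parameter: almost everywhere a functional equals its
composition with `truncate k`, and there the series is a finite sum. -/
theorem ae_truncate_eq {ν : ℕ+ → Measure ℝ} [∀ j, IsProbabilityMeasure (ν j)] {k : ℕ}
    (h : ∀ j : ℕ+, ¬ (j : ℕ) ≤ k → ν j = Measure.dirac 0) :
    ∀ᵐ θ ∂Measure.infinitePi ν, truncate k θ = θ := by
  have h1 : ∀ j : ℕ+, ∀ᵐ θ ∂Measure.infinitePi ν, truncate k θ j = θ j := by
    intro j
    by_cases hj : (j : ℕ) ≤ k
    · exact ae_of_all _ fun θ => if_pos hj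
    · have h2 : ∀ᵐ y ∂(ν j), y = 0 := by
        rw [h j hj, ae_dirac_eq]
        exact Filter.eventually_pure.2 rfl
      have h3 := (measurePreserving_eval_infinitePi ν j).quasiMeasurePreserving.ae h2
      filter_upwards [h3] with θ hθ
      rw [truncate, if_neg hj]
      exact hθ.symm
  filter_upwards [ae_all_iff.2 h1] with θ hθ using funext hθ

theorem measurable_logSeries_truncate (k : ℕ) :
    Measurable fun p : (ℕ+ → ℝ) × ℝ => logSeries (truncate k p.1) p.2 := by
  simp_rw [logSeries_truncate]
  refine Finset.measurable_sum _ fun j _ => ?_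
  exact ((measurable_pi_apply j).comp measurable_fst).mul
    ((continuous_trigBasis j).measurable.comp measurable_snd)

theorem measurable_logPartition_truncate (k : ℕ) :
    Measurable fun θ => logPartition (truncate k θ) := by
  have := (Real.measurable_exp.comp (measurable_logSeries_truncate k)).stronglyMeasurable
  exact Real.measurable_log.comp
    (this.integral_prod_right' (ν := volume.restrict (Set.Icc (0 : ℝ) 1))).measurable

theorem measurable_expDensity_truncate (k : ℕ) :
    Measurable fun p : (ℕ+ → ℝ) × ℝ => expDensity (truncate k p.1) p.2 :=
  Real.measurable_exp.comp ((measurable_logSeries_truncate k).sub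
    ((measurable_logPartition_truncate k).comp measurable_fst))

theorem measurable_likelihood_truncate (k : ℕ) {n : ℕ} (X : Fin n → ℝ) :
    Measurable fun θ => likelihood X (truncate k θ) :=
  Finset.measurable_prod _ fun _ _ => ((measurable_expDensity_truncate k).comp
    (measurable_id.prodMk measurable_const)).ennreal_ofReal

theorem measurable_hellingerSq_truncate (k : ℕ) {θ₀ : ℕ+ → ℝ} (h₀ : Summable θ₀) :
    Measurable fun θ => hellingerSq (expFamily (truncate k θ)) (expFamily θ₀) := by
  simp_rw [hellingerSq_expFamily (summable_truncate k _) h₀]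
  refine measurable_const.mul ?_
  have : Measurable fun p : (ℕ+ → ℝ) × ℝ =>
      (Real.sqrt (expDensity (truncate k p.1) p.2) - Real.sqrt (expDensity θ₀ p.2)) ^ 2 :=
    (((measurable_expDensity_truncate k).sqrt).sub
      ((continuous_expDensity h₀).measurable.comp measurable_snd).sqrt).pow_const 2
  exact (this.stronglyMeasurable.integral_prod_right
    (ν := volume.restrict (Set.Icc (0 : ℝ) 1))).measurable

theorem measurable_likelihood {n : ℕ} {θ : ℕ+ → ℝ} (hθ : Summable θ) :
    Measurable fun X : Fin n → ℝ => likelihood X θ :=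
  Finset.measurable_prod _ fun i _ =>
    ((continuous_expDensity hθ).measurable.comp (measurable_pi_apply i)).ennreal_ofReal

theorem likelihood_eq_ofReal {n : ℕ} (X : Fin n → ℝ) (θ : ℕ+ → ℝ) :
    likelihood X θ = ENNReal.ofReal (∏ i, expDensity θ (X i)) :=
  (ENNReal.ofReal_prod_of_nonneg fun _ _ => (expDensity_pos _ _).le).symm

theorem likelihood_pos {n : ℕ} (X : Fin n → ℝ) (θ : ℕ+ → ℝ) : 0 < likelihood X θ := by
  rw [likelihood_eq_ofReal]
  exact ENNReal.ofReal_pos.2 (Finset.prod_pos fun _ _ => expDensity_pos _ _)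

theorem likelihood_ne_top {n : ℕ} (X : Fin n → ℝ) (θ : ℕ+ → ℝ) : likelihood X θ ≠ ∞ := by
  rw [likelihood_eq_ofReal]
  exact ENNReal.ofReal_ne_top

theorem log_likelihood {n : ℕ} (X : Fin n → ℝ) (θ : ℕ+ → ℝ) :
    Real.log (likelihood X θ).toReal = ∑ i, (logSeries θ (X i) - logPartition θ) := by
  rw [likelihood_eq_ofReal, ENNReal.toReal_ofReal
    (Finset.prod_nonneg fun _ _ => (expDensity_pos _ _).le),
    Real.log_prod fun i _ => (expDensity_pos _ _).ne']
  simp [expDensity]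

/-! ### The sieve prior -/

theorem IsProbDensity.isProbabilityMeasure {g : ℝ → ℝ} (hg : IsProbDensity g) :
    IsProbabilityMeasure ((volume : Measure ℝ).withDensity fun x => ENNReal.ofReal (g x)) :=
  ⟨by rw [withDensity_apply _ MeasurableSet.univ, Measure.restrict_univ, hg.lintegral_eq_one]⟩

/-- The coordinate laws of a sieve component. -/
noncomputable def sieveMarginal (f : ℕ+ → ℝ → ℝ) (k : ℕ) (j : ℕ+) : Measure ℝ :=
  if (j : ℕ) ≤ k then volume.withDensity (fun x => ENNReal.ofReal (f j x)) else Measure.dirac 0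

section Sieve

variable {f : ℕ+ → ℝ → ℝ}

theorem sieveComponent_eq (f : ℕ+ → ℝ → ℝ) (k : ℕ) :
    sieveComponent f k = Measure.infinitePi (sieveMarginal f k) := rfl

theorem isProbabilityMeasure_sieveMarginal (hf : ∀ j, IsProbDensity (f j)) (k : ℕ) (j : ℕ+) :
    IsProbabilityMeasure (sieveMarginal f k j) := by
  unfold sieveMarginal
  split_ifs
  · exact (hf j).isProbabilityMeasure
  · infer_instance

theorem isProbabilityMeasure_sieveComponent (hf : ∀ j, IsProbDensity (f j)) (k : ℕ) :
    IsProbabilityMeasure (sieveComponent f k) := by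
  have := isProbabilityMeasure_sieveMarginal hf k
  rw [sieveComponent_eq]
  infer_instance

theorem ae_truncate_eq_sieveComponent (hf : ∀ j, IsProbDensity (f j)) (k : ℕ) :
    ∀ᵐ θ ∂sieveComponent f k, truncate k θ = θ := by
  have := isProbabilityMeasure_sieveMarginal hf k
  rw [sieveComponent_eq]
  exact ae_truncate_eq fun j hj => if_neg hj

theorem isProbabilityMeasure_sievePrior (π : PMF ℕ) (hf : ∀ j, IsProbDensity (f j)) :
    IsProbabilityMeasure (sievePrior π f) := by
  have := isProbabilityMeasure_sieveComponent hf
  refine ⟨?_⟩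
  rw [sievePrior, Measure.sum_apply _ MeasurableSet.univ]
  simp [π.tsum_coe]

theorem ae_sievePrior {π : PMF ℕ} (hf : ∀ j, IsProbDensity (f j)) :
    ∀ᵐ θ ∂sievePrior π f, ∃ k, truncate k θ = θ := by
  rw [sievePrior, Measure.ae_sum_iff]
  intro k
  filter_upwards [Measure.ae_smul_measure (ae_truncate_eq_sieveComponent hf k) (π k)] with θ hθ
  exact ⟨k, hθ⟩

theorem aemeasurable_sieveComponent {β : Type*} [MeasurableSpace β]
    (hf : ∀ j, IsProbDensity (f j)) {k : ℕ} {G : (ℕ+ → ℝ) → β}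
    (hG : Measurable fun θ => G (truncate k θ)) : AEMeasurable G (sieveComponent f k) := by
  refine ⟨_, hG, ?_⟩
  filter_upwards [ae_truncate_eq_sieveComponent hf k] with θ hθ
  rw [hθ]

theorem aemeasurable_sievePrior {β : Type*} [MeasurableSpace β] {π : PMF ℕ}
    (hf : ∀ j, IsProbDensity (f j)) {G : (ℕ+ → ℝ) → β}
    (hG : ∀ k, Measurable fun θ => G (truncate k θ)) : AEMeasurable G (sievePrior π f) := by
  rw [sievePrior, aemeasurable_sum_measure_iff]
  exact fun k => (aemeasurable_sieveComponent hf (hG k)).smul_measure (π k)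

theorem lintegral_sievePrior (π : PMF ℕ) (f : ℕ+ → ℝ → ℝ) (G : (ℕ+ → ℝ) → ℝ≥0∞) :
    ∫⁻ θ, G θ ∂sievePrior π f = ∑' k, π k * ∫⁻ θ, G θ ∂sieveComponent f k := by
  rw [sievePrior, lintegral_sum_measure]
  simp

end Sieve

/-! ### Sums over lattice cells -/

/-- Every finite set of multi-indices lies in a finite box, over which the sum of products factors.
-/
theorem ENNReal_tsum_prod_le {ι : Type*} [Fintype ι] {α : Type*} (a : ι → α → ℝ≥0∞) :
    ∑' m : ι → α, ∏ i, a i (m i) ≤ ∏ i, ∑' x, a i x := by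
  classical
  rw [ENNReal.tsum_eq_iSup_sum]
  refine iSup_le fun S => ?_
  calc ∑ m ∈ S, ∏ i, a i (m i)
      ≤ ∑ m ∈ Fintype.piFinset fun i => S.image fun m => m i, ∏ i, a i (m i) := by
        refine Finset.sum_le_sum_of_subset fun m hm => ?_
        rw [Fintype.mem_piFinset]
        exact fun i => Finset.mem_image_of_mem (fun m : ι → α => m i) hm
    _ = ∏ i, ∑ x ∈ S.image fun m => m i, a i x := (Finset.prod_univ_sum _ _).symm
    _ ≤ _ := Finset.prod_le_prod' fun i _ => ENNReal.sum_le_tsum _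

/-- Finite subadditivity passes to the limit along finite subsets. It moves the fractional power
inside the sum over cells. -/
theorem ENNReal_tsum_rpow_le {ι : Type*} (a : ι → ℝ≥0∞) {s : ℝ} (hs0 : 0 < s) (hs : s ≤ 1) :
    (∑' i, a i) ^ s ≤ ∑' i, a i ^ s := by
  classical
  have h1 : ∀ S : Finset ι, (∑ i ∈ S, a i) ^ s ≤ ∑ i ∈ S, a i ^ s := by
    intro S
    induction S using Finset.induction_on with
    | empty => simp [hs0]
    | insert i S hi ih =>
      rw [Finset.sum_insert hi, Finset.sum_insert hi]
      exact (ENNReal.rpow_add_le_add_rpow _ _ hs0.le hs).trans (add_le_add le_rfl ih)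
  have h2 : Filter.Tendsto (fun S : Finset ι => (∑ i ∈ S, a i) ^ s) Filter.atTop
      (nhds ((∑' i, a i) ^ s)) :=
    (ENNReal.continuous_rpow_const.tendsto _).comp ENNReal.summable.hasSum
  exact le_of_tendsto' h2 fun S => (h1 S).trans (ENNReal.sum_le_tsum S)

/-- The inverse mesh of the lattice in the `j`-th coordinate. -/
noncomputable def gridScale (N : ℝ) (j : ℕ+) : ℝ := N * ((j : ℕ) : ℝ) ^ 2

theorem gridScale_pos {N : ℝ} (hN : 0 < N) (j : ℕ+) : 0 < gridScale N j := by
  have : (0 : ℝ) < (j : ℕ) := by exact_mod_cast j.pos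
  unfold gridScale
  positivity

/-- The lattice cell in the first `k` coordinates with index `m`. -/
def gridCell (N : ℝ) (k : ℕ) (m : coords k → ℤ) : Set (ℕ+ → ℝ) :=
  {θ | ∀ j : coords k, ⌊θ j * gridScale N j⌋ = m j}

/-- The lattice point attached to a cell. -/
noncomputable def gridPoint (N : ℝ) (k : ℕ) (m : coords k → ℤ) : ℕ+ → ℝ :=
  fun j => if h : j ∈ coords k then m ⟨j, h⟩ / gridScale N j else 0

theorem summable_gridPoint (N : ℝ) (k : ℕ) (m : coords k → ℤ) : Summable (gridPoint N k m) :=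
  summable_of_ne_finset_zero (s := coords k) fun _ hj => dif_neg hj

theorem measurable_gridIndex (N : ℝ) (k : ℕ) :
    Measurable fun (θ : ℕ+ → ℝ) (j : coords k) => ⌊θ j * gridScale N j⌋ :=
  measurable_pi_lambda _ fun j =>
    Int.measurable_floor.comp ((measurable_pi_apply (j : ℕ+)).mul_const _)

theorem measurableSet_gridCell (N : ℝ) (k : ℕ) (m : coords k → ℤ) :
    MeasurableSet (gridCell N k m) := by
  have : gridCell N k m = (fun (θ : ℕ+ → ℝ) (j : coords k) => ⌊θ j * gridScale N j⌋) ⁻¹' {m} := by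
    ext θ
    simp [gridCell, funext_iff]
  rw [this]
  exact measurable_gridIndex N k (measurableSet_singleton m)

theorem lintegral_eq_tsum_gridCell (N : ℝ) (k : ℕ) (μ : Measure (ℕ+ → ℝ))
    (G : (ℕ+ → ℝ) → ℝ≥0∞) :
    ∫⁻ θ, G θ ∂μ = ∑' m : coords k → ℤ, ∫⁻ θ in gridCell N k m, G θ ∂μ := by
  rw [← lintegral_iUnion (measurableSet_gridCell N k), ← setLIntegral_univ]
  · congr 2
    symm
    rw [Set.eq_univ_iff_forall]
    exact fun θ => Set.mem_iUnion.2 ⟨fun j => ⌊θ j * gridScale N j⌋, fun j => rfl⟩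
  · intro m m' hm
    refine Set.disjoint_left.2 fun θ h h' => hm ?_
    ext j
    rw [← h j, ← h' j]

/-- The constant `√2 ∑_j j⁻²`. -/
noncomputable def gridConst : ℝ := Real.sqrt 2 * ∑' j : ℕ+, 1 / ((j : ℕ) : ℝ) ^ 2

theorem summable_pnat_one_div_sq : Summable fun j : ℕ+ => 1 / ((j : ℕ) : ℝ) ^ 2 :=
  (Real.summable_one_div_nat_pow.2 one_lt_two).comp_injective PNat.coe_injective

theorem gridConst_nonneg : 0 ≤ gridConst :=
  mul_nonneg (Real.sqrt_nonneg _) (tsum_nonneg fun j => by positivity)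

/-- Coordinate `j` is off by at most `1/(N j²)`, and `j⁻²` is summable, so the error does not depend
on `k`. With `N = n` the likelihood of `n` observations changes by a bounded factor. -/
theorem abs_logSeries_sub_gridPoint_le {N : ℝ} (hN : 0 < N) {k : ℕ} {m : coords k → ℤ}
    {θ : ℕ+ → ℝ} (hθ : truncate k θ = θ) (hm : θ ∈ gridCell N k m) (x : ℝ) :
    |logSeries θ x - logSeries (gridPoint N k m) x| ≤ gridConst / N := by
  have hs : Summable θ := hθ ▸ summable_truncate k θ
  have hs' := summable_gridPoint N k m
  have h1 : ∀ j : ℕ+, |(θ - gridPoint N k m) j| ≤ 1 / N * (1 / ((j : ℕ) : ℝ) ^ 2) := by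
    intro j
    have hg := gridScale_pos hN j
    have e : 1 / N * (1 / ((j : ℕ) : ℝ) ^ 2) = 1 / gridScale N j := by
      rw [gridScale, one_div_mul_one_div]
    rw [e, Pi.sub_apply, gridPoint]
    split_ifs with hj
    · have h2 : ⌊θ j * gridScale N j⌋ = m ⟨j, hj⟩ := hm ⟨j, hj⟩
      have h3 := Int.floor_le (θ j * gridScale N j)
      have h4 := Int.lt_floor_add_one (θ j * gridScale N j)
      rw [h2] at h3 h4
      have h5 : θ j - (m ⟨j, hj⟩ : ℝ) / gridScale N j
          = (θ j * gridScale N j - m ⟨j, hj⟩) / gridScale N j := by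
        field_simp
      rw [h5, abs_div, abs_of_pos hg]
      gcongr
      rw [abs_le]
      constructor <;> linarith
    · rw [← hθ, truncate_eq_zero θ hj]
      simp only [sub_zero, abs_zero]
      positivity
  rw [← logSeries_sub hs hs']
  refine (abs_logSeries_le (hs.sub hs') x).trans ?_
  rw [gridConst, mul_div_assoc, div_eq_inv_mul, ← one_div,
    ← tsum_mul_left (f := fun j : ℕ+ => 1 / ((j : ℕ) : ℝ) ^ 2)]
  exact mul_le_mul_of_nonneg_left (Summable.tsum_le_tsum h1 (hs.sub hs').abs
    (summable_pnat_one_div_sq.mul_left _)) (Real.sqrt_nonneg _)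

/-! ### Powers of cell probabilities -/

/-- For `|x| ≥ 1` a single term of the exponential series, of order `p ≥ 4/β`, already beats `x⁴`.
The squared Cauchy shape is chosen so that a power `1 - t ≥ 1/2` of it is still bounded by the
integrable `(1 + x²)⁻¹`. -/
theorem exists_exp_neg_rpow_le (c₀ : ℝ) {c₁ β : ℝ} (hc₁ : 0 < c₁) (hβ : 0 < β) :
    ∃ K : ℝ, 1 ≤ K ∧ ∀ x : ℝ, Real.exp (-(c₀ + c₁ * |x| ^ β)) ≤ K * ((1 + x ^ 2)⁻¹) ^ 2 := by
  obtain ⟨p, hp⟩ := exists_nat_ge (4 / β)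
  have hp' : 4 ≤ β * p := by rw [div_le_iff₀ hβ] at hp; linarith
  set L : ℝ := 1 + (p.factorial : ℝ) / c₁ ^ p with hL
  have hL1 : 1 ≤ L := by rw [hL]; linarith [show 0 ≤ (p.factorial : ℝ) / c₁ ^ p by positivity]
  have key : ∀ x : ℝ, Real.exp (-(c₁ * |x| ^ β)) ≤ 4 * L * ((1 + x ^ 2)⁻¹) ^ 2 := by
    intro x
    rw [inv_pow, ← div_eq_mul_inv, le_div_iff₀ (by positivity)]
    have hsq : x ^ 2 = |x| ^ 2 := (sq_abs x).symm
    rcases le_total |x| 1 with h | h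
    · have h1 : Real.exp (-(c₁ * |x| ^ β)) ≤ 1 := Real.exp_le_one_iff.2 (by
        have := Real.rpow_nonneg (abs_nonneg x) β
        nlinarith)
      have h2 : (1 + x ^ 2) ^ 2 ≤ 4 := by
        have : x ^ 2 ≤ 1 := by rw [hsq]; exact pow_le_one₀ (abs_nonneg _) h
        nlinarith [sq_nonneg x]
      calc _ ≤ 1 * (4 : ℝ) := by gcongr
        _ ≤ 4 * L := by linarith
    · have h1 := Real.pow_div_factorial_le_exp (c₁ * |x| ^ β) (by positivity) p
      have h2 : |x| ^ 4 ≤ (|x| ^ β) ^ p := by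
        rw [← Real.rpow_natCast, ← Real.rpow_natCast, ← Real.rpow_mul (abs_nonneg _)]
        exact Real.rpow_le_rpow_of_exponent_le h (by exact_mod_cast hp')
      have h3 : (1 + x ^ 2) ^ 2 ≤ 4 * |x| ^ 4 := by
        have h5 : 1 ≤ |x| ^ 2 := one_le_pow₀ h
        rw [hsq]
        nlinarith
      have h4 : c₁ ^ p * |x| ^ 4 / p.factorial ≤ Real.exp (c₁ * |x| ^ β) := by
        refine le_trans ?_ h1
        rw [mul_pow]
        gcongr
      rw [Real.exp_neg, inv_mul_le_iff₀ (Real.exp_pos _)]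
      calc (1 + x ^ 2) ^ 2 ≤ 4 * |x| ^ 4 := h3
        _ = c₁ ^ p * |x| ^ 4 / p.factorial * (4 * (p.factorial / c₁ ^ p)) := by field_simp
        _ ≤ Real.exp (c₁ * |x| ^ β) * (4 * L) := by
          gcongr
          rw [hL]; linarith
  refine ⟨1 + Real.exp (-c₀) * (4 * L), ?_, fun x => ?_⟩
  · linarith [show 0 ≤ Real.exp (-c₀) * (4 * L) by positivity]
  · rw [neg_add, Real.exp_add]
    calc _ ≤ Real.exp (-c₀) * (4 * L * ((1 + x ^ 2)⁻¹) ^ 2) := by gcongr; exact key x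
      _ ≤ _ := by nlinarith [sq_nonneg ((1 + x ^ 2)⁻¹)]

/-- Within a cell of length at most 1, values of the Cauchy shape can be traded for one another,
hence point bounds for integrals. -/
theorem inv_one_add_sq_le {x y : ℝ} (h : |x - y| ≤ 1) :
    (1 + x ^ 2)⁻¹ ≤ 3 * (1 + y ^ 2)⁻¹ := by
  rw [← div_eq_mul_inv, le_div_iff₀ (by positivity), inv_mul_le_iff₀ (by positivity)]
  have : (x - y) ^ 2 ≤ 1 := by rw [← sq_abs]; exact pow_le_one₀ (abs_nonneg _) h
  nlinarith [sq_nonneg (2 * x - y), sq_nonneg x]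

/-- The sum of the `(1-t)`-th powers of the probabilities of the cells of mesh `1/G`. -/
theorem tsum_cell_rpow_le {g : ℝ → ℝ} {K : ℝ} (hK : 1 ≤ K)
    (hg : ∀ x, g x ≤ K * ((1 + x ^ 2)⁻¹) ^ 2) {G : ℝ} (hG : 1 ≤ G) {t : ℝ} (ht : t ≤ 1 / 2)
    (ht0 : 0 ≤ t) :
    ∑' i : ℤ, (∫⁻ x in {y : ℝ | ⌊y * G⌋ = i}, ENNReal.ofReal (g x)) ^ (1 - t)
      ≤ ENNReal.ofReal (27 * K * Real.pi * G ^ t) := by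
  have hG0 : 0 < G := by linarith
  set I : ℤ → Set ℝ := fun i => {y : ℝ | ⌊y * G⌋ = i} with hI
  have hIco : ∀ i, I i = Set.Ico (i / G) ((i + 1) / G) := by
    intro i
    ext y
    simp only [hI, Set.mem_ofPred_eq, Int.floor_eq_iff, Set.mem_Ico]
    rw [div_le_iff₀ hG0, lt_div_iff₀ hG0]
  have hIm : ∀ i, MeasurableSet (I i) := fun i => by rw [hIco]; exact measurableSet_Ico
  have hvol : ∀ i, volume (I i) = ENNReal.ofReal (1 / G) := by
    intro i
    rw [hIco, Real.volume_Ico]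
    congr 1
    field_simp
    ring
  have hdist : ∀ i, ∀ y ∈ I i, |y - i / G| ≤ 1 := by
    intro i y hy
    rw [hIco] at hy
    have h1 : ((i : ℝ) + 1) / G = i / G + 1 / G := add_div _ _ _
    have h2 : 1 / G ≤ 1 := by rw [div_le_one hG0]; exact hG
    rw [abs_le]
    constructor <;> linarith [hy.1, hy.2]
  -- The cell has length `1/G` and probability at most `9 K h²/G`. The power `1 - t` turns `1/G`
  -- into `G^t · (1/G)`, and `h/G` is returned, at the price of a factor 3, to an integral over the
  -- cell. Thus `G^t` is the whole cost of the mesh.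
  have hcell : ∀ i : ℤ, (∫⁻ x in I i, ENNReal.ofReal (g x)) ^ (1 - t)
      ≤ ENNReal.ofReal (27 * K * G ^ t) * ∫⁻ x in I i, ENNReal.ofReal ((1 + x ^ 2)⁻¹) := by
    intro i
    set h : ℝ := (1 + ((i : ℝ) / G) ^ 2)⁻¹ with hh
    have h0 : 0 < h := by positivity
    have h1 : h ≤ 1 := inv_le_one_of_one_le₀ (by linarith [sq_nonneg ((i : ℝ) / G)])
    have hA : ∫⁻ x in I i, ENNReal.ofReal (g x) ≤ ENNReal.ofReal (9 * K * h ^ 2 * (1 / G)) := by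
      calc _ ≤ ∫⁻ x in I i, ENNReal.ofReal (9 * K * h ^ 2) := by
            refine setLIntegral_mono' (hIm i) fun x hx => ENNReal.ofReal_le_ofReal ?_
            have := inv_one_add_sq_le (hdist i x hx)
            calc g x ≤ K * ((1 + x ^ 2)⁻¹) ^ 2 := hg x
              _ ≤ K * (3 * h) ^ 2 := by gcongr
              _ = _ := by ring
        _ = _ := by
          rw [setLIntegral_const, hvol, ← ENNReal.ofReal_mul (by positivity)]
    have hB : (9 * K * h ^ 2 * (1 / G)) ^ (1 - t) ≤ 9 * K * G ^ t * (h * (1 / G)) := by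
      rw [Real.mul_rpow (by positivity) (by positivity),
        Real.mul_rpow (by positivity) (by positivity)]
      have e1 : (9 * K) ^ (1 - t) ≤ 9 * K := by
        calc _ ≤ (9 * K) ^ (1 : ℝ) :=
              Real.rpow_le_rpow_of_exponent_le (by linarith) (by linarith)
          _ = _ := Real.rpow_one _
      have e2 : (h ^ 2) ^ (1 - t) ≤ h := by
        rw [← Real.rpow_natCast, ← Real.rpow_mul h0.le]
        calc _ ≤ h ^ (1 : ℝ) := Real.rpow_le_rpow_of_exponent_ge h0 h1 (by push_cast; linarith)
          _ = _ := Real.rpow_one _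
      have e3 : (1 / G) ^ (1 - t) = G ^ t * (1 / G) := by
        rw [one_div, Real.inv_rpow hG0.le, ← Real.rpow_neg hG0.le, ← Real.rpow_neg_one,
          ← Real.rpow_add hG0]
        congr 1
        ring
      rw [e3]
      calc _ ≤ (9 * K) * h * (G ^ t * (1 / G)) := by gcongr
        _ = _ := by ring
    have hC : ENNReal.ofReal (h * (1 / G))
        ≤ ENNReal.ofReal 3 * ∫⁻ x in I i, ENNReal.ofReal ((1 + x ^ 2)⁻¹) := by
      calc ENNReal.ofReal (h * (1 / G)) = ∫⁻ x in I i, ENNReal.ofReal h := by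
            rw [setLIntegral_const, hvol, ← ENNReal.ofReal_mul h0.le]
        _ ≤ ∫⁻ x in I i, ENNReal.ofReal 3 * ENNReal.ofReal ((1 + x ^ 2)⁻¹) := by
            refine setLIntegral_mono' (hIm i) fun x hx => ?_
            rw [← ENNReal.ofReal_mul (by norm_num)]
            refine ENNReal.ofReal_le_ofReal (inv_one_add_sq_le ?_)
            rw [abs_sub_comm]
            exact hdist i x hx
        _ = _ := lintegral_const_mul' _ _ ENNReal.ofReal_ne_top
    calc _ ≤ ENNReal.ofReal (9 * K * h ^ 2 * (1 / G)) ^ (1 - t) :=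
          ENNReal.rpow_le_rpow hA (by linarith)
      _ = ENNReal.ofReal ((9 * K * h ^ 2 * (1 / G)) ^ (1 - t)) :=
          ENNReal.ofReal_rpow_of_nonneg (by positivity) (by linarith)
      _ ≤ ENNReal.ofReal (9 * K * G ^ t * (h * (1 / G))) := ENNReal.ofReal_le_ofReal hB
      _ = ENNReal.ofReal (9 * K * G ^ t) * ENNReal.ofReal (h * (1 / G)) :=
          ENNReal.ofReal_mul (by positivity)
      _ ≤ ENNReal.ofReal (9 * K * G ^ t)
          * (ENNReal.ofReal 3 * ∫⁻ x in I i, ENNReal.ofReal ((1 + x ^ 2)⁻¹)) := by gcongr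
      _ = _ := by
          rw [← mul_assoc, ← ENNReal.ofReal_mul (by positivity)]
          congr 2
          ring
  calc _ ≤ ∑' i : ℤ, ENNReal.ofReal (27 * K * G ^ t)
        * ∫⁻ x in I i, ENNReal.ofReal ((1 + x ^ 2)⁻¹) := ENNReal.tsum_le_tsum hcell
    _ = ENNReal.ofReal (27 * K * G ^ t)
        * ∫⁻ x in ⋃ i, I i, ENNReal.ofReal ((1 + x ^ 2)⁻¹) := by
        rw [ENNReal.tsum_mul_left, lintegral_iUnion hIm]
        intro i i' hi
        refine Set.disjoint_left.2 fun y hy hy' => hi ?_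
        simp only [hI, Set.mem_ofPred_eq] at hy hy'
        rw [← hy, ← hy']
    _ ≤ ENNReal.ofReal (27 * K * G ^ t) * ∫⁻ x : ℝ, ENNReal.ofReal ((1 + x ^ 2)⁻¹) := by
        exact mul_le_mul_right (setLIntegral_le_lintegral _ _) _
    _ = _ := by
        rw [← ofReal_integral_eq_lintegral_ofReal integrable_inv_one_add_sq
          (ae_of_all _ fun x => by positivity), integral_univ_inv_one_add_sq,
          ← ENNReal.ofReal_mul (by positivity)]
        congr 1
        ring

section Component

variable {f : ℕ+ → ℝ → ℝ}

theorem sieveComponent_gridCell (hf : ∀ j, IsProbDensity (f j)) (N : ℝ) (k : ℕ)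
    (m : coords k → ℤ) :
    sieveComponent f k (gridCell N k m)
      = ∏ j : coords k, ∫⁻ x in {y : ℝ | ⌊y * gridScale N j⌋ = m j}, ENNReal.ofReal (f j x) := by
  have := isProbabilityMeasure_sieveMarginal hf k
  have hms : ∀ (j : ℕ+) (i : ℤ), MeasurableSet {y : ℝ | ⌊y * gridScale N j⌋ = i} := fun j i =>
    (Int.measurable_floor.comp (measurable_id.mul_const (gridScale N j)))
      (measurableSet_singleton i)
  set T : ℕ+ → Set ℝ := fun j =>
    if h : j ∈ coords k then {y : ℝ | ⌊y * gridScale N j⌋ = m ⟨j, h⟩} else Set.univ with hT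
  have hTj : ∀ j : coords k, T j = {y : ℝ | ⌊y * gridScale N j⌋ = m j} := fun j => dif_pos j.2
  have e : gridCell N k m = Set.pi (coords k : Set ℕ+) T := by
    ext θ
    simp only [gridCell, Set.mem_ofPred_eq, Set.mem_pi, Finset.mem_coe]
    constructor
    · intro h j hj
      rw [hTj ⟨j, hj⟩]
      exact h ⟨j, hj⟩
    · intro h j
      have := h j j.2
      rw [hTj j] at this
      exact this
  rw [e, sieveComponent_eq, Measure.infinitePi_pi, ← Finset.prod_coe_sort]
  · refine Finset.prod_congr rfl fun j _ => ?_
    rw [hTj, sieveMarginal, if_pos (mem_coords.1 j.2), withDensity_apply _ (hms _ _)]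
  · intro j hj
    rw [hTj ⟨j, hj⟩]
    exact hms _ _

/-- Independence of the coordinates factors the sum over cells; each of the `k` coordinates has
scale `N j² ≤ N k²`. -/
theorem tsum_sieveComponent_gridCell_rpow_le (hf : ∀ j, IsProbDensity (f j)) {K : ℝ} (hK : 1 ≤ K)
    (hfK : ∀ j x, f j x ≤ K * ((1 + x ^ 2)⁻¹) ^ 2) {N : ℝ} (hN : 1 ≤ N) {t : ℝ} (ht0 : 0 ≤ t)
    (ht : t ≤ 1 / 2) (k : ℕ) :
    ∑' m : coords k → ℤ, sieveComponent f k (gridCell N k m) ^ (1 - t)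
      ≤ ENNReal.ofReal ((27 * K * Real.pi * (N * (k : ℝ) ^ 2) ^ t) ^ k) := by
  have hscale : ∀ j : ℕ+, 1 ≤ gridScale N j := fun j => by
    have : (1 : ℝ) ≤ (j : ℕ) := by exact_mod_cast j.pos
    unfold gridScale
    nlinarith [one_le_pow₀ this (n := 2)]
  calc _ = ∑' m : coords k → ℤ, ∏ j : coords k,
        (∫⁻ x in {y : ℝ | ⌊y * gridScale N j⌋ = m j}, ENNReal.ofReal (f j x)) ^ (1 - t) := by
        simp_rw [sieveComponent_gridCell hf]
        refine tsum_congr fun m => ?_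
        rw [ENNReal.prod_rpow_of_nonneg (by linarith)]
    _ ≤ ∏ j : coords k, ∑' i : ℤ,
        (∫⁻ x in {y : ℝ | ⌊y * gridScale N j⌋ = i}, ENNReal.ofReal (f j x)) ^ (1 - t) :=
        ENNReal_tsum_prod_le fun (j : coords k) (i : ℤ) =>
          (∫⁻ x in {y : ℝ | ⌊y * gridScale N j⌋ = i}, ENNReal.ofReal (f j x)) ^ (1 - t)
    _ ≤ ∏ _j : coords k, ENNReal.ofReal (27 * K * Real.pi * (N * (k : ℝ) ^ 2) ^ t) := by
        refine Finset.prod_le_prod' fun j _ => ?_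
        refine (tsum_cell_rpow_le hK (hfK j) (hscale j) ht ht0).trans
          (ENNReal.ofReal_le_ofReal ?_)
        have : (((j : ℕ+) : ℕ) : ℝ) ≤ k := by exact_mod_cast mem_coords.1 j.2
        have := (hscale j).trans' zero_le_one
        unfold gridScale at *
        gcongr
    _ = _ := by
        rw [Finset.prod_const, Finset.card_univ, Fintype.card_coe, card_coords,
          ENNReal.ofReal_pow (by positivity)]

end Component

/-! ### Summation over the model dimension -/

theorem summable_exp_neg_mul_log {a : ℝ} (ha : 0 < a) (b : ℝ) :
    Summable fun k : ℕ => Real.exp (-(a * k * Real.log k) + k * b) := by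
  have h1 : ∀ᶠ k : ℕ in Filter.atTop, (b + 1) / a ≤ Real.log k :=
    (Real.tendsto_log_atTop.comp tendsto_natCast_atTop_atTop).eventually_ge_atTop _
  refine Summable.of_norm_bounded_eventually_nat (g := fun k : ℕ => Real.exp (-k))
    Real.summable_exp_neg_nat ?_
  filter_upwards [h1] with k hk
  rw [Real.norm_eq_abs, Real.abs_exp]
  refine Real.exp_le_exp.2 ?_
  rw [div_le_iff₀ ha] at hk
  have := mul_le_mul_of_nonneg_left hk (Nat.cast_nonneg k : (0 : ℝ) ≤ k)
  linarith

/-- After the power `1 - t ≥ 1/2` the prior tail still supplies `exp(-(C₂/2) k log k)`. One half of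
this exponent keeps the sum finite. The other half pays for `t k log n + 2 t k log k` when `k ≥ k₀`,
because there `log n ≤ A log k`. When `k ≤ k₀` it pays for the second term only, and the first is at
most `k₀ log n`. -/
theorem tsum_prior_rpow_mul_le {π : PMF ℕ} {C₁ C₂ : ℝ} (hC₁ : 0 < C₁) (hC₂ : 0 < C₂)
    (hπ : PriorTail π C₁ C₂) {t A : ℝ} (ht0 : 0 < t) (ht : t ≤ 1 / 2) (hA : 0 ≤ A)
    (htA : t * (A + 2) ≤ C₂ / 4) {n k₀ : ℕ} (hn : 1 ≤ n)
    (hk₀ : ∀ k : ℕ, k₀ ≤ k → Real.log n ≤ A * Real.log k) {C : ℝ} (hC : 1 ≤ C) :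
    ∑' k, π k ^ (1 - t) * ENNReal.ofReal ((C * (n * (k : ℝ) ^ 2) ^ t) ^ k)
      ≤ ENNReal.ofReal (Real.exp (k₀ * Real.log n)
        * ∑' k : ℕ, (1 + C₁) * Real.exp (-(C₂ / 4 * k * Real.log k) + k * Real.log C)) := by
  have hsum := (summable_exp_neg_mul_log (show 0 < C₂ / 4 by positivity) (Real.log C)).mul_left
    (1 + C₁)
  rw [← tsum_mul_left, ENNReal.ofReal_tsum_of_nonneg (fun k => by positivity) (hsum.mul_left _)]
  refine ENNReal.tsum_le_tsum fun k => ?_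
  have hln : 0 ≤ Real.log n := Real.log_natCast_nonneg n
  -- The tail hypothesis starts at `k = 1`; at `k = 0` the trivial bound 1 is covered by the `1` in
  -- the factor `1 + C₁`.
  rcases Nat.eq_zero_or_pos k with rfl | hk
  · simp only [pow_zero, ENNReal.ofReal_one, mul_one]
    calc π 0 ^ (1 - t) ≤ 1 ^ (1 - t) := ENNReal.rpow_le_rpow (π.coe_le_one 0) (by linarith)
      _ = ENNReal.ofReal 1 := by simp
      _ ≤ _ := by
        refine ENNReal.ofReal_le_ofReal ?_
        have : 1 ≤ Real.exp (k₀ * Real.log n) := Real.one_le_exp (by positivity)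
        simp only [Nat.cast_zero, mul_zero, zero_mul, neg_zero, add_zero, Real.exp_zero, mul_one]
        nlinarith
  · have hk1 : (1 : ℝ) ≤ k := by exact_mod_cast hk
    have hlk : 0 ≤ Real.log k := Real.log_natCast_nonneg k
    have hn0 : (0 : ℝ) < n := by exact_mod_cast hn
    have h1 : π k ≤ ENNReal.ofReal (C₁ * Real.exp (-C₂ * k * Real.log k)) :=
      (ENNReal.le_tsum (f := fun j : Set.Ici k => π j) ⟨k, le_refl k⟩).trans (hπ k hk)
    have h2 : π k ^ (1 - t)
        ≤ ENNReal.ofReal ((1 + C₁) * Real.exp (-(C₂ / 2 * k * Real.log k))) := by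
      refine (ENNReal.rpow_le_rpow h1 (by linarith)).trans ?_
      rw [ENNReal.ofReal_rpow_of_nonneg (by positivity) (by linarith),
        Real.mul_rpow hC₁.le (Real.exp_pos _).le, ← Real.exp_mul]
      refine ENNReal.ofReal_le_ofReal (mul_le_mul ?_ (Real.exp_le_exp.2 ?_)
        (Real.exp_pos _).le (by positivity))
      · calc C₁ ^ (1 - t) ≤ (1 + C₁) ^ (1 - t) :=
              Real.rpow_le_rpow hC₁.le (by linarith) (by linarith)
          _ ≤ (1 + C₁) ^ (1 : ℝ) :=
              Real.rpow_le_rpow_of_exponent_le (by linarith) (by linarith)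
          _ = _ := Real.rpow_one _
      · have : 0 ≤ C₂ * k * Real.log k := by positivity
        nlinarith
    have h3 : (C * (n * (k : ℝ) ^ 2) ^ t) ^ k
        = Real.exp (k * (Real.log C + t * Real.log n + 2 * t * Real.log k)) := by
      rw [Real.exp_nat_mul, Real.exp_add, Real.exp_add, Real.exp_log (by linarith),
        Real.mul_rpow hn0.le (by positivity), Real.rpow_def_of_pos hn0,
        Real.rpow_def_of_pos (by positivity), Real.log_pow]
      congr 1
      rw [mul_comm (Real.log n) t,
        show ((2 : ℕ) : ℝ) * Real.log k * t = 2 * t * Real.log k by push_cast; ring, ← mul_assoc]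
    calc _ ≤ ENNReal.ofReal ((1 + C₁) * Real.exp (-(C₂ / 2 * k * Real.log k)))
          * ENNReal.ofReal ((C * (n * (k : ℝ) ^ 2) ^ t) ^ k) := by gcongr
      _ ≤ _ := by
        rw [← ENNReal.ofReal_mul (by positivity), h3]
        refine ENNReal.ofReal_le_ofReal ?_
        rw [mul_assoc, ← Real.exp_add, mul_left_comm, ← Real.exp_add]
        refine mul_le_mul_of_nonneg_left (Real.exp_le_exp.2 ?_) (by positivity)
        have hkl : 0 ≤ k * Real.log k := by positivity
        have h5 : 2 * t ≤ C₂ / 4 := by nlinarith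
        have h6 : t * (k * Real.log n) + 2 * t * (k * Real.log k)
            ≤ k₀ * Real.log n + C₂ / 4 * (k * Real.log k) := by
          rcases le_total k₀ k with h | h
          · have h7 : k * Real.log n ≤ A * (k * Real.log k) := by
              have := mul_le_mul_of_nonneg_left (hk₀ k h) (Nat.cast_nonneg k : (0 : ℝ) ≤ k)
              linarith
            have h8 := mul_le_mul_of_nonneg_left h7 ht0.le
            have h9 := mul_le_mul_of_nonneg_right htA hkl
            have : (0 : ℝ) ≤ k₀ * Real.log n := by positivity
            nlinarith
          · have h7 : k * Real.log n ≤ k₀ * Real.log n := by gcongr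
            have h8 := mul_le_mul_of_nonneg_right h5 hkl
            have h9 : (0 : ℝ) ≤ k * Real.log n := by positivity
            nlinarith
        linarith

/-! ### The weighted evidence -/

/-- Squared Hellinger distance of a lattice point to the true parameter. -/
noncomputable def gridHellinger (N : ℝ) (θ₀ : ℕ+ → ℝ) (k : ℕ) (m : coords k → ℤ) : ℝ :=
  hellingerSq (expFamily (gridPoint N k m)) (expFamily θ₀)

/-- A bound, piecewise constant in the parameter, for the exponentially weighted evidence. -/
noncomputable def evidenceEnvelope (π : PMF ℕ) (f : ℕ+ → ℝ → ℝ) (t : ℝ) (θ₀ : ℕ+ → ℝ) {n : ℕ}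
    (X : Fin n → ℝ) : ℝ≥0∞ :=
  ∑' k, ∑' m : coords k → ℤ, π k * sieveComponent f k (gridCell n k m)
    * ENNReal.ofReal (Real.exp (4 * gridConst + 2 * t * n * gridHellinger n θ₀ k m))
    * likelihood X (gridPoint n k m)

section Envelope

variable {f : ℕ+ → ℝ → ℝ} {π : PMF ℕ} {θ₀ : ℕ+ → ℝ} {t : ℝ} {n : ℕ}

/-- Each of the `n` likelihood factors changes by at most `exp(2 gridConst/n)`. The weak triangle
inequality for `H²` doubles the weight exponent and adds another `2 gridConst`. The doubled `2t` is
exactly what the affinity bound can cancel. -/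
theorem likelihood_mul_exp_le (h₀ : Summable θ₀) (ht0 : 0 ≤ t) (ht : t ≤ 1) (hn : 0 < n)
    (X : Fin n → ℝ) {k : ℕ} {m : coords k → ℤ} {θ : ℕ+ → ℝ} (hθ : truncate k θ = θ)
    (hm : θ ∈ gridCell n k m) :
    likelihood X θ * ENNReal.ofReal (Real.exp (t * n * hellingerSq (expFamily θ) (expFamily θ₀)))
      ≤ ENNReal.ofReal (Real.exp (4 * gridConst + 2 * t * n * gridHellinger n θ₀ k m))
        * likelihood X (gridPoint n k m) := by
  have hn' : (0 : ℝ) < n := by exact_mod_cast hn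
  have hs : Summable θ := hθ ▸ summable_truncate k θ
  have hs' := summable_gridPoint n k m
  have hd := abs_logSeries_sub_gridPoint_le hn' hθ hm
  have h1 : ∏ i, expDensity θ (X i)
      ≤ Real.exp (2 * gridConst) * ∏ i, expDensity (gridPoint n k m) (X i) := by
    calc _ ≤ ∏ i, Real.exp (2 * (gridConst / n)) * expDensity (gridPoint n k m) (X i) :=
          Finset.prod_le_prod (fun i _ => (expDensity_pos _ _).le)
            fun i _ => expDensity_le_of_abs_sub_le hs hs' hd (X i)
      _ = _ := by
          rw [Finset.prod_mul_distrib, Finset.prod_const, Finset.card_univ, Fintype.card_fin,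
            ← Real.exp_nat_mul]
          congr 2
          field_simp
  have h2 : t * n * hellingerSq (expFamily θ) (expFamily θ₀)
      ≤ 2 * gridConst + 2 * t * n * gridHellinger n θ₀ k m := by
    have h3 := hellingerSq_triangle hs hs' h₀
    have h4 := hellingerSq_le_of_abs_sub_le hs hs' hd
    have h5 : t * n * (gridConst / n) ≤ gridConst := by
      have : t * n * (gridConst / n) = t * gridConst := by field_simp
      rw [this]
      exact mul_le_of_le_one_left gridConst_nonneg ht
    have h6 : (0 : ℝ) ≤ t * n := by positivity
    unfold gridHellinger
    nlinarith [mul_le_mul_of_nonneg_left h3 h6, mul_le_mul_of_nonneg_left h4 h6]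
  rw [likelihood_eq_ofReal, likelihood_eq_ofReal, ← ENNReal.ofReal_mul
    (Finset.prod_nonneg fun _ _ => (expDensity_pos _ _).le), ← ENNReal.ofReal_mul
    (Real.exp_pos _).le]
  refine ENNReal.ofReal_le_ofReal ?_
  have h7 : 0 ≤ ∏ i, expDensity (gridPoint n k m) (X i) :=
    Finset.prod_nonneg fun _ _ => (expDensity_pos _ _).le
  calc _ ≤ (Real.exp (2 * gridConst) * ∏ i, expDensity (gridPoint n k m) (X i))
        * Real.exp (2 * gridConst + 2 * t * n * gridHellinger n θ₀ k m) := by gcongr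
    _ = _ := by
        rw [mul_right_comm, ← Real.exp_add]
        congr 2
        ring

theorem lintegral_likelihood_mul_exp_le (hf : ∀ j, IsProbDensity (f j)) (h₀ : Summable θ₀)
    (ht0 : 0 ≤ t) (ht : t ≤ 1) (hn : 0 < n) (X : Fin n → ℝ) :
    ∫⁻ θ, likelihood X θ
        * ENNReal.ofReal (Real.exp (t * n * hellingerSq (expFamily θ) (expFamily θ₀)))
        ∂sievePrior π f
      ≤ evidenceEnvelope π f t θ₀ X := by
  rw [lintegral_sievePrior, evidenceEnvelope]
  refine ENNReal.tsum_le_tsum fun k => ?_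
  rw [lintegral_eq_tsum_gridCell n k, ← ENNReal.tsum_mul_left]
  refine ENNReal.tsum_le_tsum fun m => ?_
  rw [mul_assoc, mul_assoc]
  refine mul_le_mul_right ?_ _
  rw [mul_comm (sieveComponent f k _), ← setLIntegral_const]
  refine setLIntegral_mono_ae' (measurableSet_gridCell n k m) ?_
  filter_upwards [ae_truncate_eq_sieveComponent hf k] with θ hθ hm
  exact likelihood_mul_exp_le h₀ ht0 ht hn X hθ hm

theorem evidence_le_envelope (hf : ∀ j, IsProbDensity (f j)) (h₀ : Summable θ₀)
    (ht0 : 0 ≤ t) (ht : t ≤ 1) (hn : 0 < n) (X : Fin n → ℝ) :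
    ∫⁻ θ, likelihood X θ ∂sievePrior π f ≤ evidenceEnvelope π f t θ₀ X := by
  refine le_trans (lintegral_mono fun θ => ?_)
    (lintegral_likelihood_mul_exp_le hf h₀ ht0 ht hn X)
  refine le_mul_of_one_le_right zero_le ?_
  rw [ENNReal.one_le_ofReal]
  exact Real.one_le_exp (mul_nonneg (by positivity) (hellingerSq_nonneg _ _))

theorem measurable_evidenceEnvelope (π : PMF ℕ) (f : ℕ+ → ℝ → ℝ) (t : ℝ) (θ₀ : ℕ+ → ℝ) (n : ℕ) :
    Measurable fun X : Fin n → ℝ => evidenceEnvelope π f t θ₀ X :=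
  Measurable.tsum fun k => Measurable.tsum fun m =>
    (measurable_likelihood (summable_gridPoint n k m)).const_mul _

/-- By independence the integral is the `n`-th power of `∫ (p/q)^(1-t) q = ∫ p^(1-t) q^t`. -/
theorem lintegral_likelihood_ratio_rpow_le {θ : ℕ+ → ℝ} (hθ : Summable θ) (h₀ : Summable θ₀)
    (ht0 : 0 ≤ t) (ht : t ≤ 1 / 2) (n : ℕ) :
    ∫⁻ X : Fin n → ℝ, (likelihood X θ * (likelihood X θ₀)⁻¹) ^ (1 - t) ∂sampleLaw n θ₀
      ≤ ENNReal.ofReal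
        (Real.exp (-(2 * t * n * hellingerSq (expFamily θ) (expFamily θ₀)))) := by
  have := isProbabilityMeasure_expFamily h₀
  set g : ℝ → ℝ≥0∞ := fun x =>
    (ENNReal.ofReal (expDensity θ x) * (ENNReal.ofReal (expDensity θ₀ x))⁻¹) ^ (1 - t) with hg
  have hgm : Measurable g := by
    have h1 := (continuous_expDensity hθ).measurable.ennreal_ofReal
    have h2 := (continuous_expDensity h₀).measurable.ennreal_ofReal
    exact (h1.mul h2.inv).pow_const _
  have e1 : ∀ X : Fin n → ℝ, (likelihood X θ * (likelihood X θ₀)⁻¹) ^ (1 - t)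
      = ∏ i, g (X i) := by
    intro X
    rw [hg, ENNReal.prod_rpow_of_nonneg (by linarith), Finset.prod_mul_distrib, likelihood,
      likelihood, ENNReal.prod_inv_distrib]
    intro i _ j _ _
    exact Or.inr ENNReal.ofReal_ne_top
  have e2 : ∫⁻ x, g x ∂expFamily θ₀
      ≤ ENNReal.ofReal (Real.exp (-(2 * t * hellingerSq (expFamily θ) (expFamily θ₀)))) := by
    refine le_trans (le_of_eq ?_) (integral_rpow_mul_rpow_le hθ h₀ ht0 ht)
    rw [expFamily, lintegral_withDensity_eq_lintegral_mul _
      (continuous_expDensity h₀).measurable.ennreal_ofReal hgm]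
    refine lintegral_congr fun x => ?_
    have hp := expDensity_pos θ x
    have hq := expDensity_pos θ₀ x
    simp only [Pi.mul_apply, hg]
    rw [← ENNReal.ofReal_inv_of_pos hq, ← ENNReal.ofReal_mul hp.le,
      ENNReal.ofReal_rpow_of_pos (by positivity), ← ENNReal.ofReal_mul hq.le]
    congr 1
    rw [Real.mul_rpow hp.le (by positivity), Real.inv_rpow hq.le, ← Real.rpow_neg hq.le,
      mul_left_comm]
    congr 1
    nth_rewrite 1 [← Real.rpow_one (expDensity θ₀ x)]
    rw [← Real.rpow_add hq]
    congr 1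
    ring
  simp_rw [e1]
  rw [sampleLaw, lintegral_prod_eq_prod_lintegral_of_indepFun Finset.univ
    (fun (i : Fin n) (X : Fin n → ℝ) => g (X i))
    (iIndepFun_pi (μ := fun _ : Fin n => expFamily θ₀) (X := fun _ => g)
      fun _ => hgm.aemeasurable) fun i => hgm.comp (measurable_pi_apply i)]
  have e3 : ∀ i : Fin n, ∫⁻ X, g (X i) ∂(Measure.pi fun _ : Fin n => expFamily θ₀)
      = ∫⁻ x, g x ∂expFamily θ₀ := fun i =>
    (measurePreserving_eval (fun _ : Fin n => expFamily θ₀) i).lintegral_comp hgm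
  simp_rw [e3]
  rw [Finset.prod_const, Finset.card_univ, Fintype.card_fin]
  calc _ ≤ ENNReal.ofReal
        (Real.exp (-(2 * t * hellingerSq (expFamily θ) (expFamily θ₀)))) ^ n := by gcongr
    _ = _ := by
        rw [← ENNReal.ofReal_pow (Real.exp_pos _).le, ← Real.exp_nat_mul]
        congr 2
        ring

/-- The power is taken cell by cell before integrating over the sample. The weight is at least 1, so
its own power `1 - t` may be dropped, after which `exp(2 t n H²)` cancels against the affinity
bound. The result no longer depends on the true parameter. -/
theorem lintegral_envelope_ratio_rpow_le (h₀ : Summable θ₀) (ht0 : 0 ≤ t) (ht : t ≤ 1 / 2) :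
    ∫⁻ X : Fin n → ℝ, (evidenceEnvelope π f t θ₀ X * (likelihood X θ₀)⁻¹) ^ (1 - t)
        ∂sampleLaw n θ₀
      ≤ ENNReal.ofReal (Real.exp (4 * gridConst)) * ∑' k, π k ^ (1 - t)
        * ∑' m : coords k → ℤ, sieveComponent f k (gridCell n k m) ^ (1 - t) := by
  have hs0 : 0 < 1 - t := by linarith
  have hs1 : 1 - t ≤ 1 := by linarith
  set c : ∀ k : ℕ, (coords k → ℤ) → ℝ≥0∞ := fun k m =>
    π k * sieveComponent f k (gridCell n k m)
      * ENNReal.ofReal (Real.exp (4 * gridConst + 2 * t * n * gridHellinger n θ₀ k m)) with hc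
  have hm : ∀ k (m : coords k → ℤ), Measurable fun X : Fin n → ℝ =>
      (likelihood X (gridPoint n k m) * (likelihood X θ₀)⁻¹) ^ (1 - t) := fun k m =>
    ((measurable_likelihood (summable_gridPoint n k m)).mul
      (measurable_likelihood h₀).inv).pow_const _
  calc _ ≤ ∫⁻ X : Fin n → ℝ, ∑' k, ∑' m : coords k → ℤ, c k m ^ (1 - t)
        * (likelihood X (gridPoint n k m) * (likelihood X θ₀)⁻¹) ^ (1 - t)
        ∂sampleLaw n θ₀ := by
        refine lintegral_mono fun X => ?_
        rw [evidenceEnvelope, ← ENNReal.tsum_mul_right]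
        refine (ENNReal_tsum_rpow_le _ hs0 hs1).trans (ENNReal.tsum_le_tsum fun k => ?_)
        rw [← ENNReal.tsum_mul_right]
        refine (ENNReal_tsum_rpow_le _ hs0 hs1).trans (ENNReal.tsum_le_tsum fun m => ?_)
        rw [mul_assoc _ (likelihood X (gridPoint n k m)), ENNReal.mul_rpow_of_nonneg _ _ hs0.le]
    _ = ∑' k, ∑' m : coords k → ℤ, c k m ^ (1 - t) * ∫⁻ X : Fin n → ℝ,
        (likelihood X (gridPoint n k m) * (likelihood X θ₀)⁻¹) ^ (1 - t) ∂sampleLaw n θ₀ := by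
        rw [lintegral_tsum fun k =>
          (Measurable.tsum fun m => (hm k m).const_mul _).aemeasurable]
        refine tsum_congr fun k => ?_
        rw [lintegral_tsum fun m => ((hm k m).const_mul _).aemeasurable]
        exact tsum_congr fun m => lintegral_const_mul _ (hm k m)
    _ ≤ ∑' k, ∑' m : coords k → ℤ, ENNReal.ofReal (Real.exp (4 * gridConst))
        * (π k ^ (1 - t) * sieveComponent f k (gridCell n k m) ^ (1 - t)) := by
        refine ENNReal.tsum_le_tsum fun k => ENNReal.tsum_le_tsum fun m => ?_
        set H := gridHellinger n θ₀ k m with hH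
        have hH0 : 0 ≤ H := hellingerSq_nonneg _ _
        have h1 := lintegral_likelihood_ratio_rpow_le (summable_gridPoint n k m) h₀ ht0 ht n
        have h2 : ENNReal.ofReal (Real.exp (4 * gridConst + 2 * t * n * H)) ^ (1 - t)
            ≤ ENNReal.ofReal (Real.exp (4 * gridConst + 2 * t * n * H)) := by
          conv_rhs => rw [← ENNReal.rpow_one (ENNReal.ofReal _)]
          refine ENNReal.rpow_le_rpow_of_exponent_le ?_ hs1
          rw [ENNReal.one_le_ofReal]
          have := gridConst_nonneg
          exact Real.one_le_exp (by positivity)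
        calc _ ≤ (π k * sieveComponent f k (gridCell n k m)) ^ (1 - t)
              * ENNReal.ofReal (Real.exp (4 * gridConst + 2 * t * n * H))
              * ENNReal.ofReal (Real.exp (-(2 * t * n * H))) := by
              rw [hc, ENNReal.mul_rpow_of_nonneg _ _ hs0.le]
              gcongr
              exact h1
          _ = _ := by
              rw [mul_assoc, ← ENNReal.ofReal_mul (Real.exp_pos _).le, ← Real.exp_add,
                ENNReal.mul_rpow_of_nonneg _ _ hs0.le, mul_comm, add_neg_cancel_right]
    _ = _ := by simp_rw [ENNReal.tsum_mul_left]

end Envelope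

/-! ### Product measures with product densities -/

/-- Cylinders determine a product measure. On a cylinder the indicator times the density is a finite
product of functions of independent coordinates, since all but finitely many densities equal 1. -/
theorem infinitePi_eq_withDensity {ι X : Type*} [MeasurableSpace X] {μ ν : ι → Measure X}
    [∀ i, IsProbabilityMeasure (μ i)] [∀ i, IsProbabilityMeasure (ν i)] {R : ι → X → ℝ≥0∞}
    (hR : ∀ i, Measurable (R i)) (h : ∀ i, (ν i).withDensity (R i) = μ i) {S : Finset ι}
    (hS : ∀ i ∉ S, R i = 1) :
    Measure.infinitePi μ
      = (Measure.infinitePi ν).withDensity fun θ => ∏ i ∈ S, R i (θ i) := by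
  classical
  symm
  refine Measure.eq_infinitePi μ fun s T hT => ?_
  set T' : ι → Set X := fun i => if i ∈ s then T i else Set.univ with hT'
  have hT'm : ∀ i, MeasurableSet (T' i) := fun i => by
    simp only [hT']
    split_ifs
    exacts [hT i, MeasurableSet.univ]
  have hpi : MeasurableSet (Set.pi (s : Set ι) T) :=
    MeasurableSet.pi s.countable_toSet fun i _ => hT i
  set g : ι → X → ℝ≥0∞ := fun i => (T' i).indicator (R i) with hg
  have hgm : ∀ i, Measurable (g i) := fun i => (hR i).indicator (hT'm i)
  have e : ∀ θ : ι → X, (Set.pi (s : Set ι) T).indicator (fun θ => ∏ i ∈ S, R i (θ i)) θ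
      = ∏ i ∈ s ∪ S, g i (θ i) := by
    intro θ
    by_cases hθ : θ ∈ Set.pi (s : Set ι) T
    · rw [Set.indicator_of_mem hθ]
      have h1 : ∀ i, θ i ∈ T' i := fun i => by
        simp only [hT']
        split_ifs with hi
        exacts [hθ i hi, Set.mem_univ _]
      have h2 : ∀ i, g i (θ i) = R i (θ i) := fun i => Set.indicator_of_mem (h1 i) _
      simp_rw [h2]
      refine Finset.prod_subset Finset.subset_union_right fun i _ hi => ?_
      rw [hS i hi, Pi.one_apply]
    · rw [Set.indicator_of_notMem hθ]
      simp only [Set.mem_pi, not_forall] at hθ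
      obtain ⟨i, hi, hθi⟩ := hθ
      symm
      refine Finset.prod_eq_zero (Finset.mem_union_left S hi) (Set.indicator_of_notMem ?_ _)
      simp only [hT']
      rwa [if_pos (Finset.mem_coe.1 hi)]
  rw [withDensity_apply _ hpi, ← lintegral_indicator hpi]
  simp_rw [e]
  rw [lintegral_prod_eq_prod_lintegral_of_indepFun (s ∪ S)
    (fun i (θ : ι → X) => g i (θ i)) (iIndepFun_infinitePi hgm)
    fun i => (hgm i).comp (measurable_pi_apply i)]
  have e2 : ∀ i, ∫⁻ θ, g i (θ i) ∂Measure.infinitePi ν = μ i (T' i) := by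
    intro i
    rw [← h i, withDensity_apply _ (hT'm i), ← lintegral_indicator (hT'm i)]
    exact (measurePreserving_eval_infinitePi ν i).lintegral_comp (hgm i)
  simp_rw [e2]
  rw [← Finset.prod_subset Finset.subset_union_left fun i _ hi => by
    simp only [hT']
    rw [if_neg hi, measure_univ]]
  exact Finset.prod_congr rfl fun i hi => by simp only [hT']; rw [if_pos hi]

/-! ### The Gaussian comparison measure -/

/-- The Gaussian product measure centred at the truncation of `θ₀`, with variance `v` in the
first `k` coordinates. -/
noncomputable def sieveGaussian (θ₀ : ℕ+ → ℝ) (v : ℝ≥0) (k : ℕ) : Measure (ℕ+ → ℝ) :=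
  Measure.infinitePi fun j : ℕ+ =>
    gaussianReal (truncate k θ₀ j) (if (j : ℕ) ≤ k then v else 0)

section Gaussian

variable {θ₀ : ℕ+ → ℝ} {v : ℝ≥0} {k : ℕ}

instance isProbabilityMeasure_sieveGaussian : IsProbabilityMeasure (sieveGaussian θ₀ v k) := by
  unfold sieveGaussian
  infer_instance

theorem sieveGaussian_mem : sieveGaussian θ₀ v k ∈ gaussianMeanField := ⟨_, _, rfl⟩

theorem ae_truncate_eq_sieveGaussian :
    ∀ᵐ θ ∂sieveGaussian θ₀ v k, truncate k θ = θ := by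
  refine ae_truncate_eq fun j hj => ?_
  rw [if_neg hj, gaussianReal_zero_var, truncate, if_neg hj]

theorem map_eval_sieveGaussian {j : ℕ+} (hj : j ∈ coords k) :
    (sieveGaussian θ₀ v k).map (fun θ => θ j) = gaussianReal (θ₀ j) v := by
  rw [sieveGaussian, Measure.infinitePi_map_eval, if_pos (mem_coords.1 hj), truncate_eq_self _ hj]

theorem memLp_eval_sieveGaussian {j : ℕ+} (hj : j ∈ coords k) :
    MemLp (fun θ : ℕ+ → ℝ => θ j) 2 (sieveGaussian θ₀ v k) := by
  have h := memLp_id_gaussianReal (μ := θ₀ j) (v := v) 2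
  rw [← map_eval_sieveGaussian (k := k) hj] at h
  exact h.comp_of_map (measurable_pi_apply j).aemeasurable

theorem integrable_eval_sieveGaussian {j : ℕ+} (hj : j ∈ coords k) :
    Integrable (fun θ : ℕ+ → ℝ => θ j) (sieveGaussian θ₀ v k) :=
  (memLp_eval_sieveGaussian hj).integrable one_le_two

theorem integral_eval_sieveGaussian {j : ℕ+} (hj : j ∈ coords k) :
    ∫ θ, θ j ∂sieveGaussian θ₀ v k = θ₀ j := by
  have := integral_map (μ := sieveGaussian θ₀ v k) (φ := fun θ => θ j) (f := id)
    (measurable_pi_apply j).aemeasurable (by fun_prop)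
  rw [map_eval_sieveGaussian hj] at this
  simp only [id] at this
  rw [← this, integral_id_gaussianReal]

theorem integral_sq_eval_sieveGaussian {j : ℕ+} (hj : j ∈ coords k) :
    ∫ θ, θ j ^ 2 ∂sieveGaussian θ₀ v k = θ₀ j ^ 2 + v := by
  have h1 := variance_eq_sub (memLp_eval_sieveGaussian (θ₀ := θ₀) (v := v) hj)
  have h2 : Var[fun θ : ℕ+ → ℝ => θ j; sieveGaussian θ₀ v k] = v := by
    have := variance_map (μ := sieveGaussian θ₀ v k) (Y := fun θ => θ j) (X := id)
      (by fun_prop) (measurable_pi_apply j).aemeasurable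
    rw [map_eval_sieveGaussian hj, variance_id_gaussianReal] at this
    exact this.symm
  rw [h2, integral_eval_sieveGaussian hj] at h1
  have h3 : ∫ θ, θ j ^ 2 ∂sieveGaussian θ₀ v k
      = ∫ θ, ((fun θ : ℕ+ → ℝ => θ j) ^ 2) θ ∂sieveGaussian θ₀ v k := rfl
  rw [h3]
  linarith

/-- The variance of `∑_{j ≤ k} θ_j φ_j(x)` is `v` times this quantity. -/
noncomputable def basisEnergy (k : ℕ) (x : ℝ) : ℝ := ∑ j ∈ coords k, trigBasis j x ^ 2

theorem basisEnergy_nonneg (k : ℕ) (x : ℝ) : 0 ≤ basisEnergy k x :=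
  Finset.sum_nonneg fun _ _ => sq_nonneg _

theorem basisEnergy_le (k : ℕ) (x : ℝ) : basisEnergy k x ≤ 2 * k := by
  refine (Finset.sum_le_card_nsmul (coords k) _ 2 fun j _ => sq_trigBasis_le j x).trans (le_of_eq ?_)
  rw [card_coords, nsmul_eq_mul, mul_comm]

theorem continuous_basisEnergy (k : ℕ) : Continuous (basisEnergy k) :=
  continuous_finsetSum _ fun j _ => (continuous_trigBasis j).pow 2

theorem integral_exp_logSeries_sieveGaussian (x : ℝ) :
    ∫ θ, Real.exp (logSeries (truncate k θ) x) ∂sieveGaussian θ₀ v k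
      = Real.exp (logSeries (truncate k θ₀) x + v * basisEnergy k x / 2) := by
  have hind : iIndepFun (fun (j : ℕ+) (θ : ℕ+ → ℝ) => trigBasis j x * θ j)
      (sieveGaussian θ₀ v k) :=
    iIndepFun_infinitePi (X := fun (j : ℕ+) (y : ℝ) => trigBasis j x * y)
      fun j => measurable_id.const_mul _
  have h1 := hind.mgf_sum (t := 1) (fun j => (measurable_pi_apply j).const_mul _) (coords k)
  have h2 : ∫ θ, Real.exp (logSeries (truncate k θ) x) ∂sieveGaussian θ₀ v k
      = mgf (∑ j ∈ coords k, fun θ : ℕ+ → ℝ => trigBasis j x * θ j) (sieveGaussian θ₀ v k) 1 := by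
    rw [mgf]
    refine integral_congr_ae (ae_of_all _ fun θ => ?_)
    simp only [logSeries_truncate, one_mul, Finset.sum_apply]
    congr 1
    exact Finset.sum_congr rfl fun j _ => mul_comm _ _
  rw [h2, h1, logSeries_truncate, basisEnergy, Finset.mul_sum, Finset.sum_div,
    ← Finset.sum_add_distrib, Real.exp_sum]
  refine Finset.prod_congr rfl fun j hj => ?_
  rw [mgf_const_mul, mgf_gaussianReal (map_eval_sieveGaussian hj)]
  congr 1
  ring

theorem integrable_exp_logSeries_sieveGaussian :
    Integrable (fun p : (ℕ+ → ℝ) × ℝ => Real.exp (logSeries (truncate k p.1) p.2))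
      ((sieveGaussian θ₀ v k).prod (volume.restrict (Set.Icc (0 : ℝ) 1))) := by
  have hm : Measurable fun p : (ℕ+ → ℝ) × ℝ => Real.exp (logSeries (truncate k p.1) p.2) :=
    Real.measurable_exp.comp (measurable_logSeries_truncate k)
  rw [integrable_prod_iff' hm.aestronglyMeasurable]
  constructor
  -- A non-integrable function would have integral zero by convention, whereas the computed value is
  -- an exponential.
  · refine ae_of_all _ fun x => Integrable.of_integral_ne_zero ?_
    rw [integral_exp_logSeries_sieveGaussian]
    exact Real.exp_ne_zero _
  · simp only [Real.norm_eq_abs, Real.abs_exp, integral_exp_logSeries_sieveGaussian]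
    refine integrable_unitInterval_of_continuous (Real.continuous_exp.comp ?_)
    exact (continuous_logSeries (summable_truncate k θ₀)).add
      ((continuous_const.mul (continuous_basisEnergy k)).div_const 2)

theorem integrable_logPartition_sieveGaussian :
    Integrable (fun θ => logPartition (truncate k θ)) (sieveGaussian θ₀ v k) := by
  have h1 : Integrable (fun θ : ℕ+ → ℝ => Real.sqrt 2 * ∑ j ∈ coords k, |θ j|)
      (sieveGaussian θ₀ v k) :=
    (integrable_finsetSum _ fun j hj => (integrable_eval_sieveGaussian hj).abs).const_mul _
  refine h1.mono' (measurable_logPartition_truncate k).aestronglyMeasurable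
    (ae_of_all _ fun θ => ?_)
  refine (abs_logPartition_le (summable_truncate k θ)).trans (le_of_eq ?_)
  rw [tsum_eq_sum (s := coords k) fun j hj => by rw [truncate_eq_zero θ hj, abs_zero]]
  congr 1
  exact Finset.sum_congr rfl fun j hj => by rw [truncate_eq_self θ hj]

/-- The logarithm lies below its tangent at the partition function of `θ₀`. This makes the
expectation linear in the partition function, and Fubini reduces it to the Gaussian moment
generating function. -/
theorem integral_logPartition_sieveGaussian_le :
    ∫ θ, logPartition (truncate k θ) ∂sieveGaussian θ₀ v k
      ≤ logPartition θ₀ - 1 + ∫ x in Set.Icc (0 : ℝ) 1, expDensity θ₀ x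
        * Real.exp (logSeries (truncate k θ₀) x - logSeries θ₀ x + v * basisEnergy k x / 2) := by
  have hint := integrable_exp_logSeries_sieveGaussian (θ₀ := θ₀) (v := v) (k := k)
  have h1 : ∀ θ : ℕ+ → ℝ, logPartition (truncate k θ) ≤ logPartition θ₀ - 1
      + Real.exp (-logPartition θ₀)
        * ∫ x in Set.Icc (0 : ℝ) 1, Real.exp (logSeries (truncate k θ) x) := by
    intro θ
    rw [← exp_logPartition (summable_truncate k θ), ← Real.exp_add]
    linarith [Real.add_one_le_exp (-logPartition θ₀ + logPartition (truncate k θ))]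
  have h2 : ∫ θ, (∫ x in Set.Icc (0 : ℝ) 1, Real.exp (logSeries (truncate k θ) x))
        ∂sieveGaussian θ₀ v k
      = ∫ x in Set.Icc (0 : ℝ) 1,
        Real.exp (logSeries (truncate k θ₀) x + v * basisEnergy k x / 2) := by
    rw [integral_integral_swap hint]
    simp_rw [integral_exp_logSeries_sieveGaussian]
  have hint' : Integrable (fun θ : ℕ+ → ℝ => Real.exp (-logPartition θ₀)
      * ∫ x in Set.Icc (0 : ℝ) 1, Real.exp (logSeries (truncate k θ) x))
      (sieveGaussian θ₀ v k) := hint.integral_prod_left.const_mul _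
  calc _ ≤ ∫ θ, (logPartition θ₀ - 1 + Real.exp (-logPartition θ₀)
        * ∫ x in Set.Icc (0 : ℝ) 1, Real.exp (logSeries (truncate k θ) x))
          ∂sieveGaussian θ₀ v k :=
        integral_mono integrable_logPartition_sieveGaussian
          ((integrable_const _).add hint') h1
    _ = _ := by
        rw [integral_add (integrable_const _) hint',
          integral_const_mul, h2, ← integral_const_mul]
        simp only [integral_const, probReal_univ, one_smul]
        congr 1
        refine integral_congr_ae (ae_of_all _ fun x => ?_)
        simp only [expDensity, ← Real.exp_add]
        congr 1
        ring

end Gaussian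

/-! ### Density of the Gaussian measure with respect to a sieve component -/

section GaussianDensity

variable {f : ℕ+ → ℝ → ℝ} {θ₀ : ℕ+ → ℝ} {v : ℝ≥0} {k : ℕ}

/-- The density of `sieveGaussian θ₀ v k` with respect to `sieveComponent f k`. -/
noncomputable def gaussianSieveDensity (f : ℕ+ → ℝ → ℝ) (θ₀ : ℕ+ → ℝ) (v : ℝ≥0) (k : ℕ)
    (θ : ℕ+ → ℝ) : ℝ≥0∞ :=
  ∏ j ∈ coords k, gaussianPDF (θ₀ j) v (θ j) / ENNReal.ofReal (f j (θ j))

theorem measurable_gaussianSieveDensity (hf : ∀ j, IsProbDensity (f j)) :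
    Measurable (gaussianSieveDensity f θ₀ v k) :=
  Finset.measurable_prod _ fun j _ =>
    ((measurable_gaussianPDF _ _).comp (measurable_pi_apply j)).div
      ((hf j).measurable.comp (measurable_pi_apply j)).ennreal_ofReal

theorem sieveGaussian_eq_withDensity (hf : ∀ j, IsProbDensity (f j)) (hv : v ≠ 0)
    (hpos : ∀ j x, 0 < f j x) :
    sieveGaussian θ₀ v k
      = (sieveComponent f k).withDensity (gaussianSieveDensity f θ₀ v k) := by
  have := isProbabilityMeasure_sieveMarginal hf k
  set R : ℕ+ → ℝ → ℝ≥0∞ := fun j => if j ∈ coords k then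
    fun x => gaussianPDF (θ₀ j) v x / ENNReal.ofReal (f j x) else 1 with hR
  have hRm : ∀ j : ℕ+, Measurable fun x => gaussianPDF (θ₀ j) v x / ENNReal.ofReal (f j x) :=
    fun j => (measurable_gaussianPDF _ _).div (hf j).measurable.ennreal_ofReal
  have e : gaussianSieveDensity f θ₀ v k = fun θ => ∏ j ∈ coords k, R j (θ j) := by
    ext θ
    exact Finset.prod_congr rfl fun j hj => by simp only [hR, if_pos hj]
  rw [e, sieveComponent_eq]
  refine infinitePi_eq_withDensity (fun j => ?_) (fun j => ?_)
    (fun j hj => by simp only [hR, if_neg hj])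
  · simp only [hR]
    split_ifs
    · exact hRm j
    · exact measurable_one
  · by_cases hj : j ∈ coords k
    · have hj' := mem_coords.1 hj
      simp only [hR, if_pos hj, sieveMarginal, if_pos hj']
      rw [truncate_eq_self θ₀ hj, gaussianReal_of_var_ne_zero _ hv,
        ← withDensity_mul _ (hf j).measurable.ennreal_ofReal (hRm j)]
      congr 1
      ext x
      exact ENNReal.mul_div_cancel (ENNReal.ofReal_pos.2 (hpos j x)).ne' ENNReal.ofReal_ne_top
    · have hj' := fun h => hj (mem_coords.2 h)
      simp only [hR, if_neg hj, sieveMarginal, if_neg hj']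
      rw [truncate_eq_zero θ₀ hj, gaussianReal_zero_var, withDensity_one]

/-- An upper bound for the logarithm of `gaussianSieveDensity`. -/
noncomputable def gaussianLogBound (α c₀' c₁' : ℝ) (n k : ℕ) (θ : ℕ+ → ℝ) : ℝ :=
  ∑ j ∈ coords k, (Real.log n / 2 + (c₀' + c₁' * ((j : ℕ) : ℝ) ^ (2 * α + 1) * θ j ^ 2))

theorem gaussianPDFReal_le {n : ℕ} (hn : 0 < n) (μ x : ℝ) :
    gaussianPDFReal μ (1 / n) x ≤ Real.exp (Real.log n / 2) := by
  have hn' : (0 : ℝ) < n := by exact_mod_cast hn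
  rw [gaussianPDFReal]
  have h1 : Real.exp (-(x - μ) ^ 2 / (2 * ((1 / n : ℝ≥0) : ℝ))) ≤ 1 := by
    refine Real.exp_le_one_iff.2 ?_
    rw [neg_div]
    have : 0 ≤ (x - μ) ^ 2 / (2 * ((1 / n : ℝ≥0) : ℝ)) := by positivity
    linarith
  have h2 : (Real.sqrt (2 * Real.pi * ((1 / n : ℝ≥0) : ℝ)))⁻¹ ≤ Real.exp (Real.log n / 2) := by
    rw [← Real.log_sqrt hn'.le, Real.exp_log (Real.sqrt_pos.2 hn'), ← Real.sqrt_inv]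
    refine Real.sqrt_le_sqrt ?_
    push_cast
    rw [inv_le_comm₀ (by positivity) hn', ← one_div]
    have : 1 ≤ 2 * Real.pi := by linarith [Real.pi_gt_three]
    exact le_mul_of_one_le_left (by positivity) this
  calc _ ≤ Real.exp (Real.log n / 2) * 1 := by gcongr
    _ = _ := mul_one _

theorem gaussianSieveDensity_le {α c₀' c₁' : ℝ}
    (hlow : ∀ j x, 0 < f j x ∧ -Real.log (f j x)
      ≤ c₀' + c₁' * ((j : ℕ) : ℝ) ^ (2 * α + 1) * x ^ 2) {n : ℕ} (hn : 0 < n) (θ : ℕ+ → ℝ) :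
    gaussianSieveDensity f θ₀ (1 / n) k θ
      ≤ ENNReal.ofReal (Real.exp (gaussianLogBound α c₀' c₁' n k θ)) := by
  rw [gaussianSieveDensity, gaussianLogBound, Real.exp_sum,
    ENNReal.ofReal_prod_of_nonneg fun _ _ => (Real.exp_pos _).le]
  refine Finset.prod_le_prod' fun j _ => ?_
  obtain ⟨h1, h2⟩ := hlow j (θ j)
  rw [gaussianPDF, ← ENNReal.ofReal_div_of_pos h1, Real.exp_add, div_eq_mul_inv]
  refine ENNReal.ofReal_le_ofReal (mul_le_mul (gaussianPDFReal_le hn _ _) ?_ (by positivity)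
    (Real.exp_pos _).le)
  conv_lhs => rw [← Real.exp_log h1, ← Real.exp_neg]
  exact Real.exp_le_exp.2 h2

theorem integrable_gaussianLogBound (α c₀' c₁' : ℝ) (n : ℕ) :
    Integrable (gaussianLogBound α c₀' c₁' n k) (sieveGaussian θ₀ v k) :=
  integrable_finsetSum _ fun _ hj => (integrable_const _).add
    ((integrable_const _).add ((memLp_eval_sieveGaussian hj).integrable_sq.const_mul _))

theorem integral_gaussianLogBound (α c₀' c₁' : ℝ) (n : ℕ) :
    ∫ θ, gaussianLogBound α c₀' c₁' n k θ ∂sieveGaussian θ₀ v k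
      = ∑ j ∈ coords k,
        (Real.log n / 2 + (c₀' + c₁' * ((j : ℕ) : ℝ) ^ (2 * α + 1) * (θ₀ j ^ 2 + v))) := by
  have hi : ∀ j ∈ coords k, Integrable (fun θ : ℕ+ → ℝ =>
      c₁' * ((j : ℕ) : ℝ) ^ (2 * α + 1) * θ j ^ 2) (sieveGaussian θ₀ v k) := fun j hj =>
    (memLp_eval_sieveGaussian hj).integrable_sq.const_mul _
  have hi' : ∀ j ∈ coords k, Integrable (fun θ : ℕ+ → ℝ =>
      c₀' + c₁' * ((j : ℕ) : ℝ) ^ (2 * α + 1) * θ j ^ 2) (sieveGaussian θ₀ v k) := fun j hj =>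
    (integrable_const _).add (hi j hj)
  have hi'' : ∀ j ∈ coords k, Integrable (fun θ : ℕ+ → ℝ =>
      Real.log n / 2 + (c₀' + c₁' * ((j : ℕ) : ℝ) ^ (2 * α + 1) * θ j ^ 2))
      (sieveGaussian θ₀ v k) := fun j hj => (integrable_const _).add (hi' j hj)
  unfold gaussianLogBound
  rw [integral_finsetSum _ hi'']
  refine Finset.sum_congr rfl fun j hj => ?_
  rw [integral_add (integrable_const _) (hi' j hj), integral_add (integrable_const _) (hi j hj),
    integral_const_mul, integral_sq_eval_sieveGaussian hj]
  simp

end GaussianDensity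

/-! ### The variational inequality for a fixed sample -/

section Posterior

open InformationTheory

variable {f : ℕ+ → ℝ → ℝ} {π : PMF ℕ} {θ₀ : ℕ+ → ℝ} {n : ℕ}

theorem aemeasurable_likelihood (hf : ∀ j, IsProbDensity (f j)) (X : Fin n → ℝ) :
    AEMeasurable (likelihood X) (sievePrior π f) :=
  aemeasurable_sievePrior hf fun k => measurable_likelihood_truncate k X

theorem aemeasurable_hellingerSq (hf : ∀ j, IsProbDensity (f j)) (h₀ : Summable θ₀) :
    AEMeasurable (fun θ => hellingerSq (expFamily θ) (expFamily θ₀)) (sievePrior π f) :=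
  aemeasurable_sievePrior hf fun k => measurable_hellingerSq_truncate k h₀

theorem evidence_ne_zero (hf : ∀ j, IsProbDensity (f j)) (X : Fin n → ℝ) :
    ∫⁻ θ, likelihood X θ ∂sievePrior π f ≠ 0 := by
  have := isProbabilityMeasure_sievePrior π hf
  intro h
  rw [lintegral_eq_zero_iff' (aemeasurable_likelihood hf X)] at h
  obtain ⟨θ, hθ⟩ := h.exists
  exact (likelihood_pos X θ).ne' hθ

theorem isProbabilityMeasure_bayesPosterior (hf : ∀ j, IsProbDensity (f j)) (X : Fin n → ℝ)
    (hD : ∫⁻ θ, likelihood X θ ∂sievePrior π f ≠ ∞) :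
    IsProbabilityMeasure (bayesPosterior (sievePrior π f) X) := by
  refine ⟨?_⟩
  rw [bayesPosterior, Measure.smul_apply, withDensity_apply _ MeasurableSet.univ,
    Measure.restrict_univ, smul_eq_mul, ENNReal.inv_mul_cancel (evidence_ne_zero hf X) hD]

theorem bayesPosterior_absolutelyContinuous (Pr : Measure (ℕ+ → ℝ)) (X : Fin n → ℝ) :
    bayesPosterior Pr X ≪ Pr :=
  (withDensity_absolutelyContinuous _ _).smul_left _

/-- The integral of the logarithmic density bound of the Gaussian measure against the posterior,
up to the logarithm of the evidence. -/
noncomputable def comparisonCost (α c₀' c₁' : ℝ) (π : PMF ℕ) (θ₀ : ℕ+ → ℝ) (k : ℕ) {n : ℕ}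
    (X : Fin n → ℝ) : ℝ :=
  ∑ j ∈ coords k, (Real.log n / 2
      + (c₀' + c₁' * ((j : ℕ) : ℝ) ^ (2 * α + 1) * (θ₀ j ^ 2 + 1 / n)))
    - Real.log (π k).toReal
    + n * ∫ θ, logPartition (truncate k θ) ∂sieveGaussian θ₀ (1 / n) k
    - ∑ i, logSeries (truncate k θ₀) (X i)

/-- The comparison is with the share of the posterior coming from index `k` alone. Relative to it
the Gaussian has density `D / (π(k) · likelihood)` times its density with respect to the prior
component. The series terms integrate exactly because the Gaussian has mean the truncated `θ₀`. -/
theorem klDiv_sieveGaussian_le (hf : ∀ j, IsProbDensity (f j)) {α c₀' c₁' : ℝ}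
    (hlow : ∀ j x, 0 < f j x ∧ -Real.log (f j x)
      ≤ c₀' + c₁' * ((j : ℕ) : ℝ) ^ (2 * α + 1) * x ^ 2) (hn : 0 < n) {k : ℕ} (hk : π k ≠ 0)
    (X : Fin n → ℝ) (hD : ∫⁻ θ, likelihood X θ ∂sievePrior π f ≠ ∞) :
    klDiv (sieveGaussian θ₀ (1 / n) k) (bayesPosterior (sievePrior π f) X) ≠ ∞ ∧
    (klDiv (sieveGaussian θ₀ (1 / n) k) (bayesPosterior (sievePrior π f) X)).toReal
      ≤ comparisonCost α c₀' c₁' π θ₀ k X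
        + Real.log (∫⁻ θ, likelihood X θ ∂sievePrior π f).toReal := by
  set D := ∫⁻ θ, likelihood X θ ∂sievePrior π f with hDdef
  have hD0 : D ≠ 0 := evidence_ne_zero hf X
  have hpost := isProbabilityMeasure_bayesPosterior hf X hD
  have hkt : π k ≠ ∞ := π.apply_ne_top k
  have hv : (1 / n : ℝ≥0) ≠ 0 := by positivity
  have hlm : AEMeasurable (likelihood X) (sieveComponent f k) :=
    aemeasurable_sieveComponent hf (measurable_likelihood_truncate k X)
  have hlmP : AEMeasurable (likelihood X) (sievePrior π f) := aemeasurable_likelihood hf X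
  set Q := sieveGaussian θ₀ (1 / n) k with hQ
  set ρ := gaussianSieveDensity f θ₀ (1 / n) k with hρ
  have hρm : Measurable ρ := measurable_gaussianSieveDensity hf
  set ν' : Measure (ℕ+ → ℝ) := D⁻¹ • ((π k • sieveComponent f k).withDensity (likelihood X))
    with hν'
  have hle : ν' ≤ bayesPosterior (sievePrior π f) X := by
    refine Measure.le_iff.2 fun s hs => ?_
    rw [hν', bayesPosterior, Measure.smul_apply, Measure.smul_apply, withDensity_apply _ hs,
      withDensity_apply _ hs]
    refine mul_le_mul_right (lintegral_mono' (Measure.restrict_mono_measure ?_ s) le_rfl) _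
    exact Measure.le_sum (fun k => π k • sieveComponent f k) k
  set c : ℝ≥0∞ := D * (π k)⁻¹ with hc
  have hmod : AEMeasurable (fun θ => c * (likelihood X θ)⁻¹ * ρ θ) (sievePrior π f) :=
    ((hlmP.inv.const_mul c).mul hρm.aemeasurable)
  have hmodk : AEMeasurable (fun θ => c * (likelihood X θ)⁻¹ * ρ θ) (sieveComponent f k) :=
    ((hlm.inv.const_mul c).mul hρm.aemeasurable)
  have hdens : Q = ν'.withDensity fun θ => c * (likelihood X θ)⁻¹ * ρ θ := by
    rw [hQ, sieveGaussian_eq_withDensity hf hv fun j x => (hlow j x).1, hν',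
      withDensity_smul_measure, withDensity_smul_measure, withDensity_smul_measure, smul_smul,
      ← withDensity_mul₀ hlm hmodk, ← withDensity_smul' _ _
        (ENNReal.mul_ne_top (ENNReal.inv_ne_top.2 hD0) hkt)]
    · refine withDensity_congr_ae (ae_of_all _ fun θ => ?_)
      have h1 := likelihood_pos X θ
      have h2 := likelihood_ne_top X θ
      simp only [Pi.smul_apply, Pi.mul_apply, smul_eq_mul, hc]
      have e : D⁻¹ * π k * (likelihood X θ * (D * (π k)⁻¹ * (likelihood X θ)⁻¹ * ρ θ))
          = (D⁻¹ * D) * (π k * (π k)⁻¹) * (likelihood X θ * (likelihood X θ)⁻¹) * ρ θ := by ring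
      rw [e, ENNReal.inv_mul_cancel hD0 hD, ENNReal.mul_inv_cancel hk hkt,
        ENNReal.mul_inv_cancel h1.ne' h2, one_mul, one_mul, one_mul]
  set w : (ℕ+ → ℝ) → ℝ := fun θ => gaussianLogBound α c₀' c₁' n k θ
    + (Real.log D.toReal - Real.log (π k).toReal)
    + (n * logPartition (truncate k θ) - ∑ i, logSeries (truncate k θ) (X i)) with hw
  have hLi : ∀ i, Integrable (fun θ => logSeries (truncate k θ) (X i)) Q := by
    intro i
    simp_rw [logSeries_truncate]
    exact integrable_finsetSum _ fun j hj => (integrable_eval_sieveGaussian hj).mul_const _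
  have hI1 : Integrable (fun θ => gaussianLogBound α c₀' c₁' n k θ
    + (Real.log D.toReal - Real.log (π k).toReal)) Q :=
    (integrable_gaussianLogBound α c₀' c₁' n).add (integrable_const _)
  have hI2 : Integrable (fun θ => n * logPartition (truncate k θ)) Q :=
    integrable_logPartition_sieveGaussian.const_mul _
  have hI3 : Integrable (fun θ => ∑ i, logSeries (truncate k θ) (X i)) Q :=
    integrable_finsetSum _ fun i _ => hLi i
  have hI4 : Integrable (fun θ => n * logPartition (truncate k θ)
      - ∑ i, logSeries (truncate k θ) (X i)) Q := hI2.sub hI3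
  have hwint : Integrable w Q := hI1.add hI4
  have hwI : ∫ θ, w θ ∂Q = comparisonCost α c₀' c₁' π θ₀ k X + Real.log D.toReal := by
    have hS : ∫ θ, ∑ i, logSeries (truncate k θ) (X i) ∂Q
        = ∑ i, logSeries (truncate k θ₀) (X i) := by
      rw [integral_finsetSum _ fun i _ => hLi i]
      refine Finset.sum_congr rfl fun i _ => ?_
      simp_rw [logSeries_truncate]
      rw [integral_finsetSum _ fun j hj => (integrable_eval_sieveGaussian hj).mul_const _]
      refine Finset.sum_congr rfl fun j hj => ?_
      rw [integral_mul_const, integral_eval_sieveGaussian hj]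
    simp only [hw]
    rw [integral_add hI1 hI4, integral_sub hI2 hI3, integral_add
      (integrable_gaussianLogBound α c₀' c₁' n) (integrable_const _), hS, integral_const_mul,
      integral_gaussianLogBound, comparisonCost]
    simp only [integral_const, probReal_univ, one_smul]
    push_cast
    ring
  rw [← hwI]
  refine klDiv_le_of_withDensity hle (hmod.mono_ac (bayesPosterior_absolutelyContinuous _ _))
    hdens hwint ?_
  filter_upwards [ae_truncate_eq_sieveGaussian (θ₀ := θ₀) (v := 1 / n) (k := k)] with θ hθ
  have h1 := gaussianSieveDensity_le (θ₀ := θ₀) (k := k) hlow hn θ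
  have hl := log_likelihood X θ
  have hlp : 0 < (likelihood X θ).toReal :=
    ENNReal.toReal_pos (likelihood_pos X θ).ne' (likelihood_ne_top X θ)
  have hDp : 0 < D.toReal := ENNReal.toReal_pos hD0 hD
  have hkp : 0 < (π k).toReal := ENNReal.toReal_pos hk hkt
  have hfac : c * (likelihood X θ)⁻¹ = ENNReal.ofReal (Real.exp
      (Real.log D.toReal - Real.log (π k).toReal - Real.log (likelihood X θ).toReal)) := by
    rw [Real.exp_sub, Real.exp_sub, Real.exp_log hDp, Real.exp_log hkp, Real.exp_log hlp,
      ENNReal.ofReal_div_of_pos hlp, ENNReal.ofReal_div_of_pos hkp, ENNReal.ofReal_toReal hD,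
      ENNReal.ofReal_toReal hkt, ENNReal.ofReal_toReal (likelihood_ne_top X θ), hc,
      div_eq_mul_inv, div_eq_mul_inv]
  calc c * (likelihood X θ)⁻¹ * ρ θ
      ≤ ENNReal.ofReal (Real.exp
      (Real.log D.toReal - Real.log (π k).toReal - Real.log (likelihood X θ).toReal))
        * ENNReal.ofReal (Real.exp (gaussianLogBound α c₀' c₁' n k θ)) := by
        rw [hfac]
        gcongr
    _ = ENNReal.ofReal (Real.exp (w θ)) := by
        rw [← ENNReal.ofReal_mul (Real.exp_pos _).le, ← Real.exp_add, hl, hw]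
        simp only [hθ]
        rw [Finset.sum_sub_distrib, Finset.sum_const, Finset.card_univ, Fintype.card_fin,
          nsmul_eq_mul]
        congr 2
        ring

/-- Optimality against the Gaussian contributes `+ log D`, and the exponential moment under the
posterior contributes `log U - log D`; the evidence `D` cancels. The nonnegativity is recorded
because it lets the bound be integrated over the sample inside `ENNReal.ofReal`. -/
theorem lintegral_hellingerSq_variational_le (hf : ∀ j, IsProbDensity (f j)) {α c₀' c₁' : ℝ}
    (hlow : ∀ j x, 0 < f j x ∧ -Real.log (f j x)
      ≤ c₀' + c₁' * ((j : ℕ) : ℝ) ^ (2 * α + 1) * x ^ 2) (hn : 0 < n) {k : ℕ} (hk : π k ≠ 0)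
    (h₀ : Summable θ₀) {t : ℝ} (ht0 : 0 < t) (ht : t ≤ 1) (X : Fin n → ℝ)
    (hU : evidenceEnvelope π f t θ₀ X ≠ ∞) {Q : Measure (ℕ+ → ℝ)}
    (hQ : IsVariationalPosterior gaussianMeanField (bayesPosterior (sievePrior π f) X) Q) :
    0 ≤ comparisonCost α c₀' c₁' π θ₀ k X + Real.log (evidenceEnvelope π f t θ₀ X).toReal ∧
    ∫⁻ θ, ENNReal.ofReal (hellingerSq (expFamily θ) (expFamily θ₀)) ∂Q
      ≤ ENNReal.ofReal (1 / (t * n) * (comparisonCost α c₀' c₁' π θ₀ k X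
        + Real.log (evidenceEnvelope π f t θ₀ X).toReal)) := by
  set U := evidenceEnvelope π f t θ₀ X with hUdef
  set D := ∫⁻ θ, likelihood X θ ∂sievePrior π f with hDdef
  have hDU : D ≤ U := evidence_le_envelope hf h₀ ht0.le ht hn X
  have hD : D ≠ ∞ := (hDU.trans_lt hU.lt_top).ne
  have hD0 : D ≠ 0 := evidence_ne_zero hf X
  have hDp : 0 < D.toReal := ENNReal.toReal_pos hD0 hD
  have hpost := isProbabilityMeasure_bayesPosterior hf X hD
  have hn' : (0 : ℝ) < n := by exact_mod_cast hn
  set post := bayesPosterior (sievePrior π f) X with hR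
  have hRac : post ≪ sievePrior π f := bayesPosterior_absolutelyContinuous _ _
  obtain ⟨hfin, hcost⟩ := klDiv_sieveGaussian_le (θ₀ := θ₀) hf hlow hn hk X hD
  have hQprob : IsProbabilityMeasure Q := by
    obtain ⟨μ, v, hμ⟩ := hQ.1
    rw [hμ]
    infer_instance
  have hQle := hQ.2 _ (sieveGaussian_mem (θ₀ := θ₀) (v := 1 / n) (k := k))
  have hQfin : klDiv Q post ≠ ∞ := (hQle.trans_lt hfin.lt_top).ne
  have hQkl : (klDiv Q post).toReal ≤ comparisonCost α c₀' c₁' π θ₀ k X + Real.log D.toReal :=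
    (ENNReal.toReal_mono hfin hQle).trans hcost
  set H : (ℕ+ → ℝ) → ℝ := fun θ => hellingerSq (expFamily θ) (expFamily θ₀) with hH
  have hHm : AEMeasurable H post := (aemeasurable_hellingerSq hf h₀).mono_ac hRac
  have hH1 : ∀ᵐ θ ∂post, H θ ≤ 1 := by
    refine hRac.ae_le ?_
    filter_upwards [ae_sievePrior hf] with θ hθ
    obtain ⟨l, hl⟩ := hθ
    exact hellingerSq_le_one (hl ▸ summable_truncate l θ) h₀
  have hHb : ∀ᵐ θ ∂post, |t * n * H θ| ≤ t * n := by
    filter_upwards [hH1] with θ hθ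
    have h0 : 0 ≤ H θ := hellingerSq_nonneg _ _
    rw [abs_of_nonneg (by positivity)]
    exact mul_le_of_le_one_right (by positivity) hθ
  have hDV := integral_le_klDiv_add_log hQfin (hHm.const_mul (t * n)) hHb
  have hexp : Real.log (∫ θ, Real.exp (t * n * H θ) ∂post)
      ≤ Real.log U.toReal - Real.log D.toReal := by
    have hem : AEMeasurable (fun θ => Real.exp (t * n * H θ)) post :=
      Real.measurable_exp.comp_aemeasurable (hHm.const_mul _)
    have hem' : AEMeasurable (fun θ => ENNReal.ofReal (Real.exp (t * n * H θ)))
        (sievePrior π f) := (Real.measurable_exp.comp_aemeasurable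
          ((aemeasurable_hellingerSq hf h₀).const_mul _)).ennreal_ofReal
    have h1 : ∫⁻ θ, ENNReal.ofReal (Real.exp (t * n * H θ)) ∂post ≤ D⁻¹ * U := by
      rw [hR, bayesPosterior, lintegral_smul_measure, smul_eq_mul,
        lintegral_withDensity_eq_lintegral_mul₀ (aemeasurable_likelihood hf X) hem']
      exact mul_le_mul_right (lintegral_likelihood_mul_exp_le hf h₀ ht0.le ht hn X) _
    have hpos : 0 < ∫ θ, Real.exp (t * n * H θ) ∂post := by
      refine integral_exp_pos (Integrable.of_bound hem.aestronglyMeasurable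
        (Real.exp (t * n)) ?_)
      filter_upwards [hHb] with θ hθ
      rw [Real.norm_eq_abs, Real.abs_exp]
      exact Real.exp_le_exp.2 ((le_abs_self _).trans hθ)
    have hUp : 0 < U.toReal := hDp.trans_le (ENNReal.toReal_mono hU hDU)
    rw [← Real.log_div hUp.ne' hDp.ne']
    refine Real.log_le_log hpos ?_
    rw [integral_eq_lintegral_of_nonneg_ae (ae_of_all _ fun θ => (Real.exp_pos _).le)
      hem.aestronglyMeasurable]
    refine (ENNReal.toReal_mono (ENNReal.mul_ne_top (ENNReal.inv_ne_top.2 hD0) hU) h1).trans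
      (le_of_eq ?_)
    rw [ENNReal.toReal_mul, ENNReal.toReal_inv, div_eq_inv_mul]
  -- Finite divergence forces `Q` to be carried by finitely supported sequences, like the posterior,
  -- although the Gaussian family contains measures that are not.
  have hQac : Q ≪ post := (klDiv_ne_top_iff.1 hQfin).1
  have hHint : Integrable H Q := by
    refine Integrable.of_bound (hHm.mono_ac hQac).aestronglyMeasurable 1 ?_
    filter_upwards [hQac.ae_le hH1] with θ hθ
    rw [Real.norm_eq_abs, abs_of_nonneg (hellingerSq_nonneg _ _)]
    exact hθ
  have hmain : t * n * ∫ θ, H θ ∂Q ≤ comparisonCost α c₀' c₁' π θ₀ k X + Real.log U.toReal := by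
    rw [← integral_const_mul]
    linarith
  have hH0 : 0 ≤ ∫ θ, H θ ∂Q := integral_nonneg fun θ => hellingerSq_nonneg _ _
  refine ⟨le_trans (by positivity) hmain, ?_⟩
  rw [← ofReal_integral_eq_lintegral_ofReal hHint (ae_of_all _ fun θ => hellingerSq_nonneg _ _)]
  refine ENNReal.ofReal_le_ofReal ?_
  rw [one_div, inv_mul_eq_div, le_div_iff₀ (by positivity)]
  linarith

end Posterior

/-! ### The integrated risk bound -/

section Risk

variable {f : ℕ+ → ℝ → ℝ} {π : PMF ℕ} {θ₀ : ℕ+ → ℝ} {n : ℕ}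

theorem map_eval_sampleLaw (h₀ : Summable θ₀) (i : Fin n) :
    (sampleLaw n θ₀).map (fun X => X i) = expFamily θ₀ := by
  have := isProbabilityMeasure_expFamily h₀
  exact (measurePreserving_eval (fun _ : Fin n => expFamily θ₀) i).map_eq

theorem integrable_expFamily (h₀ : Summable θ₀) {h : ℝ → ℝ} (hh : Continuous h) {K : ℝ}
    (hK : ∀ x, |h x| ≤ K) : Integrable h (expFamily θ₀) := by
  have := isProbabilityMeasure_expFamily h₀
  exact Integrable.of_bound hh.aestronglyMeasurable K (ae_of_all _ hK)

theorem integral_expFamily (h₀ : Summable θ₀) (h : ℝ → ℝ) :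
    ∫ x, h x ∂expFamily θ₀ = ∫ x in Set.Icc (0 : ℝ) 1, expDensity θ₀ x * h x := by
  rw [expFamily, integral_withDensity_eq_integral_toReal_smul
    (continuous_expDensity h₀).measurable.ennreal_ofReal
    (ae_of_all _ fun x => ENNReal.ofReal_lt_top)]
  refine integral_congr_ae (ae_of_all _ fun x => ?_)
  simp only [smul_eq_mul]
  rw [ENNReal.toReal_ofReal (expDensity_pos _ _).le]

theorem integral_sum_sampleLaw (h₀ : Summable θ₀) {h : ℝ → ℝ} (hh : Continuous h) {K : ℝ}
    (hK : ∀ x, |h x| ≤ K) :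
    Integrable (fun X : Fin n → ℝ => ∑ i, h (X i)) (sampleLaw n θ₀) ∧
    ∫ X, ∑ i, h (X i) ∂sampleLaw n θ₀
      = n * ∫ x in Set.Icc (0 : ℝ) 1, expDensity θ₀ x * h x := by
  have hp := isProbabilityMeasure_expFamily h₀
  have h1 : ∀ i : Fin n, Integrable (fun X : Fin n → ℝ => h (X i)) (sampleLaw n θ₀) := fun i =>
    (measurePreserving_eval (fun _ : Fin n => expFamily θ₀) i).integrable_comp_of_integrable
      (integrable_expFamily h₀ hh hK)
  have h2 : ∀ i : Fin n, ∫ X, h (X i) ∂sampleLaw n θ₀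
      = ∫ x in Set.Icc (0 : ℝ) 1, expDensity θ₀ x * h x := by
    intro i
    rw [← integral_expFamily h₀, ← map_eval_sampleLaw h₀ i,
      integral_map (measurable_pi_apply i).aemeasurable hh.aestronglyMeasurable]
  refine ⟨integrable_finsetSum _ fun i _ => h1 i, ?_⟩
  rw [integral_finsetSum _ fun i _ => h1 i]
  simp_rw [h2]
  simp

/-- With `V` the `(1-t)`-th power of the envelope ratio, Jensen's inequality is replaced by the
tangent bound `log V ≤ log E + V/E - 1`. This gives an integrable majorant `Ψ` of the pointwise risk
bound, so no measurability of `X ↦ Qhat X` is needed. -/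
theorem lintegral_risk_le (hf : ∀ j, IsProbDensity (f j)) {α c₀' c₁' : ℝ}
    (hlow : ∀ j x, 0 < f j x ∧ -Real.log (f j x)
      ≤ c₀' + c₁' * ((j : ℕ) : ℝ) ^ (2 * α + 1) * x ^ 2) (hn : 0 < n) {k : ℕ} (hk : π k ≠ 0)
    (h₀ : Summable θ₀) {t : ℝ} (ht0 : 0 < t) (ht : t ≤ 1 / 2) {E : ℝ} (hE : 0 < E)
    (hV : ∫⁻ X : Fin n → ℝ, (evidenceEnvelope π f t θ₀ X * (likelihood X θ₀)⁻¹) ^ (1 - t)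
        ∂sampleLaw n θ₀ ≤ ENNReal.ofReal E)
    {Qhat : (Fin n → ℝ) → Measure (ℕ+ → ℝ)}
    (hQ : ∀ᵐ X ∂(sampleLaw n θ₀),
      IsVariationalPosterior gaussianMeanField (bayesPosterior (sievePrior π f) X) (Qhat X)) :
    ∫⁻ X, (∫⁻ θ, ENNReal.ofReal (hellingerSq (expFamily θ) (expFamily θ₀)) ∂(Qhat X))
        ∂(sampleLaw n θ₀)
      ≤ ENNReal.ofReal (1 / (t * n) *
        (∑ j ∈ coords k, (Real.log n / 2
          + (c₀' + c₁' * ((j : ℕ) : ℝ) ^ (2 * α + 1) * (θ₀ j ^ 2 + 1 / n)))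
        - Real.log (π k).toReal
        + n * (∫ θ, logPartition (truncate k θ) ∂sieveGaussian θ₀ (1 / n) k - logPartition θ₀
          + ∫ x in Set.Icc (0 : ℝ) 1,
            expDensity θ₀ x * (logSeries θ₀ x - logSeries (truncate k θ₀) x))
        + 1 / (1 - t) * Real.log E)) := by
  have hp0 := isProbabilityMeasure_expFamily h₀
  have hps : IsProbabilityMeasure (sampleLaw n θ₀) := by unfold sampleLaw; infer_instance
  have hs0 : 0 < 1 - t := by linarith
  have hn' : (0 : ℝ) < n := by exact_mod_cast hn
  set U : (Fin n → ℝ) → ℝ≥0∞ := evidenceEnvelope π f t θ₀ with hUdef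
  set V : (Fin n → ℝ) → ℝ≥0∞ := fun X => (U X * (likelihood X θ₀)⁻¹) ^ (1 - t) with hVdef
  have hVm : Measurable V := ((measurable_evidenceEnvelope π f t θ₀ n).mul
    (measurable_likelihood h₀).inv).pow_const _
  have hVfin : ∫⁻ X, V X ∂sampleLaw n θ₀ ≠ ∞ := (hV.trans_lt ENNReal.ofReal_lt_top).ne
  have hVint : Integrable (fun X => (V X).toReal) (sampleLaw n θ₀) :=
    integrable_toReal_of_lintegral_ne_top hVm.aemeasurable hVfin
  have hVE : ∫ X, (V X).toReal ∂sampleLaw n θ₀ ≤ E := by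
    rw [integral_toReal hVm.aemeasurable (ae_lt_top hVm hVfin)]
    exact (ENNReal.toReal_mono ENNReal.ofReal_ne_top hV).trans_eq (ENNReal.toReal_ofReal hE.le)
  have hst := summable_truncate k θ₀
  set a : ℝ → ℝ := fun x => logSeries θ₀ x - logSeries (truncate k θ₀) x with ha
  have hac : Continuous a := (continuous_logSeries h₀).sub (continuous_logSeries hst)
  have hab : ∀ x, |a x| ≤ Real.sqrt 2 * ∑' j, |(θ₀ - truncate k θ₀) j| := by
    intro x
    rw [ha]
    simp only
    rw [← logSeries_sub h₀ hst]
    exact abs_logSeries_le (h₀.sub hst) x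
  obtain ⟨hSint, hSI⟩ := integral_sum_sampleLaw (n := n) h₀ hac hab
  set κ : ℝ := ∑ j ∈ coords k, (Real.log n / 2
      + (c₀' + c₁' * ((j : ℕ) : ℝ) ^ (2 * α + 1) * (θ₀ j ^ 2 + 1 / n)))
    - Real.log (π k).toReal
    + n * ∫ θ, logPartition (truncate k θ) ∂sieveGaussian θ₀ (1 / n) k
    - n * logPartition θ₀ + 1 / (1 - t) * (Real.log E - 1) with hκ
  set Ψ : (Fin n → ℝ) → ℝ := fun X => κ + ∑ i, a (X i) + 1 / (1 - t) * (1 / E * (V X).toReal)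
    with hΨ
  have hpt : ∀ᵐ X ∂sampleLaw n θ₀, 0 ≤ Ψ X ∧
      ∫⁻ θ, ENNReal.ofReal (hellingerSq (expFamily θ) (expFamily θ₀)) ∂(Qhat X)
        ≤ ENNReal.ofReal (1 / (t * n) * Ψ X) := by
    filter_upwards [hQ, ae_lt_top hVm hVfin] with X hQX hVX
    have hl0 := likelihood_pos X θ₀
    have hlt := likelihood_ne_top X θ₀
    have hU : U X ≠ ∞ := by
      intro h
      have : V X = ∞ := by
        simp only [hVdef, h]
        rw [ENNReal.top_mul (ENNReal.inv_ne_zero.2 hlt), ENNReal.top_rpow_of_pos hs0]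
      exact hVX.ne this
    have hU0 : U X ≠ 0 := fun h => evidence_ne_zero (π := π) hf X
      (le_antisymm ((evidence_le_envelope hf h₀ ht0.le (by linarith) hn X).trans_eq h) zero_le)
    obtain ⟨h1, h2⟩ := lintegral_hellingerSq_variational_le hf hlow hn hk h₀ ht0
      (by linarith) X hU hQX
    have hUp : 0 < (U X).toReal := ENNReal.toReal_pos hU0 hU
    have hlp : 0 < (likelihood X θ₀).toReal := ENNReal.toReal_pos hl0.ne' hlt
    have hVr : (V X).toReal = ((U X).toReal / (likelihood X θ₀).toReal) ^ (1 - t) := by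
      simp only [hVdef]
      rw [← ENNReal.toReal_rpow, ENNReal.toReal_mul, ENNReal.toReal_inv, div_eq_mul_inv]
    have hVp : 0 < (V X).toReal := by rw [hVr]; positivity
    have hlogV : Real.log (V X).toReal
        = (1 - t) * (Real.log (U X).toReal - Real.log (likelihood X θ₀).toReal) := by
      rw [hVr, Real.log_rpow (by positivity), Real.log_div hUp.ne' hlp.ne']
    have hlogle : Real.log (V X).toReal ≤ Real.log E + (1 / E * (V X).toReal - 1) := by
      have := Real.log_le_sub_one_of_pos (show 0 < 1 / E * (V X).toReal by positivity)
      rw [Real.log_mul (by positivity) hVp.ne', one_div, Real.log_inv] at this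
      rw [one_div]
      linarith
    have hUlog : Real.log (U X).toReal ≤ ∑ i, (logSeries θ₀ (X i) - logPartition θ₀)
        + 1 / (1 - t) * (Real.log E + (1 / E * (V X).toReal - 1)) := by
      rw [← log_likelihood]
      have h3 : Real.log (U X).toReal - Real.log (likelihood X θ₀).toReal
          = 1 / (1 - t) * Real.log (V X).toReal := by
        rw [hlogV]
        field_simp
      have h4 := mul_le_mul_of_nonneg_left hlogle (one_div_pos.2 hs0).le
      linarith
    have hle : comparisonCost α c₀' c₁' π θ₀ k X + Real.log (U X).toReal ≤ Ψ X := by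
      have e : Ψ X = comparisonCost α c₀' c₁' π θ₀ k X
          + (∑ i, (logSeries θ₀ (X i) - logPartition θ₀)
            + 1 / (1 - t) * (Real.log E + (1 / E * (V X).toReal - 1))) := by
        simp only [hΨ, hκ, comparisonCost, ha, Finset.sum_sub_distrib, Finset.sum_const,
          Finset.card_univ, Fintype.card_fin, nsmul_eq_mul]
        ring
      rw [e]
      linarith
    refine ⟨h1.trans hle, h2.trans (ENNReal.ofReal_le_ofReal ?_)⟩
    gcongr
  have hVint' : Integrable (fun X => 1 / (1 - t) * (1 / E * (V X).toReal)) (sampleLaw n θ₀) :=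
    (hVint.const_mul _).const_mul _
  have hκS : Integrable (fun X : Fin n → ℝ => κ + ∑ i, a (X i)) (sampleLaw n θ₀) :=
    (integrable_const _).add hSint
  have hΨint : Integrable Ψ (sampleLaw n θ₀) := hκS.add hVint'
  calc _ ≤ ∫⁻ X, ENNReal.ofReal (1 / (t * n) * Ψ X) ∂sampleLaw n θ₀ :=
        lintegral_mono_ae (hpt.mono fun X hX => hX.2)
    _ = ENNReal.ofReal (∫ X, 1 / (t * n) * Ψ X ∂sampleLaw n θ₀) := by
        refine (ofReal_integral_eq_lintegral_ofReal (hΨint.const_mul _) ?_).symm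
        filter_upwards [hpt] with X hX
        exact mul_nonneg (by positivity) hX.1
    _ ≤ _ := by
        refine ENNReal.ofReal_le_ofReal ?_
        rw [integral_const_mul]
        refine mul_le_mul_of_nonneg_left ?_ (by positivity)
        simp only [hΨ]
        rw [integral_add hκS hVint', integral_add (integrable_const _) hSint, hSI,
          integral_const_mul, integral_const_mul]
        simp only [integral_const, probReal_univ, one_smul]
        have h5 : 1 / (1 - t) * (1 / E * ∫ X, (V X).toReal ∂sampleLaw n θ₀) ≤ 1 / (1 - t) := by
          refine mul_le_of_le_one_right (by positivity) ?_
          rw [one_div, inv_mul_le_iff₀ hE, mul_one]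
          exact hVE
        rw [hκ]
        linarith

end Risk

/-! ### Approximation error on Sobolev balls -/

/-- Subtracting the linear term makes the remainder quadratic in `a`, while `τ` enters linearly.
Here `a` is the truncated tail of the log-density up to sign, and `τ` half the Gaussian variance, at
most `k/n`. -/
theorem exp_add_sub_one_sub_le {a A τ : ℝ} (ha : |a| ≤ A) (hτ0 : 0 ≤ τ) (hτ : τ ≤ 1) :
    Real.exp (a + τ) - 1 - a ≤ Real.exp (A + 1) * (a ^ 2 + τ) := by
  have hA := abs_le.1 ha
  have hb : ∀ u : ℝ, Real.exp u - 1 ≤ u * Real.exp u := fun u => by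
    have h1 := Real.add_one_le_exp (-u)
    have h2 : Real.exp (-u) * Real.exp u = 1 := by rw [← Real.exp_add]; simp
    nlinarith [Real.exp_pos u]
  have h1 : Real.exp a - 1 - a ≤ a ^ 2 * Real.exp (A + 1) := by
    have hA1 : 1 ≤ Real.exp (A + 1) := Real.one_le_exp (by linarith [abs_nonneg a])
    have haA : Real.exp a ≤ Real.exp (A + 1) := Real.exp_le_exp.2 (by linarith)
    have h2 : Real.exp a - 1 - a ≤ a * (Real.exp a - 1) := by linarith [hb a]
    rcases le_total 0 a with h | h
    · have h3 := mul_le_mul_of_nonneg_left (hb a) h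
      have h4 := mul_le_mul_of_nonneg_left haA (sq_nonneg a)
      nlinarith
    · have h3 : a * (Real.exp a - 1) ≤ a ^ 2 := by nlinarith [Real.add_one_le_exp a]
      nlinarith [sq_nonneg a]
  have h2 : Real.exp (a + τ) - Real.exp a ≤ Real.exp (A + 1) * τ := by
    have h3 : Real.exp (a + τ) ≤ Real.exp (A + 1) := Real.exp_le_exp.2 (by linarith)
    have h4 : Real.exp (a + τ) - Real.exp a ≤ Real.exp (a + τ) * τ := by
      have h5 := Real.add_one_le_exp (-τ)
      have h6 : Real.exp a = Real.exp (a + τ) * Real.exp (-τ) := by rw [← Real.exp_add]; simp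
      rw [h6]
      nlinarith [Real.exp_pos (a + τ)]
    nlinarith
  linarith

/-- A bound for the `ℓ¹` norm on the Sobolev ball. -/
noncomputable def sobolevConst (α B : ℝ) : ℝ :=
  (B ^ 2 + ∑' j : ℕ+, ((j : ℕ) : ℝ) ^ (-(2 * α))) / 2

section Sobolev

variable {α B : ℝ} {θ : ℕ+ → ℝ}

/-- AM–GM applied to `(j^α |θ_j|) · j^(-α)`; for `α > 1/2` the second part is summable, so Sobolev
balls are bounded in `ℓ¹`. -/
theorem abs_sobolev_le (α : ℝ) (θ : ℕ+ → ℝ) (j : ℕ+) :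
    |θ j| ≤ (((j : ℕ) : ℝ) ^ (2 * α) * θ j ^ 2 + ((j : ℕ) : ℝ) ^ (-(2 * α))) / 2 := by
  have hj : (0 : ℝ) < (j : ℕ) := by exact_mod_cast j.pos
  have h1 : ((j : ℕ) : ℝ) ^ (2 * α) = (((j : ℕ) : ℝ) ^ α) ^ 2 := by
    rw [← Real.rpow_natCast, ← Real.rpow_mul hj.le]
    congr 1
    push_cast
    ring
  have h2 : ((j : ℕ) : ℝ) ^ (-(2 * α)) = ((((j : ℕ) : ℝ) ^ α)⁻¹) ^ 2 := by
    rw [Real.rpow_neg hj.le, h1, inv_pow]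
  have h3 : 0 < ((j : ℕ) : ℝ) ^ α := Real.rpow_pos_of_pos hj _
  rw [h1, h2, ← sq_abs (θ j)]
  have h4 : ((j : ℕ) : ℝ) ^ α * (((j : ℕ) : ℝ) ^ α)⁻¹ = 1 := mul_inv_cancel₀ h3.ne'
  have h5 := sq_nonneg (((j : ℕ) : ℝ) ^ α * |θ j| - (((j : ℕ) : ℝ) ^ α)⁻¹)
  have h6 : ((j : ℕ) : ℝ) ^ α * |θ j| * (((j : ℕ) : ℝ) ^ α)⁻¹ = |θ j| := by
    rw [mul_right_comm, h4, one_mul]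
  nlinarith

theorem summable_pnat_rpow (hα : 1 / 2 < α) :
    Summable fun j : ℕ+ => ((j : ℕ) : ℝ) ^ (-(2 * α)) :=
  (Real.summable_nat_rpow.2 (by linarith)).comp_injective PNat.coe_injective

theorem summable_of_mem_sobolevBall (hα : 1 / 2 < α) (hθ : θ ∈ sobolevBall α B) : Summable θ :=
  Summable.of_norm_bounded ((hθ.1.add (summable_pnat_rpow hα)).div_const 2) (abs_sobolev_le α θ)

theorem tsum_abs_le_of_mem_sobolevBall (hα : 1 / 2 < α) (hθ : θ ∈ sobolevBall α B) :
    ∑' j, |θ j| ≤ sobolevConst α B := by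
  have h1 := Summable.tsum_le_tsum (abs_sobolev_le α θ)
    (summable_of_mem_sobolevBall hα hθ).abs ((hθ.1.add (summable_pnat_rpow hα)).div_const 2)
  rw [tsum_div_const, hθ.1.tsum_add (summable_pnat_rpow hα)] at h1
  refine h1.trans ?_
  unfold sobolevConst
  linarith [hθ.2]

theorem sub_truncate_apply (k : ℕ) (θ : ℕ+ → ℝ) (j : ℕ+) :
    (θ - truncate k θ) j = if (j : ℕ) ≤ k then 0 else θ j := by
  simp only [Pi.sub_apply, truncate]
  split_ifs <;> simp

theorem tsum_sq_tail_le (hα : 1 / 2 < α) (hθ : θ ∈ sobolevBall α B) {k : ℕ} (hk : 0 < k) :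
    ∑' j, (θ - truncate k θ) j ^ 2 ≤ (k : ℝ) ^ (-(2 * α)) * B ^ 2 := by
  have hk' : (0 : ℝ) < k := by exact_mod_cast hk
  have h1 : ∀ j : ℕ+, (θ - truncate k θ) j ^ 2
      ≤ (k : ℝ) ^ (-(2 * α)) * (((j : ℕ) : ℝ) ^ (2 * α) * θ j ^ 2) := by
    intro j
    rw [sub_truncate_apply]
    split_ifs with hj
    · rw [zero_pow two_ne_zero]
      positivity
    · rw [← mul_assoc]
      refine le_mul_of_one_le_left (sq_nonneg _) ?_
      rw [Real.rpow_neg hk'.le, ← div_eq_inv_mul, one_le_div (Real.rpow_pos_of_pos hk' _)]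
      have : (k : ℝ) ≤ (j : ℕ) := by exact_mod_cast (not_le.1 hj).le
      exact Real.rpow_le_rpow hk'.le this (by linarith)
  have h2 := hθ.1.mul_left ((k : ℝ) ^ (-(2 * α)))
  calc _ ≤ ∑' j : ℕ+, (k : ℝ) ^ (-(2 * α)) * (((j : ℕ) : ℝ) ^ (2 * α) * θ j ^ 2) :=
        Summable.tsum_le_tsum h1 (Summable.of_nonneg_of_le (fun j => sq_nonneg _) h1 h2) h2
    _ ≤ _ := by
        rw [tsum_mul_left]
        exact mul_le_mul_of_nonneg_left hθ.2 (by positivity)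

/-- The expected Kullback–Leibler divergence from the Gaussian comparison measure. -/
theorem approximation_le (hα : 1 / 2 < α) (hθ : θ ∈ sobolevBall α B) {n k : ℕ} (hk : 0 < k)
    (hkn : k ≤ n) :
    ∫ θ', logPartition (truncate k θ') ∂sieveGaussian θ (1 / n) k - logPartition θ
        + ∫ x in Set.Icc (0 : ℝ) 1, expDensity θ x * (logSeries θ x - logSeries (truncate k θ) x)
      ≤ Real.exp (3 * (Real.sqrt 2 * sobolevConst α B) + 1)
        * ((k : ℝ) ^ (-(2 * α)) * B ^ 2 + k / n) := by
  have hs := summable_of_mem_sobolevBall hα hθ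
  have hst := summable_truncate k θ
  have hn' : (0 : ℝ) < n := by exact_mod_cast hk.trans_le hkn
  set G : ℝ := Real.sqrt 2 * sobolevConst α B with hG
  have hl1 := tsum_abs_le_of_mem_sobolevBall hα hθ
  set d : ℕ+ → ℝ := θ - truncate k θ with hd
  have hds : Summable d := hs.sub hst
  have hdabs : ∀ x, |logSeries d x| ≤ G := by
    intro x
    refine (abs_logSeries_le hds x).trans (mul_le_mul_of_nonneg_left (le_trans ?_ hl1)
      (Real.sqrt_nonneg _))
    refine Summable.tsum_le_tsum (fun j => ?_) hds.abs hs.abs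
    rw [hd, sub_truncate_apply]
    split_ifs
    · rw [abs_zero]; exact abs_nonneg _
    · exact le_rfl
  have hp : ∀ x, expDensity θ x ≤ Real.exp (2 * G) := fun x =>
    (expDensity_le_exp hs x).trans (Real.exp_le_exp.2 (by
      have := mul_le_mul_of_nonneg_left hl1 (Real.sqrt_nonneg 2)
      linarith))
  have hdx : ∀ x, logSeries d x = logSeries θ x - logSeries (truncate k θ) x :=
    fun x => logSeries_sub hs hst x
  set τ : ℝ → ℝ := fun x => (1 / n : ℝ≥0) * basisEnergy k x / 2 with hτ
  have hτ0 : ∀ x, 0 ≤ τ x := fun x => by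
    have := basisEnergy_nonneg k x
    simp only [hτ]
    positivity
  have hτk : ∀ x, τ x ≤ k / n := fun x => by
    have h1 := basisEnergy_le k x
    simp only [hτ]
    push_cast
    rw [one_div, inv_mul_eq_div, div_div, div_le_div_iff₀ (by positivity) hn']
    nlinarith
  have hkn1 : (k : ℝ) / n ≤ 1 := by
    rw [div_le_one hn']
    exact_mod_cast hkn
  have hc1 := continuous_expDensity hs
  have hcd := continuous_logSeries hds
  have hcτ : Continuous τ := (continuous_const.mul (continuous_basisEnergy k)).div_const 2
  have hI := integral_logPartition_sieveGaussian_le (θ₀ := θ) (v := 1 / n) (k := k)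
  have e1 : ∀ x, expDensity θ x * Real.exp (logSeries (truncate k θ) x - logSeries θ x
      + (1 / n : ℝ≥0) * basisEnergy k x / 2)
      = expDensity θ x * Real.exp (-logSeries d x + τ x) := fun x => by
    rw [hdx, neg_sub]
  simp_rw [e1] at hI
  simp_rw [← hdx]
  have i1 : Integrable (fun x => expDensity θ x * Real.exp (-logSeries d x + τ x))
      (volume.restrict (Set.Icc (0 : ℝ) 1)) :=
    integrable_unitInterval_of_continuous (hc1.mul (Real.continuous_exp.comp (hcd.neg.add hcτ)))
  have i2 : Integrable (fun x => expDensity θ x * logSeries d x)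
      (volume.restrict (Set.Icc (0 : ℝ) 1)) :=
    integrable_unitInterval_of_continuous (hc1.mul hcd)
  have i7 : Integrable (fun x => logSeries d x ^ 2) (volume.restrict (Set.Icc (0 : ℝ) 1)) :=
    integrable_unitInterval_of_continuous (hcd.pow 2)
  have i3 := integrable_expDensity hs
  have i4 : Integrable (fun x => logSeries d x ^ 2 + k / n)
      (volume.restrict (Set.Icc (0 : ℝ) 1)) :=
    integrable_unitInterval_of_continuous ((hcd.pow 2).add continuous_const)
  -- The terms linear in the tail cancel. Bounding the density by `exp(2G)` then leaves a Lebesgue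
  -- integral of the squared tail, where Parseval applies; together with `exp(G+1)` this gives
  -- `3G+1`.
  have hsum : (∫ x in Set.Icc (0 : ℝ) 1, expDensity θ x * Real.exp (-logSeries d x + τ x))
      - (∫ x in Set.Icc (0 : ℝ) 1, expDensity θ x)
      + ∫ x in Set.Icc (0 : ℝ) 1, expDensity θ x * logSeries d x
      ≤ ∫ x in Set.Icc (0 : ℝ) 1,
        Real.exp (3 * G + 1) * (logSeries d x ^ 2 + k / n) := by
    have i5 : Integrable (fun x => expDensity θ x * Real.exp (-logSeries d x + τ x)
        - expDensity θ x) (volume.restrict (Set.Icc (0 : ℝ) 1)) := i1.sub i3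
    have i6 : Integrable (fun x => expDensity θ x * Real.exp (-logSeries d x + τ x)
        - expDensity θ x + expDensity θ x * logSeries d x)
        (volume.restrict (Set.Icc (0 : ℝ) 1)) := i5.add i2
    calc _ = ∫ x in Set.Icc (0 : ℝ) 1, (expDensity θ x * Real.exp (-logSeries d x + τ x)
          - expDensity θ x + expDensity θ x * logSeries d x) := by
          rw [integral_add i5 i2, integral_sub i1 i3]
      _ ≤ _ := by
          refine integral_mono i6 (i4.const_mul _) fun x => ?_
          have h1 := exp_add_sub_one_sub_le (a := -logSeries d x) (A := G)
            (by rw [abs_neg]; exact hdabs x) (hτ0 x) ((hτk x).trans hkn1)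
          have hp0 := expDensity_pos θ x
          have h2 : Real.exp (G + 1) * ((-logSeries d x) ^ 2 + τ x)
              ≤ Real.exp (G + 1) * (logSeries d x ^ 2 + k / n) := by
            rw [neg_sq]
            gcongr
            exact hτk x
          calc _ = expDensity θ x * (Real.exp (-logSeries d x + τ x) - 1 - -logSeries d x) := by
                ring
            _ ≤ expDensity θ x * (Real.exp (G + 1) * (logSeries d x ^ 2 + k / n)) :=
                mul_le_mul_of_nonneg_left (h1.trans h2) hp0.le
            _ ≤ Real.exp (2 * G) * (Real.exp (G + 1) * (logSeries d x ^ 2 + k / n)) := by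
                gcongr
                exact hp x
            _ = _ := by
                rw [← mul_assoc, ← Real.exp_add]
                congr 2
                ring
  rw [integral_const_mul, integral_add i7 (integrable_const _), integral_expDensity hs] at hsum
  have hpars := integral_logSeries_sq hds
  have htail := tsum_sq_tail_le hα hθ hk
  simp only [integral_const, probReal_univ, one_smul] at hsum
  have h7 : Real.exp (3 * G + 1) * ((∫ x in Set.Icc (0 : ℝ) 1, logSeries d x ^ 2) + k / n)
      ≤ Real.exp (3 * G + 1) * ((k : ℝ) ^ (-(2 * α)) * B ^ 2 + k / n) := by
    rw [hpars]
    gcongr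
  linarith

end Sobolev

/-! ### The sieve dimension and the rate -/

/-- The squared rate of convergence. -/
noncomputable def sqRate (α : ℝ) (n : ℕ) : ℝ :=
  (n : ℝ) ^ (-(2 * α / (2 * α + 1))) * Real.log n ^ (2 * α / (2 * α + 1))

section Arithmetic

variable {α : ℝ} {n : ℕ}

theorem half_lt_log (hn : 2 ≤ n) : 1 / 2 < Real.log n := by
  have h2 : (2 : ℝ) ≤ n := by exact_mod_cast hn
  linarith [Real.log_two_gt_d9, Real.log_le_log two_pos h2]

/-- Using `log y ≤ y - 1` at `√n/2`, rather than at `√n`, gives `log n ≤ √n - 2 + 2 log 2`. -/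
theorem log_le_sqrt (hn : 2 ≤ n) : Real.log n ≤ Real.sqrt n := by
  have h2 : (2 : ℝ) ≤ n := by exact_mod_cast hn
  have hs : 0 < Real.sqrt n := Real.sqrt_pos.2 (by linarith)
  have h1 := Real.log_le_sub_one_of_pos (half_pos hs)
  rw [Real.log_div hs.ne' two_ne_zero, Real.log_sqrt (by linarith)] at h1
  linarith [Real.log_two_lt_d9]

theorem one_lt_div_log (hn : 2 ≤ n) : 1 < (n : ℝ) / Real.log n := by
  have h2 : (2 : ℝ) ≤ n := by exact_mod_cast hn
  rw [one_lt_div (by linarith [half_lt_log hn])]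
  linarith [Real.log_le_sub_one_of_pos (show (0 : ℝ) < n by linarith)]

theorem one_lt_sieveRoot (hα : 1 / 2 < α) (hn : 2 ≤ n) :
    1 < ((n : ℝ) / Real.log n) ^ (1 / (2 * α + 1)) :=
  Real.one_lt_rpow (one_lt_div_log hn) (by apply one_div_pos.2; linarith)

theorem sieveRoot_le (α : ℝ) (n : ℕ) :
    ((n : ℝ) / Real.log n) ^ (1 / (2 * α + 1)) ≤ sieveDim α n := Nat.le_ceil _

theorem sieveDim_le_two_mul (hα : 1 / 2 < α) (hn : 2 ≤ n) :
    (sieveDim α n : ℝ) ≤ 2 * ((n : ℝ) / Real.log n) ^ (1 / (2 * α + 1)) := by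
  have h1 := one_lt_sieveRoot hα hn
  have h2 := Nat.ceil_lt_add_one (zero_le_one.trans h1.le)
  unfold sieveDim
  linarith

theorem two_le_sieveDim (hα : 1 / 2 < α) (hn : 2 ≤ n) : 2 ≤ sieveDim α n := by
  have h : (1 : ℝ) < sieveDim α n := (one_lt_sieveRoot hα hn).trans_le (sieveRoot_le α n)
  exact_mod_cast h

theorem sieveDim_le (hα : 1 / 2 < α) (hn : 2 ≤ n) : sieveDim α n ≤ n := by
  have h2 : (2 : ℝ) ≤ n := by exact_mod_cast hn
  refine Nat.ceil_le.2 ?_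
  have hx := one_lt_div_log hn
  have hl := half_lt_log hn
  calc ((n : ℝ) / Real.log n) ^ (1 / (2 * α + 1))
      ≤ ((n : ℝ) / Real.log n) ^ (1 / 2 : ℝ) := by
        refine Real.rpow_le_rpow_of_exponent_le hx.le ?_
        exact one_div_le_one_div_of_le two_pos (by linarith)
    _ ≤ ((n : ℝ) ^ 2) ^ (1 / 2 : ℝ) := by
        refine Real.rpow_le_rpow (by linarith) ?_ (by norm_num)
        rw [div_le_iff₀ (by linarith)]
        nlinarith [mul_le_mul h2 hl.le (by norm_num) (by linarith)]
    _ = n := by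
        rw [← Real.sqrt_eq_rpow, Real.sqrt_sq (by linarith)]

/-- From `log n ≤ √n` one gets `n/log n ≥ √n`, so `k` is at least `n` to the power `1/(2(2α+1))`. -/
theorem log_le_mul_log (hα : 1 / 2 < α) (hn : 2 ≤ n) {k : ℕ} (hk : sieveDim α n ≤ k) :
    Real.log n ≤ 2 * (2 * α + 1) * Real.log k := by
  have h2 : (2 : ℝ) ≤ n := by exact_mod_cast hn
  have hx := one_lt_div_log hn
  have hl := half_lt_log hn
  have hy := one_lt_sieveRoot hα hn
  have h1 : ((n : ℝ) / Real.log n) ^ (1 / (2 * α + 1)) ≤ k :=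
    (sieveRoot_le α n).trans (by exact_mod_cast hk)
  have h3 := Real.log_le_log (by linarith) h1
  rw [Real.log_rpow (by linarith), Real.log_div (by linarith) (by linarith)] at h3
  have h4 : Real.log (Real.log n) ≤ Real.log n / 2 := by
    have := Real.log_le_log (by linarith) (log_le_sqrt hn)
    rwa [Real.log_sqrt (by linarith)] at this
  rw [one_div, inv_mul_le_iff₀ (by linarith)] at h3
  linarith

/-- Since `k₀(n)` is unbounded, the density hypotheses, stated for `j ≤ k₀(n)`, hold for every `j`
with the same constants. -/
theorem exists_le_sieveDim (hα : 1 / 2 < α) {n₀ : ℕ} (hn₀ : 2 ≤ n₀) (j : ℕ) :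
    ∃ n, n₀ ≤ n ∧ j ≤ sieveDim α n := by
  by_contra! h
  have h1 : ∀ᶠ n : ℕ in Filter.atTop, 2 * (2 * α + 1) * Real.log j < Real.log n :=
    (Real.tendsto_log_atTop.comp tendsto_natCast_atTop_atTop).eventually_gt_atTop _
  obtain ⟨n, hn1, hn2⟩ := (h1.and (Filter.eventually_ge_atTop n₀)).exists
  exact absurd (log_le_mul_log hα (hn₀.trans hn2) (h n hn2).le) (not_le.2 hn1)

theorem mul_sqRate (hα : 1 / 2 < α) (hn : 2 ≤ n) :
    n * sqRate α n = ((n : ℝ) / Real.log n) ^ (1 / (2 * α + 1)) * Real.log n := by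
  have h2 : (0 : ℝ) < n := by have : 0 < n := by omega
                              exact_mod_cast this
  have hl : 0 < Real.log n := by linarith [half_lt_log hn]
  have ha : 2 * α + 1 ≠ 0 := by linarith
  have e1 : (n : ℝ) * (n : ℝ) ^ (-(2 * α / (2 * α + 1))) = (n : ℝ) ^ (1 / (2 * α + 1)) := by
    nth_rewrite 1 [← Real.rpow_one (n : ℝ)]
    rw [← Real.rpow_add h2]
    congr 1
    field_simp
    ring
  have e2 : Real.log n / Real.log n ^ (1 / (2 * α + 1))
      = Real.log n ^ (2 * α / (2 * α + 1)) := by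
    nth_rewrite 1 [← Real.rpow_one (Real.log n)]
    rw [← Real.rpow_sub hl]
    congr 1
    field_simp
    ring
  rw [sqRate, Real.div_rpow h2.le hl.le, ← mul_assoc, e1, ← e2]
  ring

theorem mul_sieveDim_rpow_le (hα : 1 / 2 < α) (hn : 2 ≤ n) :
    n * (sieveDim α n : ℝ) ^ (-(2 * α)) ≤ n * sqRate α n := by
  have h2 : (0 : ℝ) < n := by have : 0 < n := by omega
                              exact_mod_cast this
  have hl : 0 < Real.log n := by linarith [half_lt_log hn]
  have hx := one_lt_div_log hn
  have hy := one_lt_sieveRoot hα hn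
  refine mul_le_mul_of_nonneg_left ?_ h2.le
  calc (sieveDim α n : ℝ) ^ (-(2 * α))
      ≤ (((n : ℝ) / Real.log n) ^ (1 / (2 * α + 1))) ^ (-(2 * α)) :=
        Real.rpow_le_rpow_of_nonpos (by linarith) (sieveRoot_le α n) (by linarith)
    _ = sqRate α n := by
        rw [← Real.rpow_mul (by linarith), sqRate, Real.div_rpow h2.le hl.le]
        have e : 1 / (2 * α + 1) * -(2 * α) = -(2 * α / (2 * α + 1)) := by ring
        rw [e, Real.rpow_neg hl.le, div_inv_eq_mul]

/-- The Gaussian variance `1/n` therefore adds only a bounded amount per coordinate to the quadratic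
bound on `-log f_j`. -/
theorem sieveDim_rpow_div_le (hα : 1 / 2 < α) (hn : 2 ≤ n) :
    (sieveDim α n : ℝ) ^ (2 * α + 1) * (1 / n) ≤ 2 * 2 ^ (2 * α + 1) := by
  have h2 : (0 : ℝ) < n := by have : 0 < n := by omega
                              exact_mod_cast this
  have hl := half_lt_log hn
  have hx := one_lt_div_log hn
  have h1 : (sieveDim α n : ℝ) ^ (2 * α + 1) ≤ 2 ^ (2 * α + 1) * (n / Real.log n) := by
    calc _ ≤ (2 * ((n : ℝ) / Real.log n) ^ (1 / (2 * α + 1))) ^ (2 * α + 1) :=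
          Real.rpow_le_rpow (Nat.cast_nonneg _) (sieveDim_le_two_mul hα hn) (by linarith)
      _ = _ := by
          rw [Real.mul_rpow two_pos.le (by positivity), ← Real.rpow_mul (by linarith),
            one_div_mul_cancel (by linarith), Real.rpow_one]
  calc _ ≤ 2 ^ (2 * α + 1) * (n / Real.log n) * (1 / n) := by gcongr
    _ = 2 ^ (2 * α + 1) * (1 / Real.log n) := by field_simp
    _ ≤ 2 ^ (2 * α + 1) * 2 := by
        gcongr
        rw [div_le_iff₀ (by linarith)]
        linarith
    _ = _ := mul_comm _ _

end Arithmetic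

/-! ### The prior cost and the evidence constant -/

/-- One surplus power of `j` is bounded by `k₀`, leaving the Sobolev sum; hence the quadratic part
costs `k₀ B²`. -/
theorem sum_coords_sobolev_le {α B c₀' c₁' : ℝ} (hα : 1 / 2 < α) (hc₁' : 0 < c₁') {n : ℕ}
    (hn : 2 ≤ n) {θ : ℕ+ → ℝ} (hθ : θ ∈ sobolevBall α B) :
    ∑ j ∈ coords (sieveDim α n), (Real.log n / 2
        + (c₀' + c₁' * ((j : ℕ) : ℝ) ^ (2 * α + 1) * (θ j ^ 2 + 1 / n)))
      ≤ sieveDim α n * (Real.log n / 2 + c₀' + c₁' * (B ^ 2 + 2 * 2 ^ (2 * α + 1))) := by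
  set k := sieveDim α n with hk
  have hc : ∑ _j ∈ coords k, (1 : ℝ) = k := by simp [card_coords]
  have h1 : ∑ j ∈ coords k, ((j : ℕ) : ℝ) ^ (2 * α) * θ j ^ 2 ≤ B ^ 2 :=
    (hθ.1.sum_le_tsum _ fun j _ => by positivity).trans hθ.2
  have h2 : ∀ j ∈ coords k, Real.log n / 2
        + (c₀' + c₁' * ((j : ℕ) : ℝ) ^ (2 * α + 1) * (θ j ^ 2 + 1 / n))
      ≤ (Real.log n / 2 + c₀' + c₁' * (2 * 2 ^ (2 * α + 1))) * 1
        + c₁' * k * (((j : ℕ) : ℝ) ^ (2 * α) * θ j ^ 2) := by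
    intro j hj
    have hj0 : (0 : ℝ) < (j : ℕ) := by exact_mod_cast j.pos
    have hjk : ((j : ℕ) : ℝ) ≤ k := by exact_mod_cast mem_coords.1 hj
    have h3 : ((j : ℕ) : ℝ) ^ (2 * α + 1) * θ j ^ 2
        ≤ k * (((j : ℕ) : ℝ) ^ (2 * α) * θ j ^ 2) := by
      rw [Real.rpow_add_one hj0.ne', mul_comm (((j : ℕ) : ℝ) ^ (2 * α)), mul_assoc]
      gcongr
    have h4 : ((j : ℕ) : ℝ) ^ (2 * α + 1) * (1 / n) ≤ 2 * 2 ^ (2 * α + 1) := by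
      refine le_trans ?_ (sieveDim_rpow_div_le hα hn)
      gcongr
    have h5 := mul_le_mul_of_nonneg_left (add_le_add h3 h4) hc₁'.le
    linarith
  calc _ ≤ _ := Finset.sum_le_sum h2
    _ = (Real.log n / 2 + c₀' + c₁' * (2 * 2 ^ (2 * α + 1))) * k
        + c₁' * k * ∑ j ∈ coords k, ((j : ℕ) : ℝ) ^ (2 * α) * θ j ^ 2 := by
        rw [Finset.sum_add_distrib, ← Finset.mul_sum, hc, ← Finset.mul_sum]
    _ ≤ (Real.log n / 2 + c₀' + c₁' * (2 * 2 ^ (2 * α + 1))) * k + c₁' * k * B ^ 2 := by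
        gcongr
    _ = _ := by ring

theorem neg_log_prior_le {α C₃ C₄ : ℝ} (hα : 1 / 2 < α) (hC₃ : 0 < C₃) (hC₄ : 0 < C₄) {n₀ n : ℕ}
    (hn : 2 ≤ n) (hnn : n₀ ≤ n) {π : PMF ℕ} (hπ : PriorMass α n₀ π C₃ C₄) :
    π (sieveDim α n) ≠ 0 ∧ -Real.log (π (sieveDim α n)).toReal
      ≤ |Real.log C₃| + C₄ * (sieveDim α n * Real.log n) := by
  have h := hπ n hnn
  set k := sieveDim α n with hk
  have hk2 : 2 ≤ k := two_le_sieveDim hα hn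
  have hpos : 0 < C₃ * Real.exp (-C₄ * k * Real.log k) := by positivity
  have h0 : 0 < π k := (ENNReal.ofReal_pos.2 hpos).trans_le h
  refine ⟨h0.ne', ?_⟩
  have h1 := ENNReal.toReal_mono (π.apply_ne_top k) h
  rw [ENNReal.toReal_ofReal hpos.le] at h1
  have h2 := Real.log_le_log hpos h1
  rw [Real.log_mul hC₃.ne' (Real.exp_ne_zero _), Real.log_exp] at h2
  have h3 : Real.log k ≤ Real.log n := by
    refine Real.log_le_log (by exact_mod_cast (by omega : 0 < k)) ?_
    exact_mod_cast sieveDim_le hα hn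
  have h4 : C₄ * (k * Real.log k) ≤ C₄ * (k * Real.log n) := by gcongr
  linarith [neg_abs_le (Real.log C₃)]

theorem density_le_of_densityUpper {α c₀ c₁ β : ℝ} (hα : 1 / 2 < α) {n₀ : ℕ} (hn₀ : 2 ≤ n₀)
    {f : ℕ+ → ℝ → ℝ} (h : DensityUpper α n₀ f c₀ c₁ β) {K : ℝ} (hK0 : 0 ≤ K)
    (hK : ∀ x : ℝ, Real.exp (-(c₀ + c₁ * |x| ^ β)) ≤ K * ((1 + x ^ 2)⁻¹) ^ 2) (j : ℕ+) (x : ℝ) :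
    f j x ≤ K * ((1 + x ^ 2)⁻¹) ^ 2 := by
  obtain ⟨n, hn, hj⟩ := exists_le_sieveDim hα hn₀ j
  rcases le_or_gt (f j x) 0 with h0 | h0
  · exact h0.trans (by positivity)
  · refine le_trans ?_ (hK x)
    rw [← Real.log_le_iff_le_exp h0]
    linarith [h n hn j hj x h0]

theorem densityLower_all {α c₀' c₁' : ℝ} (hα : 1 / 2 < α) {n₀ : ℕ} (hn₀ : 2 ≤ n₀)
    {f : ℕ+ → ℝ → ℝ} (h : DensityLower α n₀ f c₀' c₁') (j : ℕ+) (x : ℝ) :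
    0 < f j x ∧ -Real.log (f j x) ≤ c₀' + c₁' * ((j : ℕ) : ℝ) ^ (2 * α + 1) * x ^ 2 := by
  obtain ⟨n, hn, hj⟩ := exists_le_sieveDim hα hn₀ j
  exact h n hn j hj x

theorem envelope_moment_le {π : PMF ℕ} {f : ℕ+ → ℝ → ℝ} {θ₀ : ℕ+ → ℝ} (h₀ : Summable θ₀)
    (hf : ∀ j, IsProbDensity (f j)) {K : ℝ} (hK : 1 ≤ K)
    (hfK : ∀ j x, f j x ≤ K * ((1 + x ^ 2)⁻¹) ^ 2) {C₁ C₂ : ℝ} (hC₁ : 0 < C₁) (hC₂ : 0 < C₂)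
    (hπ : PriorTail π C₁ C₂) {α : ℝ} (hα : 1 / 2 < α) {t : ℝ} (ht0 : 0 < t) (ht : t ≤ 1 / 2)
    (htA : t * (2 * (2 * α + 1) + 2) ≤ C₂ / 4) {n : ℕ} (hn : 2 ≤ n) :
    ∫⁻ X : Fin n → ℝ, (evidenceEnvelope π f t θ₀ X * (likelihood X θ₀)⁻¹) ^ (1 - t)
        ∂sampleLaw n θ₀
      ≤ ENNReal.ofReal (Real.exp (4 * gridConst) * (Real.exp (sieveDim α n * Real.log n)
        * ∑' k : ℕ, (1 + C₁) * Real.exp (-(C₂ / 4 * k * Real.log k)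
          + k * Real.log (27 * K * Real.pi)))) := by
  have hn1 : (1 : ℝ) ≤ n := by exact_mod_cast (by omega : 1 ≤ n)
  have hC : 1 ≤ 27 * K * Real.pi := by nlinarith [Real.pi_gt_three]
  refine (lintegral_envelope_ratio_rpow_le h₀ ht0.le ht).trans ?_
  rw [ENNReal.ofReal_mul (Real.exp_pos _).le]
  refine mul_le_mul_right ?_ _
  refine le_trans (ENNReal.tsum_le_tsum fun k => mul_le_mul_right
    (tsum_sieveComponent_gridCell_rpow_le hf hK hfK hn1 ht0.le ht k) _) ?_
  exact tsum_prior_rpow_mul_le hC₁ hC₂ hπ ht0 ht (by linarith) htA (by omega)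
    (fun k hk => log_le_mul_log hα hn hk) hC

end VBDensity

/-! ### Choice of constants and conclusion -/

theorem mainTheorem8
    (α B C₁ C₂ C₃ C₄ c₀ c₁ β c₀' c₁' : ℝ) (n₀ : ℕ)
    (hα : 1 / 2 < α) (hB : 0 < B) (hn₀ : 2 ≤ n₀)
    (hC₁ : 0 < C₁) (hC₂ : 0 < C₂) (hC₃ : 0 < C₃) (hC₄ : 0 < C₄)
    (hc₁ : 0 < c₁) (hβ : 0 < β) (hc₁' : 0 < c₁') :
    ∃ M : ℝ, 0 < M ∧
      ∀ (π : PMF ℕ) (f : ℕ+ → ℝ → ℝ), (∀ j, IsProbDensity (f j)) →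
        PriorTail π C₁ C₂ → PriorMass α n₀ π C₃ C₄ →
        DensityUpper α n₀ f c₀ c₁ β → DensityLower α n₀ f c₀' c₁' →
        ∀ θstar ∈ sobolevBall α B, ∀ n : ℕ, n₀ ≤ n →
          ∀ Qhat : (Fin n → ℝ) → Measure (ℕ+ → ℝ),
            (∀ᵐ X ∂(sampleLaw n θstar),
              IsVariationalPosterior gaussianMeanField (bayesPosterior (sievePrior π f) X) (Qhat X)) →
            ∫⁻ X, (∫⁻ θ, ENNReal.ofReal (hellingerSq (expFamily θ) (expFamily θstar)) ∂(Qhat X))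
                ∂(sampleLaw n θstar)
              ≤ ENNReal.ofReal (M * ((n : ℝ) ^ (-(2 * α / (2 * α + 1)))
                  * Real.log n ^ (2 * α / (2 * α + 1)))) := by
  obtain ⟨K, hK1, hK⟩ := exists_exp_neg_rpow_le c₀ hc₁ hβ
  set A : ℝ := 2 * (2 * α + 1) with hA
  have hA0 : 0 < A := by rw [hA]; linarith
  -- The bound `1/2` serves the affinity estimate, the other one the absorption by the prior tail;
  -- `t` depends on `α` and `C₂` only.
  set t : ℝ := min (1 / 2) (C₂ / (4 * (A + 2))) with ht
  have ht0 : 0 < t := lt_min (by norm_num) (by positivity)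
  have ht2 : t ≤ 1 / 2 := min_le_left _ _
  have htA : t * (A + 2) ≤ C₂ / 4 := by
    calc t * (A + 2) ≤ C₂ / (4 * (A + 2)) * (A + 2) :=
          mul_le_mul_of_nonneg_right (min_le_right _ _) (by linarith)
      _ = C₂ / 4 := by field_simp
  set S : ℝ := ∑' k : ℕ, (1 + C₁) * Real.exp (-(C₂ / 4 * k * Real.log k)
    + k * Real.log (27 * K * Real.pi)) with hS
  have hSsum : Summable fun k : ℕ => (1 + C₁) * Real.exp (-(C₂ / 4 * k * Real.log k)
      + k * Real.log (27 * K * Real.pi)) :=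
    (summable_exp_neg_mul_log (by positivity) _).mul_left _
  have hS0 : 0 < S := hSsum.tsum_pos (fun k => by positivity) 0 (by positivity)
  set L : ℝ := Real.exp (3 * (Real.sqrt 2 * sobolevConst α B) + 1) with hL
  have hL0 : 0 < L := Real.exp_pos _
  -- In order: Gaussian against prior densities, `-log π(k₀)`, approximation error, and the evidence
  -- moment with `1/(1-t) ≤ 2`. The further factor `2/t` comes from dividing by `t n` and from
  -- rounding in `k₀`.
  set M' : ℝ := 1 + 2 * |c₀'| + 2 * (c₁' * (B ^ 2 + 2 * 2 ^ (2 * α + 1)))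
    + (|Real.log C₃| + C₄) + L * (B ^ 2 + 2) + 2 * (4 * gridConst + 1 + |Real.log S|) with hM'
  have hg := gridConst_nonneg
  have hM0 : 0 < M' := by positivity
  refine ⟨2 * M' / t, by positivity, ?_⟩
  intro π f hf hπ hπ' hup hlo θ hθ n hn Qhat hQ
  have hn2 : 2 ≤ n := hn₀.trans hn
  have hn0 : (0 : ℝ) < n := by exact_mod_cast (by omega : 0 < n)
  have hθs := summable_of_mem_sobolevBall hα hθ
  have hfK := density_le_of_densityUpper hα hn₀ hup (by linarith) hK
  have hlow := densityLower_all hα hn₀ hlo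
  set k := sieveDim α n with hk
  have hk2 : 2 ≤ k := two_le_sieveDim hα hn2
  have hk2' : (2 : ℝ) ≤ k := by exact_mod_cast hk2
  have hlog := half_lt_log hn2
  obtain ⟨hπ0, hπlog⟩ := neg_log_prior_le hα hC₃ hC₄ hn2 hn hπ'
  -- Every contribution is measured in units of `k₀ log n`, which lies between `n` times the squared
  -- rate and twice that.
  set w : ℝ := k * Real.log n with hw
  have hw1 : 1 ≤ w := by nlinarith
  have hkw : (k : ℝ) ≤ 2 * w := by nlinarith
  have hmom := envelope_moment_le (θ₀ := θ) hθs hf hK1 hfK hC₁ hC₂ hπ hα ht0 ht2 htA hn2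
  set E : ℝ := Real.exp (4 * gridConst) * (Real.exp w * S) with hE
  have hE0 : 0 < E := by positivity
  have hlogE : Real.log E = 4 * gridConst + (w + Real.log S) := by
    rw [hE, Real.log_mul (Real.exp_ne_zero _) (by positivity), Real.log_exp,
      Real.log_mul (Real.exp_ne_zero _) hS0.ne', Real.log_exp]
  refine (lintegral_risk_le hf hlow (by omega) hπ0 hθs ht0 ht2 hE0 hmom hQ).trans
    (ENNReal.ofReal_le_ofReal ?_)
  have happ := approximation_le hα hθ (by omega : 0 < k) (sieveDim_le hα hn2)
  have hsum := sum_coords_sobolev_le (c₀' := c₀') hα hc₁' hn2 hθ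
  have hrate : n * sqRate α n ≤ w := by
    rw [mul_sqRate hα hn2]
    exact mul_le_mul_of_nonneg_right (sieveRoot_le α n) (by linarith)
  have hwrate : w ≤ 2 * (n * sqRate α n) := by
    rw [mul_sqRate hα hn2, ← mul_assoc]
    exact mul_le_mul_of_nonneg_right (sieveDim_le_two_mul hα hn2) (by linarith)
  have happ' : n * (∫ θ', logPartition (truncate k θ') ∂sieveGaussian θ (1 / n) k
      - logPartition θ + ∫ x in Set.Icc (0 : ℝ) 1,
        expDensity θ x * (logSeries θ x - logSeries (truncate k θ) x))
      ≤ L * (B ^ 2 + 2) * w := by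
    have h1 := mul_le_mul_of_nonneg_left happ hn0.le
    have h2 : n * (L * ((k : ℝ) ^ (-(2 * α)) * B ^ 2 + k / n))
        = L * (n * (k : ℝ) ^ (-(2 * α)) * B ^ 2 + k) := by field_simp
    have h3 : n * (k : ℝ) ^ (-(2 * α)) * B ^ 2 ≤ w * B ^ 2 :=
      mul_le_mul_of_nonneg_right ((mul_sieveDim_rpow_le hα hn2).trans hrate) (sq_nonneg B)
    have h4 : L * (n * (k : ℝ) ^ (-(2 * α)) * B ^ 2 + k) ≤ L * (w * B ^ 2 + 2 * w) :=
      mul_le_mul_of_nonneg_left (add_le_add h3 hkw) hL0.le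
    linarith
  have hsum' : ∑ j ∈ coords k, (Real.log n / 2
        + (c₀' + c₁' * ((j : ℕ) : ℝ) ^ (2 * α + 1) * (θ j ^ 2 + 1 / n)))
      ≤ (1 + 2 * |c₀'| + 2 * (c₁' * (B ^ 2 + 2 * 2 ^ (2 * α + 1)))) * w := by
    have h1 : (k : ℝ) * c₀' ≤ 2 * w * |c₀'| :=
      (mul_le_mul_of_nonneg_left (le_abs_self _) (by linarith)).trans
        (mul_le_mul_of_nonneg_right hkw (abs_nonneg _))
    have h2 : (k : ℝ) * (c₁' * (B ^ 2 + 2 * 2 ^ (2 * α + 1)))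
        ≤ 2 * w * (c₁' * (B ^ 2 + 2 * 2 ^ (2 * α + 1))) :=
      mul_le_mul_of_nonneg_right hkw (by positivity)
    linarith
  have hElog : 1 / (1 - t) * Real.log E ≤ 2 * (4 * gridConst + 1 + |Real.log S|) * w := by
    have h1 : Real.log E ≤ (4 * gridConst + 1 + |Real.log S|) * w := by
      rw [hlogE]
      have h2 : 4 * gridConst ≤ 4 * gridConst * w := le_mul_of_one_le_right (by positivity) hw1
      have h3 : Real.log S ≤ |Real.log S| * w :=
        (le_abs_self _).trans (le_mul_of_one_le_right (abs_nonneg _) hw1)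
      linarith
    have h4 : 1 / (1 - t) ≤ 2 := by
      rw [div_le_iff₀ (by linarith)]
      linarith
    have h5 : 0 < 1 / (1 - t) := one_div_pos.2 (by linarith)
    have h6 : 0 ≤ (4 * gridConst + 1 + |Real.log S|) * w := by positivity
    calc _ ≤ 1 / (1 - t) * ((4 * gridConst + 1 + |Real.log S|) * w) :=
          mul_le_mul_of_nonneg_left h1 h5.le
      _ ≤ 2 * ((4 * gridConst + 1 + |Real.log S|) * w) := mul_le_mul_of_nonneg_right h4 h6
      _ = _ := (mul_assoc _ _ _).symm
  have hC₃' : |Real.log C₃| ≤ |Real.log C₃| * w := le_mul_of_one_le_right (abs_nonneg _) hw1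
  change _ ≤ 2 * M' / t * sqRate α n
  rw [one_div, inv_mul_le_iff₀ (by positivity)]
  have hfin : M' * w ≤ M' * (2 * (n * sqRate α n)) := mul_le_mul_of_nonneg_left hwrate hM0.le
  have e : t * n * (2 * M' / t * sqRate α n) = M' * (2 * (n * sqRate α n)) := by field_simp
  rw [e]
  refine le_trans ?_ hfin
  rw [hM']
  linarith
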